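/- A partial matching is a finite graph on the vertex set $\{1,\dots,m\}$ all of whose vertices have degree at most one. Its lattice presentation $\Delta\subset\mathbb{R}^2$ consists of the points $(x,y)$ and $(y,x)$ for each arc joining $x$ and $y$. A lattice polytope $P$ is given by two finite sets $\mathrm{Ver}_0(P),\mathrm{Ver}_1(P)\subset\mathbb{R}^2$ (initial and terminal vertices) such that within each set the $x$-components are distinct and the $y$-components are distinct, and the two sets have the same $x$-components and the same $y$-components. Its edges are the nondegenerate segments parallel to an axis that join a point of $\mathrm{Ver}_0(P)$ to a point of $\mathrm{Ver}_1(P)$; horizontal edges are oriented from $\mathrm{Ver}_0(P)$ to $\mathrm{Ver}_1(P)$, vertical edges from $\mathrm{Ver}_1(P)$ to $\mathrm{Ver}_0(P)$. The union of the edges is $\partial P$; points in $\mathrm{Ver}_0(P)\cap \mathrm{Ver}_1(P)$ are isolated vertices; a crossing is a transverse intersection of two edges. As a subset of the plane, $P$ is the union of $\partial P$, the vertices, and the components of $\mathbb{R}^2\setminus\partial P$ about which $\partial P$ has nonzero rotation number. Let $-P^*$ be the lattice polytope with $\mathrm{Ver}_i(-P^*)=\mathrm{Ver}_i(P)^*$,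 where $(x,y)^*=(y,x)$. $P$ is associated with lattice presentations $\Delta,\Delta'$ if $\Delta=\mathrm{Ver}_0(P)\sqcup \mathrm{Ver}_0(P)^*$ and $\Delta'=\mathrm{Ver}_1(P)\sqcup \mathrm{Ver}_1(P)^*$. For two points $v\neq w$ of a set $V$, the transformation by the rectangle $R(v,w)$ with diagonal vertices $v,w$ replaces $v,w$ by the other two vertices of the rectangle. A transformation of $P$ is a finite sequence of transformations by rectangles that leads from $\mathrm{Ver}_0(P)$ to $\mathrm{Ver}_1(P)$. A transformation $\Delta\to\Delta'$ is a finite sequence of transformations by pairs of rectangles $R_j\cup(-R_j^*)$, $R_j=R(v_j,w_j)$, where $v_j,w_j$ are points of the current presentation that come from two different arcs, leading from $\Delta$ to $\Delta'$. The area of either kind of transformation is $\sum_j|\mathrm{Area}(R_j)|$. Let $f(P)$ (resp. $f(\Delta,\Delta')$) be the number of transformations of $P$ (resp. $\Delta\to\Delta'$) whose area is minimal among all such transformations. Consider the following conditions on $P$. (1) There is $\epsilon\in\{+1,-1\}$ such that every embedded closed path in $\partial P$, traversed along the orientation of the edges, has rotation number $\epsilon$ about the region that it surrounds. (2) $P$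 and $-P^*$ are disjoint and, when crossings are regarded as vertices, $P$ is the union of simple lattice polytopes $P_1,\dots,P_m$ and $Q_{i1},\dots,Q_{in_i}$ $(i=1,\dots,m)$, each bounded by an embedded closed path in $\partial P$ that follows the orientation, such that for $i\ne j$ the set $P_i\cap P_j$ is empty or consists of one crossing in $\partial P_i\cap\partial P_j$, and $Q_{i1},\dots,Q_{in_i}$ are mutually disjoint and contained in the interior of $P_i$; moreover there is no cyclic sequence $P_{i_1},\dots,P_{i_r},P_{i_{r+1}}=P_{i_1}$ $(r\ge 2)$ in which $P_{i_k}$ and $P_{i_{k+1}}$ are distinct and share a crossing that is a terminal vertex of $P_{i_k}$ and an initial vertex of $P_{i_{k+1}}$, for all $k$. For $V=\{(x_1,y_1),\dots,(x_n,y_n)\}$ with $x_1<\dots<x_n$ let $\sigma(j)$ be the rank of $y_j$ among the $y$-components; this gives permutations $\sigma_i(P)\in\mathfrak S_n$ of $\mathrm{Ver}_i(P)$, $i=0,1$. $P$ and $P'$ are equivalent if the pair $(\sigma_0(P),\sigma_1(P))$ is related to $(\sigma_0(P'),\sigma_1(P'))$ or to $(\sigma_0(P')^{-1},\sigma_1(P')^{-1})$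 by left and/or right multiplication of both entries by the order-reversing permutation (or is equal to it). Then: (a) If $P$ is associated with $\Delta,\Delta'$, $P$ and $-P^*$ are disjoint, and $P$ satisfies (1) or (2), then $f(\Delta,\Delta')=f(P)$. (b) If $P$ satisfies (1) or (2) and $P'$ is a lattice polytope equivalent to $P$, then $f(P)=f(P')$. (c) Consequently, if $P_i$ is associated with $\Delta_i,\Delta_i'$, $P_i$ and $-P_i^*$ are disjoint, and $P_i$ satisfies (1) or (2) $(i=1,2)$, and $P_1$ and $P_2$ are equivalent, then $f(\Delta_1,\Delta_1')=f(\Delta_2,\Delta_2')$. -/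

import Mathlib

noncomputable section

namespace LatticeMatching

/-- Points of the plane, with its `x`-component `p.1` and its `y`-component `p.2`. -/
abbrev Pt : Type := ℝ × ℝ

/-! ### Partial matchings and their lattice presentations -/

/-- A partial matching (chord diagram) on `m` vertices: every vertex has degree at most one. -/
structure PartialMatching (m : ℕ) where
  graph : SimpleGraph (Fin m)
  degree_le_one : ∀ i j k : Fin m, graph.Adj i j → graph.Adj i k → j = k

open Classical in
/-- The lattice presentation: the points `(x, y)` and `(y, x)` for each arc joining `x` and `y`,
where the vertices are labelled `1, ..., m` (so the element `i` of `Fin m` has label `i + 1`). -/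
def PartialMatching.presentation {m : ℕ} (δ : PartialMatching m) : Finset Pt :=
  (Finset.univ.filter fun e : Fin m × Fin m => δ.graph.Adj e.1 e.2).image
    fun e => (((e.1 : ℕ) : ℝ) + 1, ((e.2 : ℕ) : ℝ) + 1)

/-! ### Lattice polytopes -/

/-- A lattice polytope, given by its initial vertices `V0` and its terminal vertices `V1`.
These determine the edges: a vertex of `V0` and a vertex of `V1` are joined by an edge in the
`x`-direction (`y`-direction) when they are distinct and have the same `y`-component
(`x`-component); the points of `V0 ∩ V1` are the isolated vertices. -/
structure LatticePolytope where
  V0 : Finset Pt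
  V1 : Finset Pt
  x_injOn0 : Set.InjOn Prod.fst (V0 : Set Pt)
  y_injOn0 : Set.InjOn Prod.snd (V0 : Set Pt)
  x_injOn1 : Set.InjOn Prod.fst (V1 : Set Pt)
  y_injOn1 : Set.InjOn Prod.snd (V1 : Set Pt)
  x_eq : V0.image Prod.fst = V1.image Prod.fst
  y_eq : V0.image Prod.snd = V1.image Prod.snd

/-- Mirror reflection of a finite set of points in the line `x = y`. -/
def reflect (V : Finset Pt) : Finset Pt := V.image Prod.swap

theorem injOn_fst_reflect {V : Finset Pt} (h : Set.InjOn Prod.snd (V : Set Pt)) :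
    Set.InjOn Prod.fst (reflect V : Set Pt) := by
  intro p hp q hq hpq
  simp only [reflect, Finset.coe_image, Set.mem_image, Finset.mem_coe] at hp hq
  obtain ⟨p', hp', rfl⟩ := hp
  obtain ⟨q', hq', rfl⟩ := hq
  rw [h (Finset.mem_coe.2 hp') (Finset.mem_coe.2 hq') hpq]

theorem injOn_snd_reflect {V : Finset Pt} (h : Set.InjOn Prod.fst (V : Set Pt)) :
    Set.InjOn Prod.snd (reflect V : Set Pt) := by
  intro p hp q hq hpq
  simp only [reflect, Finset.coe_image, Set.mem_image, Finset.mem_coe] at hp hq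
  obtain ⟨p', hp', rfl⟩ := hp
  obtain ⟨q', hq', rfl⟩ := hq
  rw [h (Finset.mem_coe.2 hp') (Finset.mem_coe.2 hq') hpq]

theorem image_fst_reflect (V : Finset Pt) : (reflect V).image Prod.fst = V.image Prod.snd := by
  simp [reflect, Finset.image_image, Function.comp_def]

theorem image_snd_reflect (V : Finset Pt) : (reflect V).image Prod.snd = V.image Prod.fst := by
  simp [reflect, Finset.image_image, Function.comp_def]

/-- Contribution of the directed segment from `u` to `v`, parallel to the `y`-axis, to the
rotation number about `p`: the signed number of times it crosses the horizontal ray that starts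
at `p` and points to the right (`+1` for an upward crossing, `-1` for a downward one). -/
def rayCrossing (p u v : Pt) : ℤ :=
  if p.1 < u.1 then
    if u.2 ≤ p.2 ∧ p.2 < v.2 then 1 else if v.2 ≤ p.2 ∧ p.2 < u.2 then -1 else 0
  else 0

namespace LatticePolytope

/-- The orientation-reversed mirror reflection `-P^*` in the line `x = y`. -/
def mirror (P : LatticePolytope) : LatticePolytope where
  V0 := reflect P.V0
  V1 := reflect P.V1
  x_injOn0 := injOn_fst_reflect P.y_injOn0
  y_injOn0 := injOn_snd_reflect P.x_injOn0
  x_injOn1 := injOn_fst_reflect P.y_injOn1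
  y_injOn1 := injOn_snd_reflect P.x_injOn1
  x_eq := by rw [image_fst_reflect, image_fst_reflect, P.y_eq]
  y_eq := by rw [image_snd_reflect, image_snd_reflect, P.x_eq]

/-- `u → v` is an oriented edge in the `x`-direction. -/
def XEdge (P : LatticePolytope) (u v : Pt) : Prop :=
  u ∈ P.V0 ∧ v ∈ P.V1 ∧ u.2 = v.2 ∧ u ≠ v

/-- `u → v` is an oriented edge in the `y`-direction. -/
def YEdge (P : LatticePolytope) (u v : Pt) : Prop :=
  u ∈ P.V1 ∧ v ∈ P.V0 ∧ u.1 = v.1 ∧ u ≠ v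

/-- The boundary `∂P`: the union of the edges. -/
def boundary (P : LatticePolytope) : Set Pt :=
  {p | ∃ u v : Pt, (P.XEdge u v ∨ P.YEdge u v) ∧ p ∈ segment ℝ u v}

/-- The rotation number of `P` about a point outside `∂P`. -/
def rotation (P : LatticePolytope) (p : Pt) : ℤ :=
  ∑ u ∈ P.V1, ∑ v ∈ P.V0, if u.1 = v.1 then rayCrossing p u v else 0

/-- `P` as a subset of the plane: its boundary, the regions cut out by `∂P` with nonzero
rotation number, and its vertices (among them the isolated ones). -/
def carrier (P : LatticePolytope) : Set Pt :=
  P.boundary ∪ {p | p ∉ P.boundary ∧ P.rotation p ≠ 0} ∪ (P.V0 : Set Pt) ∪ (P.V1 : Set Pt)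

/-- A crossing: a transverse intersection point of two edges. -/
def IsCrossing (P : LatticePolytope) (c : Pt) : Prop :=
  ∃ u v u' v' : Pt, P.XEdge u v ∧ P.YEdge u' v' ∧
    c ∈ openSegment ℝ u v ∧ c ∈ openSegment ℝ u' v'

/-- `P` is a lattice polytope associated with the lattice presentations `Δ` and `Δ'`: together
with `-P^*` it has initial vertices `Δ` and terminal vertices `Δ'`, one half of each being
vertices of `P`. (This forces `Δ` and `Δ'` to have the same set of `x, y`-components.) -/
def IsAssociated (P : LatticePolytope) (Δ Δ' : Finset Pt) : Prop :=
  P.V0 ∪ P.mirror.V0 = Δ ∧ Disjoint P.V0 P.mirror.V0 ∧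
    P.V1 ∪ P.mirror.V1 = Δ' ∧ Disjoint P.V1 P.mirror.V1

end LatticePolytope

/-! ### Closed paths and simple lattice polytopes inside a lattice polytope -/

/-- A directed closed path
`a 0 → b 0 → a 1 → b 1 → ... → a n → b n → a 0` (indices modulo `n + 1`) whose segments
`a i → b i` are in the `x`-direction and whose segments `b i → a (i + 1)` are in the
`y`-direction. As a lattice polytope it has initial vertices `a i` and terminal
vertices `b i`. -/
structure ClosedPath where
  n : ℕ
  a : Fin (n + 1) → Pt
  b : Fin (n + 1) → Pt
  horizontal : ∀ i, (a i).2 = (b i).2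
  vertical : ∀ i, (b i).1 = (a (i + 1)).1

namespace ClosedPath

/-- The set of points on the path. -/
def trace (γ : ClosedPath) : Set Pt :=
  ⋃ i, segment ℝ (γ.a i) (γ.b i) ∪ segment ℝ (γ.b i) (γ.a (i + 1))

/-- The path is embedded: no segment is degenerate and two segments meet only in a corner at
which one follows the other. -/
def Embedded (γ : ClosedPath) : Prop :=
  (∀ i, γ.a i ≠ γ.b i ∧ γ.b i ≠ γ.a (i + 1)) ∧
  (∀ i j, i ≠ j → Disjoint (segment ℝ (γ.a i) (γ.b i)) (segment ℝ (γ.a j) (γ.b j))) ∧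
  (∀ i j, i ≠ j →
    Disjoint (segment ℝ (γ.b i) (γ.a (i + 1))) (segment ℝ (γ.b j) (γ.a (j + 1)))) ∧
  (∀ i j p, p ∈ segment ℝ (γ.a i) (γ.b i) → p ∈ segment ℝ (γ.b j) (γ.a (j + 1)) →
    (j = i ∧ p = γ.b i) ∨ (i = j + 1 ∧ p = γ.a i))

/-- The rotation number of the path about a point that does not lie on it. -/
def rotation (γ : ClosedPath) (p : Pt) : ℤ :=
  ∑ i, rayCrossing p (γ.b i) (γ.a (i + 1))

/-- The points surrounded by the path. -/
def inside (γ : ClosedPath) : Set Pt := {p | p ∉ γ.trace ∧ γ.rotation p ≠ 0}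

/-- The closed region bounded by the path; a closed disk if the path is embedded. -/
def region (γ : ClosedPath) : Set Pt := γ.trace ∪ γ.inside

/-- The path runs in `∂P`, along edges of `P` and in the direction of these edges. -/
def RunsIn (γ : ClosedPath) (P : LatticePolytope) : Prop :=
  ∀ i,
    (∃ u v, P.XEdge u v ∧ γ.a i ∈ segment ℝ u v ∧ γ.b i ∈ segment ℝ (γ.a i) v) ∧
    (∃ u v, P.YEdge u v ∧ γ.b i ∈ segment ℝ u v ∧ γ.a (i + 1) ∈ segment ℝ (γ.b i) v)

end ClosedPath

namespace LatticePolytope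

/-- Condition (1): for one sign `ε`, every embedded closed path in `∂P` has rotation number `ε`
about the region that it surrounds. -/
def Condition1 (P : LatticePolytope) : Prop :=
  ∃ ε : ℤ, (ε = 1 ∨ ε = -1) ∧
    ∀ γ : ClosedPath, γ.Embedded → γ.RunsIn P → ∀ p ∈ γ.inside, γ.rotation p = ε

/-- Condition (2): `P` and `-P^*` are disjoint and, with crossings regarded as vertices, `P` is
the union of simple lattice polytopes `A i` and `B i j` such that two distinct `A i` are disjoint
or meet in one crossing on both of their boundaries, and the `B i j`, for fixed `i`, are disjoint
and contained in the interior of `A i`. The `A i` must not be linked to a closed ring, in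
which every member meets the next one in a crossing that is a terminal vertex of the
former and an initial vertex of the latter. -/
def Condition2 (P : LatticePolytope) : Prop :=
  Disjoint P.carrier P.mirror.carrier ∧
  ∃ (m : ℕ) (A : Fin m → ClosedPath) (n : Fin m → ℕ) (B : ∀ i : Fin m, Fin (n i) → ClosedPath),
    (∀ i, (A i).Embedded ∧ (A i).RunsIn P) ∧
    (∀ i j, (B i j).Embedded ∧ (B i j).RunsIn P) ∧
    P.boundary = (⋃ i, (A i).trace) ∪ ⋃ i, ⋃ j, (B i j).trace ∧
    (∀ i j, i ≠ j → (A i).region ∩ (A j).region = ∅ ∨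
      ∃ c, P.IsCrossing c ∧ c ∈ (A i).trace ∩ (A j).trace ∧
        (A i).region ∩ (A j).region = {c}) ∧
    (∀ i j k, j ≠ k → Disjoint (B i j).region (B i k).region) ∧
    (∀ i j, (B i j).region ⊆ (A i).inside) ∧
    (∀ i, ¬ Relation.TransGen
      (fun k l : Fin m => k ≠ l ∧ ∃ c, c ∈ Set.range (A k).b ∧ c ∈ Set.range (A l).a) i i)

end LatticePolytope

/-! ### Transformations by rectangles and their area

A rectangle `R(v, w)` is recorded by its diagonal `s(v, w)`. -/

/-- `|Area(R(v, w))|`. -/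
def rectArea : Sym2 Pt → ℝ :=
  Sym2.lift ⟨fun v w => |v.1 - w.1| * |v.2 - w.2|, fun v w => by
    simp only [abs_sub_comm]⟩

/-- The other diagonal `{(x(w), y(v)), (x(v), y(w))}` of the rectangle `R(v, w)`. -/
def otherDiagonal : Sym2 Pt → Sym2 Pt :=
  Sym2.lift ⟨fun v w => s((w.1, v.2), (v.1, w.2)), fun _ _ => Sym2.eq_swap⟩

/-- The mirror image of a rectangle in the line `x = y`. -/
def mirrorRect (r : Sym2 Pt) : Sym2 Pt := r.map Prod.swap

/-- `t(V, R(v, w))`: remove `v, w` and add the other two vertices of the rectangle. -/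
def transform (V : Finset Pt) (r : Sym2 Pt) : Finset Pt :=
  (V \ r.toFinset) ∪ (otherDiagonal r).toFinset

/-- The list of rectangles is a transformation of lattice polytopes from the initial vertices `V`
to the terminal vertices `V'`: each rectangle is `R(v, w)` with `v ≠ w` among the
current initial vertices. -/
def IsTransformation : List (Sym2 Pt) → Finset Pt → Finset Pt → Prop
  | [], V, V' => V = V'
  | r :: L, V, V' =>
      (∃ v ∈ V, ∃ w ∈ V, v ≠ w ∧ r = s(v, w)) ∧ IsTransformation L (transform V r) V'

/-- The list `R_1, ..., R_k` describes a transformation of lattice presentations from `Δ` to `Δ'`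
by the rectangles `R_j ∪ (-R_j^*)`: each `R_j` is `R(v, w)`, where `v, w` are points of the
current presentation that come from two different arcs. -/
def IsPresentationTransformation : List (Sym2 Pt) → Finset Pt → Finset Pt → Prop
  | [], Δ, Δ' => Δ = Δ'
  | r :: L, Δ, Δ' =>
      (∃ v ∈ Δ, ∃ w ∈ Δ, v ≠ w ∧ v ≠ w.swap ∧ r = s(v, w)) ∧
        IsPresentationTransformation L (transform (transform Δ r) (mirrorRect r)) Δ'

/-- The area of a transformation: the sum of the areas of its rectangles `R_j`. -/
def totalArea (L : List (Sym2 Pt)) : ℝ := (L.map rectArea).sum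

/-- `f(P)`: the number of transformations of `P` whose area is minimal. -/
def LatticePolytope.f (P : LatticePolytope) : ℕ∞ :=
  {L | IsTransformation L P.V0 P.V1 ∧
    ∀ L', IsTransformation L' P.V0 P.V1 → totalArea L ≤ totalArea L'}.encard

/-- `f(Δ, Δ')`: the number of transformations from `Δ` to `Δ'` whose area is minimal. A
transformation is the sequence of the pairs `{R_j, -R_j^*}`; so lists that differ
only by the choice of one member in each pair count once. -/
def presentationF (Δ Δ' : Finset Pt) : ℕ∞ :=
  ((fun L : List (Sym2 Pt) => L.map fun r => s(r, mirrorRect r)) ''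
    {L | IsPresentationTransformation L Δ Δ' ∧
      ∀ L', IsPresentationTransformation L' Δ Δ' → totalArea L ≤ totalArea L'}).encard

/-! ### Equivalence of lattice polytopes -/

/-- `σ` is the permutation of the point set `V = {(x_1, y_1), ..., (x_n, y_n)}`, where
`x_1 < ... < x_n`: the `y`-component `y_j` is the `σ(j)`-th smallest one. -/
def HasPermutation {n : ℕ} (V : Finset Pt) (σ : Equiv.Perm (Fin n)) : Prop :=
  ∃ x y : Fin n → ℝ, StrictMono x ∧ StrictMono y ∧
    V = Finset.univ.image fun j => (x j, y (σ j))

/-- Equivalence of lattice polytopes: the pairs of permutations of the initial and of the terminal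
vertices are related, possibly after inverting both permutations of one pair, by right and left
multiplication by the order-reversing permutation. -/
def LatticePolytope.Equivalent (P P' : LatticePolytope) : Prop :=
  ∃ (n : ℕ) (σ₀ σ₁ τ₀ τ₁ : Equiv.Perm (Fin n)),
    HasPermutation P.V0 σ₀ ∧ HasPermutation P.V1 σ₁ ∧
    HasPermutation P'.V0 τ₀ ∧ HasPermutation P'.V1 τ₁ ∧
    ∃ l r : Equiv.Perm (Fin n), (l = 1 ∨ l = Fin.revPerm) ∧ (r = 1 ∨ r = Fin.revPerm) ∧
      ((σ₀ = l * τ₀ * r ∧ σ₁ = l * τ₁ * r) ∨ (σ₀ = l * τ₀⁻¹ * r ∧ σ₁ = l * τ₁⁻¹ * r))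

end LatticeMatching

end

/-! For a point `p`, let `quadSum V p` count the points of `V` strictly above and to the right of
`p`. Replacing one diagonal of a rectangle by the other subtracts from this count plus or minus the
indicator of the half-open rectangle. The signed rectangles of any transformation of `P` therefore
add up to `quadSum P.V0 - quadSum P.V1`, which is the rotation number of `P`. Integrating absolute
values bounds the area from below by the integral of the absolute rotation number, with equality
exactly when no point is covered by rectangles of opposite signs (`Coherent`, `coherent_iff`). As
soon as one coherent transformation exists (`HasCoherent`), the minimal ones are precisely the
coherent ones (`minimal_iff_coherent`).

This proves (b): whether two rectangles of opposite sign overlap depends only on the order of the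
coordinates of their vertices (`conflict_iff`), so coherent transformations are carried along
monotone or antitone changes of either coordinate and along the reflection.

For (a), the same bound is applied to a presentation transformation together with the mirror images
of its rectangles. The total is now the rotation number of `P` plus its reflection, and the supports
of the two summands are disjoint. In the coherent case every closed rectangle lies in the union of
these two closed sets and is connected, so it lies in one of them (`rect_in_half`). Choosing in each
mirror pair the member on the side of `P` gives a bijection with the coherent transformations of
`P`.

It remains to produce a coherent transformation. If the rotation number has one sign, the exchange
argument for the Bruhat order supplies rectangles of that sign only
(`exists_signed_transformation`). Under (1), closed walks along the edges are cut into embedded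
closed paths, whose contributions all have the sign `ε` (`Walk.sign`). Under (2), each outer path
together with its holes has a rotation number of one sign, by a discrete Jordan curve argument
(`Embedded.exists_sign`). The groups are processed in an order permitted by the absence of closed
rings, and the lists can be concatenated coherently because different groups are nonzero at
different points. -/

namespace LatticeMatching

/-! ### Quadrant counts and rectangles -/

/-- The indicator of `s < x`. -/
noncomputable def step (s x : ℝ) : ℤ := if s < x then 1 else 0

/-- The indicator of the event that `v` lies strictly above and to the right of `p`. -/
noncomputable def quad (p v : Pt) : ℤ := step p.1 v.1 * step p.2 v.2

/-- The number of points of `V` strictly above and to the right of `p`. -/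
noncomputable def quadSum (V : Finset Pt) (p : Pt) : ℤ := ∑ v ∈ V, quad p v

/-- The change of `quadSum` under the transformation by a rectangle: plus or minus the
indicator of the half-open rectangle. -/
noncomputable def rectFun (r : Sym2 Pt) (p : Pt) : ℤ :=
  Sym2.lift ⟨fun v w : Pt => (step p.1 v.1 - step p.1 w.1) * (step p.2 v.2 - step p.2 w.2),
    fun v w => by ring⟩ r

theorem rectFun_mk (v w p : Pt) : rectFun s(v, w) p =
    (step p.1 v.1 - step p.1 w.1) * (step p.2 v.2 - step p.2 w.2) := rfl

theorem step_sub_step (s x y : ℝ) : step s x - step s y =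
    if y ≤ s ∧ s < x then 1 else if x ≤ s ∧ s < y then -1 else 0 := by
  unfold step
  split_ifs <;> first | rfl | (exfalso; grind)

/-- This identity turns the rotation number into a difference of quadrant counts; both sides vanish
when the segment is degenerate. -/
theorem rayCrossing_eq {p u v : Pt} (h : u.1 = v.1) :
    rayCrossing p u v = quad p v - quad p u := by
  unfold quad
  rw [h, ← mul_sub, step_sub_step]
  unfold rayCrossing step
  rw [h]
  split_ifs <;> rfl

/-- Distinct points have distinct `x`-components and distinct `y`-components. -/
def General (V : Finset Pt) : Prop :=
  Set.InjOn Prod.fst (V : Set Pt) ∧ Set.InjOn Prod.snd (V : Set Pt)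

/-- The sets have the same `x`-components and the same `y`-components. -/
def SameGrid (V V' : Finset Pt) : Prop :=
  V.image Prod.fst = V'.image Prod.fst ∧ V.image Prod.snd = V'.image Prod.snd

theorem General.fst_ne {V : Finset Pt} (h : General V) {v w : Pt} (hv : v ∈ V) (hw : w ∈ V)
    (hvw : v ≠ w) : v.1 ≠ w.1 := fun e => hvw (h.1 hv hw e)

theorem General.snd_ne {V : Finset Pt} (h : General V) {v w : Pt} (hv : v ∈ V) (hw : w ∈ V)
    (hvw : v ≠ w) : v.2 ≠ w.2 := fun e => hvw (h.2 hv hw e)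

theorem transform_mk (V : Finset Pt) (v w : Pt) :
    transform V s(v, w) = (V \ {v, w}) ∪ {(w.1, v.2), (v.1, w.2)} := by
  simp [transform, otherDiagonal, Sym2.toFinset_mk_eq]

theorem mem_transform_mk {V : Finset Pt} {v w z : Pt} :
    z ∈ transform V s(v, w) ↔
      (z ∈ V ∧ z ≠ v ∧ z ≠ w) ∨ z = (w.1, v.2) ∨ z = (v.1, w.2) := by
  rw [transform_mk]
  simp only [Finset.mem_union, Finset.mem_sdiff, Finset.mem_insert, Finset.mem_singleton, not_or]

theorem otherDiagonal_mk (v w : Pt) : otherDiagonal s(v, w) = s((w.1, v.2), (v.1, w.2)) := rfl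

theorem mirrorRect_mk (v w : Pt) : mirrorRect s(v, w) = s(v.swap, w.swap) := rfl

theorem rectArea_mk (v w : Pt) : rectArea s(v, w) = |v.1 - w.1| * |v.2 - w.2| := rfl

theorem General.transform {V : Finset Pt} (h : General V) {v w : Pt} (hv : v ∈ V) (hw : w ∈ V)
    (hvw : v ≠ w) : General (transform V s(v, w)) := by
  have h1 := h.fst_ne hv hw hvw
  have h2 := h.snd_ne hv hw hvw
  constructor
  · intro p hp q hq e
    rw [Finset.mem_coe, mem_transform_mk] at hp hq
    rcases hp with ⟨hp, hpv, hpw⟩ | rfl | rfl <;> rcases hq with ⟨hq, hqv, hqw⟩ | rfl | rfl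
    · exact h.1 hp hq e
    · exact absurd (h.1 hp hw e) hpw
    · exact absurd (h.1 hp hv e) hpv
    · exact absurd (h.1 hq hw e.symm) hqw
    · rfl
    · exact absurd e.symm h1
    · exact absurd (h.1 hq hv e.symm) hqv
    · exact absurd e h1
    · rfl
  · intro p hp q hq e
    rw [Finset.mem_coe, mem_transform_mk] at hp hq
    rcases hp with ⟨hp, hpv, hpw⟩ | rfl | rfl <;> rcases hq with ⟨hq, hqv, hqw⟩ | rfl | rfl
    · exact h.2 hp hq e
    · exact absurd (h.2 hp hv e) hpv
    · exact absurd (h.2 hp hw e) hpw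
    · exact absurd (h.2 hq hv e.symm) hqv
    · rfl
    · exact absurd e h2
    · exact absurd (h.2 hq hw e.symm) hqw
    · exact absurd e.symm h2
    · rfl

/-- General position keeps the two new points from already belonging to `V`, so no term is lost when
the union is formed as a finite set. -/
theorem sum_transform {M : Type*} [AddCommGroup M] (F : Pt → M) {V : Finset Pt} (h : General V)
    {v w : Pt} (hv : v ∈ V) (hw : w ∈ V) (hvw : v ≠ w) :
    ∑ z ∈ transform V s(v, w), F z = ∑ z ∈ V, F z - F v - F w + F (w.1, v.2) + F (v.1, w.2) := by
  have h1 := h.fst_ne hv hw hvw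
  have h2 := h.snd_ne hv hw hvw
  have hd : Disjoint (V \ {v, w}) {((w.1, v.2) : Pt), (v.1, w.2)} := by
    rw [Finset.disjoint_left]
    intro z hz hz'
    simp only [Finset.mem_sdiff, Finset.mem_insert, Finset.mem_singleton, not_or] at hz hz'
    rcases hz' with rfl | rfl
    · exact hz.2.2 (h.1 hz.1 hw rfl)
    · exact hz.2.1 (h.1 hz.1 hv rfl)
  rw [transform_mk, Finset.sum_union hd]
  have hsub : ({v, w} : Finset Pt) ⊆ V := by
    intro z hz
    simp only [Finset.mem_insert, Finset.mem_singleton] at hz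
    rcases hz with rfl | rfl <;> assumption
  have hne : ((w.1, v.2) : Pt) ≠ (v.1, w.2) := fun e => h1 (congrArg Prod.fst e).symm
  rw [← Finset.sum_sdiff hsub, Finset.sum_pair hvw, Finset.sum_pair hne]
  abel

theorem quadSum_transform {V : Finset Pt} (h : General V)
    {v w : Pt} (hv : v ∈ V) (hw : w ∈ V) (hvw : v ≠ w) (p : Pt) :
    quadSum (transform V s(v, w)) p = quadSum V p - rectFun s(v, w) p := by
  unfold quadSum
  rw [sum_transform _ h hv hw hvw, rectFun_mk]
  unfold quad
  ring

theorem sameGrid_transform {V : Finset Pt} {v w : Pt} (hv : v ∈ V) (hw : w ∈ V) :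
    SameGrid (transform V s(v, w)) V := by
  constructor
  · ext x
    simp only [Finset.mem_image, mem_transform_mk]
    constructor
    · rintro ⟨z, ⟨hz, -⟩ | rfl | rfl, rfl⟩
      exacts [⟨z, hz, rfl⟩, ⟨w, hw, rfl⟩, ⟨v, hv, rfl⟩]
    · rintro ⟨z, hz, rfl⟩
      by_cases hzv : z = v
      · exact ⟨_, Or.inr (Or.inr rfl), by rw [hzv]⟩
      by_cases hzw : z = w
      · exact ⟨_, Or.inr (Or.inl rfl), by rw [hzw]⟩
      exact ⟨z, Or.inl ⟨hz, hzv, hzw⟩, rfl⟩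
  · ext x
    simp only [Finset.mem_image, mem_transform_mk]
    constructor
    · rintro ⟨z, ⟨hz, -⟩ | rfl | rfl, rfl⟩
      exacts [⟨z, hz, rfl⟩, ⟨v, hv, rfl⟩, ⟨w, hw, rfl⟩]
    · rintro ⟨z, hz, rfl⟩
      by_cases hzv : z = v
      · exact ⟨_, Or.inr (Or.inl rfl), by rw [hzv]⟩
      by_cases hzw : z = w
      · exact ⟨_, Or.inr (Or.inr rfl), by rw [hzw]⟩
      exact ⟨z, Or.inl ⟨hz, hzv, hzw⟩, rfl⟩

/-- The transformation by the rectangle on the new points restores the set. -/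
theorem transform_otherDiagonal {V : Finset Pt} (h : General V)
    {v w : Pt} (hv : v ∈ V) (hw : w ∈ V) (hvw : v ≠ w) :
    transform (transform V s(v, w)) (otherDiagonal s(v, w)) = V := by
  have h1 := h.fst_ne hv hw hvw
  ext z
  rw [otherDiagonal_mk, mem_transform_mk, mem_transform_mk]
  constructor
  · rintro (⟨⟨hz, -⟩ | hz, hz1, hz2⟩ | rfl | rfl)
    · exact hz
    · exact absurd hz (not_or.2 ⟨hz1, hz2⟩)
    · exact hv
    · exact hw
  · intro hz
    by_cases hzv : z = v
    · exact Or.inr (Or.inl hzv)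
    by_cases hzw : z = w
    · exact Or.inr (Or.inr hzw)
    refine Or.inl ⟨Or.inl ⟨hz, hzv, hzw⟩, ?_, ?_⟩
    · rintro rfl; exact hzw (h.1 hz hw rfl)
    · rintro rfl; exact hzv (h.1 hz hv rfl)

theorem rectFun_otherDiagonal (r : Sym2 Pt) (p : Pt) :
    rectFun (otherDiagonal r) p = - rectFun r p := by
  induction r with
  | _ v w => rw [otherDiagonal_mk, rectFun_mk, rectFun_mk]; ring

theorem rectFun_mirrorRect (r : Sym2 Pt) (p : Pt) :
    rectFun (mirrorRect r) p = rectFun r p.swap := by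
  induction r with
  | _ v w => rw [mirrorRect_mk, rectFun_mk, rectFun_mk]; simp only [Prod.fst_swap, Prod.snd_swap]; ring

theorem rectArea_mirrorRect (r : Sym2 Pt) : rectArea (mirrorRect r) = rectArea r := by
  induction r with
  | _ v w => rw [mirrorRect_mk, rectArea_mk, rectArea_mk]; simp only [Prod.fst_swap, Prod.snd_swap]; ring

theorem IsTransformation.append {L L' : List (Sym2 Pt)} {V V' V'' : Finset Pt}
    (h : IsTransformation L V V') (h' : IsTransformation L' V' V'') :
    IsTransformation (L ++ L') V V'' := by
  induction L generalizing V with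
  | nil => cases h; exact h'
  | cons r L ih => exact ⟨h.1, ih h.2⟩

/-- The effects of the single steps telescope. Hence the sum of the signed rectangles depends only
on the two ends, which is what makes a lower bound for the area possible. -/
theorem IsTransformation.invariants {L : List (Sym2 Pt)} {V V' : Finset Pt} (hV : General V)
    (h : IsTransformation L V V') :
    General V' ∧ SameGrid V' V ∧
      ∀ p, (L.map fun r => rectFun r p).sum = quadSum V p - quadSum V' p := by
  induction L generalizing V with
  | nil => cases h; exact ⟨hV, ⟨rfl, rfl⟩, by simp⟩
  | cons r L ih =>
    obtain ⟨⟨v, hv, w, hw, hvw, rfl⟩, h⟩ := h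
    obtain ⟨h1, h2, h3⟩ := ih (hV.transform hv hw hvw) h
    have h4 := sameGrid_transform hv hw
    refine ⟨h1, ⟨h2.1.trans h4.1, h2.2.trans h4.2⟩, fun p => ?_⟩
    rw [List.map_cons, List.sum_cons, h3, quadSum_transform hV hv hw hvw]
    ring

/-! ### Area -/

/-- No point is covered both by a positive and by a negative rectangle. -/
def Coherent (L : List (Sym2 Pt)) : Prop :=
  ∀ r ∈ L, ∀ s ∈ L, ∀ p, 0 < rectFun r p → ¬ rectFun s p < 0

open MeasureTheory

theorem abs_step_sub_step (s x y : ℝ) :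
    |step s x - step s y| = if s ∈ Set.Ico (min x y) (max x y) then 1 else 0 := by
  rw [step_sub_step]
  simp only [Set.mem_Ico, min_le_iff, lt_max_iff]
  split_ifs <;> first | rfl | (exfalso; grind)

/-- The half-open rectangle with the given diagonal. -/
def halfOpen (v w : Pt) : Set Pt :=
  Set.Ico (min v.1 w.1) (max v.1 w.1) ×ˢ Set.Ico (min v.2 w.2) (max v.2 w.2)

open Classical in
theorem abs_rectFun_mk (v w p : Pt) :
    |rectFun s(v, w) p| = if p ∈ halfOpen v w then 1 else 0 := by
  rw [rectFun_mk, abs_mul, abs_step_sub_step, abs_step_sub_step]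
  unfold halfOpen
  rw [Set.mem_prod]
  split_ifs <;> first | rfl | (exfalso; tauto)

theorem rectFun_ne_zero_iff (v w p : Pt) : rectFun s(v, w) p ≠ 0 ↔ p ∈ halfOpen v w := by
  classical
  rw [← abs_pos, abs_rectFun_mk]
  split_ifs with h <;> simp [h]

theorem abs_rectFun_eq_indicator (v w : Pt) :
    (fun p => ((|rectFun s(v, w) p| : ℤ) : ℝ)) =
      (halfOpen v w).indicator fun _ => (1 : ℝ) := by
  classical
  ext p
  rw [abs_rectFun_mk, Set.indicator_apply]
  split_ifs <;> simp

theorem measurableSet_halfOpen (v w : Pt) : MeasurableSet (halfOpen v w) :=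
  measurableSet_Ico.prod measurableSet_Ico

theorem volume_halfOpen (v w : Pt) :
    volume (halfOpen v w) = ENNReal.ofReal |v.1 - w.1| * ENNReal.ofReal |v.2 - w.2| := by
  unfold halfOpen
  rw [Measure.volume_eq_prod, Measure.prod_prod, Real.volume_Ico, Real.volume_Ico,
    max_sub_min_eq_abs', max_sub_min_eq_abs']

theorem integrable_abs_rectFun (r : Sym2 Pt) :
    Integrable fun p => ((|rectFun r p| : ℤ) : ℝ) := by
  induction r with
  | _ v w =>
    rw [abs_rectFun_eq_indicator]
    refine (integrable_indicator_iff (measurableSet_halfOpen v w)).2 (integrableOn_const ?_)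
    rw [volume_halfOpen]
    exact ENNReal.mul_ne_top ENNReal.ofReal_ne_top ENNReal.ofReal_ne_top

theorem integral_abs_rectFun (r : Sym2 Pt) :
    ∫ p, ((|rectFun r p| : ℤ) : ℝ) = rectArea r := by
  induction r with
  | _ v w =>
    rw [abs_rectFun_eq_indicator, integral_indicator (measurableSet_halfOpen v w)]
    simp only [integral_const, smul_eq_mul, mul_one, Measure.real]
    rw [Measure.restrict_apply_univ, volume_halfOpen, ENNReal.toReal_mul, ENNReal.toReal_ofReal (abs_nonneg _),
      ENNReal.toReal_ofReal (abs_nonneg _), rectArea_mk]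

theorem measurable_rectFun (r : Sym2 Pt) : Measurable (rectFun r) := by
  induction r with
  | _ v w =>
    have h : ∀ x : ℝ, Measurable fun s => step s x := fun x =>
      Measurable.ite measurableSet_Iio measurable_const measurable_const
    exact (((h v.1).comp measurable_fst).sub ((h w.1).comp measurable_fst)).mul
      (((h v.2).comp measurable_snd).sub ((h w.2).comp measurable_snd))

theorem integrable_sum_abs (L : List (Sym2 Pt)) :
    Integrable (fun p => (((L.map fun r => |rectFun r p|).sum : ℤ) : ℝ)) ∧
      ∫ p, (((L.map fun r => |rectFun r p|).sum : ℤ) : ℝ) = totalArea L := by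
  induction L with
  | nil => simp [totalArea]
  | cons r L ih =>
    simp only [List.map_cons, List.sum_cons, Int.cast_add]
    refine ⟨(integrable_abs_rectFun r).add ih.1, ?_⟩
    rw [integral_add (integrable_abs_rectFun r) ih.1, ih.2, integral_abs_rectFun]
    simp [totalArea]

theorem measurable_sum_rectFun (L : List (Sym2 Pt)) :
    Measurable fun p => (L.map fun r => rectFun r p).sum := by
  induction L with
  | nil => simp
  | cons r L ih =>
    simp only [List.map_cons, List.sum_cons]
    exact (measurable_rectFun r).add ih

theorem abs_sum_map_le {α : Type*} (L : List α) (F : α → ℤ) :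
    |(L.map F).sum| ≤ (L.map fun r => |F r|).sum := by
  induction L with
  | nil => simp
  | cons r L ih =>
    simp only [List.map_cons, List.sum_cons]
    exact (abs_add_le _ _).trans (by gcongr)

theorem integrable_abs_sum (L : List (Sym2 Pt)) :
    Integrable (fun p => ((|(L.map fun r => rectFun r p).sum| : ℤ) : ℝ)) := by
  refine (integrable_sum_abs L).1.mono' ?_ (Filter.Eventually.of_forall fun p => ?_)
  · have h : Measurable fun n : ℤ => ((|n| : ℤ) : ℝ) := measurable_from_top
    exact (h.comp (measurable_sum_rectFun L)).aestronglyMeasurable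
  · rw [Real.norm_eq_abs, ← Int.cast_abs, abs_abs]
    exact Int.cast_le.2 (abs_sum_map_le L _)

theorem abs_sum_eq_of_sameSign {α : Type*} (L : List α) (F : α → ℤ)
    (h : ∀ r ∈ L, ∀ s ∈ L, 0 < F r → ¬ F s < 0) :
    |(L.map F).sum| = (L.map fun r => |F r|).sum := by
  by_cases hp : ∃ r ∈ L, 0 < F r
  · obtain ⟨r, hr, hr'⟩ := hp
    have hn : ∀ s ∈ L, 0 ≤ F s := fun s hs => not_lt.1 (h r hr s hs hr')
    rw [List.map_congr_left (g := F) fun s hs => abs_of_nonneg (hn s hs)]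
    refine abs_of_nonneg (List.sum_nonneg ?_)
    simpa using hn
  · push Not at hp
    have e : (L.map F).sum = -(L.map fun r => |F r|).sum := by
      rw [List.map_congr_left (g := fun s => -F s) fun s hs => abs_of_nonpos (hp s hs)]
      clear hp h
      induction L with
      | nil => simp
      | cons r L ih => simp only [List.map_cons, List.sum_cons, ih]; ring
    rw [e, abs_neg]
    refine abs_of_nonneg (List.sum_nonneg ?_)
    simp only [List.mem_map]
    rintro _ ⟨s, -, rfl⟩
    exact abs_nonneg _

theorem abs_sum_lt_of_mixed {α : Type*} (L : List α) (F : α → ℤ) {r s : α} (hr : r ∈ L)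
    (hs : s ∈ L) (h0 : 0 < F r) (h1 : F s < 0) :
    |(L.map F).sum| < (L.map fun r => |F r|).sum := by
  have key : (L.map F).sum ≤ (L.map fun r => |F r|).sum + 2 * F s := by
    clear hr h0
    induction L with
    | nil => simp at hs
    | cons t L ih =>
      simp only [List.map_cons, List.sum_cons]
      rcases List.mem_cons.1 hs with rfl | hs
      · have := (le_abs_self _).trans (abs_sum_map_le L F)
        rw [abs_of_neg h1]; linarith
      · have := ih hs
        have := le_abs_self (F t)
        linarith
  have key' : -(L.map fun r => |F r|).sum + 2 * F r ≤ (L.map F).sum := by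
    clear hs h1 key
    induction L with
    | nil => simp at hr
    | cons t L ih =>
      simp only [List.map_cons, List.sum_cons]
      rcases List.mem_cons.1 hr with rfl | hr
      · have := (neg_le_abs _).trans (abs_sum_map_le L F)
        rw [abs_of_pos h0]; linarith
      · have := ih hr
        have := neg_le_abs (F t)
        linarith
  rw [abs_lt]
  constructor <;> linarith

theorem integral_abs_le_totalArea (L : List (Sym2 Pt)) :
    ∫ p, ((|(L.map fun r => rectFun r p).sum| : ℤ) : ℝ) ≤ totalArea L := by
  rw [← (integrable_sum_abs L).2]
  refine integral_mono (integrable_abs_sum L) (integrable_sum_abs L).1 fun p => ?_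
  exact Int.cast_le.2 (abs_sum_map_le L _)

theorem exists_common_interval (a b a' b' s : ℝ) (h : s ∈ Set.Ico a b) (h' : s ∈ Set.Ico a' b') :
    Set.Ico s (min b b') ⊆ Set.Ico a b ∩ Set.Ico a' b' ∧ s < min b b' := by
  refine ⟨fun t ht => ?_, lt_min h.2 h'.2⟩
  rw [Set.mem_Ico, lt_min_iff] at ht
  exact ⟨⟨h.1.trans ht.1, ht.2.1⟩, ⟨h'.1.trans ht.1, ht.2.2⟩⟩

theorem step_sub_step_eq_of_mem {s t x y : ℝ} (hs : s ∈ Set.Ico (min x y) (max x y))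
    (ht : t ∈ Set.Ico (min x y) (max x y)) : step s x - step s y = step t x - step t y := by
  rw [step_sub_step, step_sub_step]
  simp only [Set.mem_Ico, min_le_iff, lt_max_iff] at hs ht
  split_ifs <;> first | rfl | (exfalso; grind)

theorem rectFun_eq_of_mem {v w p q : Pt} (hp : p ∈ halfOpen v w) (hq : q ∈ halfOpen v w) :
    rectFun s(v, w) p = rectFun s(v, w) q := by
  rw [rectFun_mk, rectFun_mk, step_sub_step_eq_of_mem hp.1 hq.1,
    step_sub_step_eq_of_mem hp.2 hq.2]

/-- This is the equality case of the triangle inequality under the integral. Since the rectangles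
are half-open, a conflict at one point persists on a small box with that point as lower left corner,
so a single conflict already costs positive area. -/
theorem coherent_iff (L : List (Sym2 Pt)) : Coherent L ↔
    totalArea L = ∫ p, ((|(L.map fun r => rectFun r p).sum| : ℤ) : ℝ) := by
  constructor
  · intro h
    rw [← (integrable_sum_abs L).2]
    congr 1
    ext p
    rw [abs_sum_eq_of_sameSign L _ fun r hr s hs => h r hr s hs p]
  · intro h r hr s hs p h0 h1
    rw [← (integrable_sum_abs L).2] at h
    have hle : (fun p => ((|(L.map fun r => rectFun r p).sum| : ℤ) : ℝ)) ≤ᵐ[volume]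
        fun p => (((L.map fun r => |rectFun r p|).sum : ℤ) : ℝ) :=
      Filter.Eventually.of_forall fun p => Int.cast_le.2 (abs_sum_map_le L _)
    have hae := (integral_eq_iff_of_ae_le (integrable_abs_sum L)
      (integrable_sum_abs L).1 hle).1 h.symm
    induction r with
    | _ v w =>
    induction s with
    | _ v' w' =>
    have hp := (rectFun_ne_zero_iff v w p).1 h0.ne'
    have hp' := (rectFun_ne_zero_iff v' w' p).1 h1.ne
    obtain ⟨hx, hx'⟩ := exists_common_interval _ _ _ _ _ hp.1 hp'.1
    obtain ⟨hy, hy'⟩ := exists_common_interval _ _ _ _ _ hp.2 hp'.2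
    -- Both rectangle functions keep their values at `p` on this box of positive measure.
    set U := Set.Ico p.1 (min (max v.1 w.1) (max v'.1 w'.1)) ×ˢ
      Set.Ico p.2 (min (max v.2 w.2) (max v'.2 w'.2)) with hU
    have hpos : volume U ≠ 0 := by
      rw [hU, Measure.volume_eq_prod, Measure.prod_prod, Real.volume_Ico, Real.volume_Ico]
      exact mul_ne_zero (ENNReal.ofReal_pos.2 (sub_pos.2 hx')).ne'
        (ENNReal.ofReal_pos.2 (sub_pos.2 hy')).ne'
    refine hpos (measure_mono_null (fun q hq => ?_) hae)
    have hq1 := hx hq.1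
    have hq2 := hy hq.2
    have e1 : rectFun s(v, w) q = rectFun s(v, w) p := rectFun_eq_of_mem ⟨hq1.1, hq2.1⟩ hp
    have e2 : rectFun s(v', w') q = rectFun s(v', w') p := rectFun_eq_of_mem ⟨hq1.2, hq2.2⟩ hp'
    have := abs_sum_lt_of_mixed L (fun r => rectFun r q) hr hs (by rw [e1]; exact h0)
      (by rw [e2]; exact h1)
    intro hc
    have hc' : |(L.map fun r => rectFun r q).sum| = (L.map fun r => |rectFun r q|).sum := by
      exact Int.cast_injective hc
    exact this.ne hc'

/-- If one of the lists with a given sum of signed rectangles is coherent, the lists of minimal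
area are the coherent ones. -/
theorem minimal_iff_coherent {ι : Type*} (T : ι → List (Sym2 Pt)) (p : ι → Prop)
    (D : Pt → ℤ) (hD : ∀ i, p i → ∀ q, ((T i).map fun r => rectFun r q).sum = D q)
    {i₀ : ι} (h0 : p i₀) (hc : Coherent (T i₀)) (i : ι) (hi : p i) :
    (∀ j, p j → totalArea (T i) ≤ totalArea (T j)) ↔ Coherent (T i) := by
  have hle : ∀ j, p j → ∫ q, ((|D q| : ℤ) : ℝ) ≤ totalArea (T j) := fun j hj => by
    have := integral_abs_le_totalArea (T j)
    simpa only [hD j hj] using this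
  have hco : ∀ j, p j → (Coherent (T j) ↔ totalArea (T j) = ∫ q, ((|D q| : ℤ) : ℝ)) :=
    fun j hj => by
      have := coherent_iff (T j)
      simpa only [hD j hj] using this
  rw [hco i hi]
  rw [hco i₀ h0] at hc
  exact ⟨fun h => le_antisymm ((h i₀ h0).trans hc.le) (hle i hi), fun h j hj => h ▸ hle j hj⟩

end LatticeMatching

namespace LatticeMatching

/-! ### Existence of transformations when the rotation number has one sign -/

/-- The number of points of `V` above height `t` and not to the right of `s`. -/
noncomputable def upperLeft (V : Finset Pt) (s t : ℝ) : ℕ := (V.filter fun v => v.1 ≤ s ∧ t < v.2).card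

theorem SameGrid.symm {V V' : Finset Pt} (h : SameGrid V V') : SameGrid V' V :=
  ⟨h.1.symm, h.2.symm⟩

theorem SameGrid.trans {V V' V'' : Finset Pt} (h : SameGrid V V') (h' : SameGrid V' V'') :
    SameGrid V V'' :=
  ⟨h.1.trans h'.1, h.2.trans h'.2⟩

theorem SameGrid.exists_fst {V V' : Finset Pt} (h : SameGrid V V') {v : Pt} (hv : v ∈ V) :
    ∃ v' ∈ V', v'.1 = v.1 := by
  have : v.1 ∈ V'.image Prod.fst := h.1 ▸ Finset.mem_image_of_mem _ hv
  simpa using Finset.mem_image.1 this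

theorem SameGrid.exists_snd {V V' : Finset Pt} (h : SameGrid V V') {v : Pt} (hv : v ∈ V) :
    ∃ v' ∈ V', v'.2 = v.2 := by
  have : v.2 ∈ V'.image Prod.snd := h.2 ▸ Finset.mem_image_of_mem _ hv
  simpa using Finset.mem_image.1 this

/-- The two counts together contain every point above height `p.2` once, and the number of these
depends only on the set of `y`-components. Upper-left counts can thus replace quadrant counts with
the sign reversed. -/
theorem quadSum_add_upperLeft {V : Finset Pt} (h : General V) (p : Pt) :
    quadSum V p + upperLeft V p.1 p.2 = ∑ y ∈ V.image Prod.snd, step p.2 y := by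
  rw [Finset.sum_image h.2, quadSum, upperLeft, Finset.card_filter]
  push_cast
  rw [← Finset.sum_add_distrib]
  refine Finset.sum_congr rfl fun v _ => ?_
  unfold quad step
  split_ifs <;> first | rfl | (exfalso; grind)

theorem quadSum_sub_quadSum {V V' : Finset Pt} (h : General V) (h' : General V')
    (hg : SameGrid V V') (p : Pt) :
    quadSum V p - quadSum V' p = upperLeft V' p.1 p.2 - upperLeft V p.1 p.2 := by
  have e := quadSum_add_upperLeft h p
  rw [hg.2, ← quadSum_add_upperLeft h' p] at e
  linarith

theorem upperLeft_eq_add (V : Finset Pt) (s : ℝ) {t t' : ℝ} (h : t ≤ t') :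
    upperLeft V s t = upperLeft V s t' + (V.filter fun v => v.1 ≤ s ∧ t < v.2 ∧ v.2 ≤ t').card := by
  unfold upperLeft
  rw [← Finset.card_union_of_disjoint]
  · congr 1
    ext v
    simp only [Finset.mem_filter, Finset.mem_union]
    grind
  · rw [Finset.disjoint_left]
    intro v hv hv'
    simp only [Finset.mem_filter] at hv hv'
    linarith [hv.2.2, hv'.2.2.2]

/-- The exchange step behind the description of the Bruhat order by quadrant counts. -/
theorem exists_positive_step {V V' : Finset Pt} (hV : General V) (hV' : General V')
    (hg : SameGrid V V') (hD : ∀ p, quadSum V' p ≤ quadSum V p) (hne : V ≠ V') :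
    ∃ v ∈ V, ∃ w ∈ V, v.1 < w.1 ∧ v.2 < w.2 ∧
      ∀ p ∈ halfOpen v w, quadSum V' p < quadSum V p := by
  have hle : ∀ s t, upperLeft V s t ≤ upperLeft V' s t := fun s t => by
    have h1 := quadSum_sub_quadSum hV hV' hg (s, t)
    have h2 := hD (s, t)
    simp only at h1
    omega
  have hex : (V \ V').Nonempty := by
    rw [Finset.nonempty_iff_ne_empty]
    intro he
    rw [Finset.sdiff_eq_empty_iff_subset] at he
    refine hne (Finset.Subset.antisymm he fun v' hv' => ?_)
    obtain ⟨v, hv, e⟩ := hg.symm.exists_fst hv'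
    rwa [← hV'.1 (he hv) hv' e]
  -- With `v` the leftmost point at which the sets differ, `V` and `V'` agree strictly to the left
  -- of `v`.
  obtain ⟨v, hv, hmin⟩ := Finset.exists_min_image (V \ V') Prod.fst hex
  rw [Finset.mem_sdiff] at hv
  have hcom : ∀ u ∈ V, u.1 < v.1 → u ∈ V' := fun u hu hlt => by
    by_contra hu'
    exact absurd (hmin u (Finset.mem_sdiff.2 ⟨hu, hu'⟩)) (not_le.2 hlt)
  have hcom' : ∀ u ∈ V', u.1 < v.1 → u ∈ V := fun u hu hlt => by
    obtain ⟨z, hz, e⟩ := hg.symm.exists_fst hu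
    rwa [← hV'.1 (hcom z hz (e ▸ hlt)) hu e]
  obtain ⟨v', hv', e⟩ := hg.exists_fst hv.1
  -- If `v'` were below `v`, the upper-left count of `V` at `(v.1, v'.2)` would exceed that of `V'`
  -- by the point `v`.
  have hy : v.2 < v'.2 := by
    rcases lt_trichotomy v.2 v'.2 with h | h | h
    · exact h
    · exact absurd (Prod.ext e h.symm ▸ hv') hv.2
    · exfalso
      refine absurd (hle v.1 v'.2) (not_le.2 (Finset.card_lt_card ?_))
      rw [Finset.ssubset_iff_of_subset]
      · exact ⟨v, by simp [hv.1, h], by simp [hv.2]⟩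
      · intro u hu
        simp only [Finset.mem_filter] at hu ⊢
        refine ⟨hcom' u hu.1 (lt_of_le_of_ne hu.2.1 fun h' => ?_), hu.2⟩
        rw [hV'.1 hu.1 hv' (h'.trans e.symm)] at hu
        exact lt_irrefl _ hu.2.2
  -- The point of `V` in the row of `v'` qualifies: to the left of `v` it would belong to `V'` and
  -- coincide with `v'`.
  have hex' : (V.filter fun u => v.1 < u.1 ∧ v.2 < u.2 ∧ u.2 ≤ v'.2).Nonempty := by
    obtain ⟨u, hu, e'⟩ := hg.symm.exists_snd hv'
    refine ⟨u, Finset.mem_filter.2 ⟨hu, ?_, e' ▸ hy, e'.le⟩⟩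
    rcases lt_trichotomy u.1 v.1 with h | h | h
    · have := hV'.2 (hcom u hu h) hv' e'
      rw [this, e] at h
      exact absurd h (lt_irrefl _)
    · rw [hV.1 hu hv.1 h] at e'
      exact absurd e' hy.ne
    · exact h
  obtain ⟨w, hw, hwmin⟩ := Finset.exists_min_image _ Prod.fst hex'
  rw [Finset.mem_filter] at hw
  refine ⟨v, hv.1, w, hw.1, hw.2.1, hw.2.2.1, fun p hp => ?_⟩
  obtain ⟨⟨hp1, hp2⟩, hp3, hp4⟩ := hp
  rw [min_eq_left hw.2.1.le] at hp1
  rw [max_eq_right hw.2.1.le] at hp2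
  rw [min_eq_left hw.2.2.1.le] at hp3
  rw [max_eq_right hw.2.2.1.le] at hp4
  have h1 := quadSum_sub_quadSum hV hV' hg p
  have h2 : p.2 ≤ v'.2 := (hp4.trans_le hw.2.2.2).le
  have h3 := hle p.1 v'.2
  -- In the strip of heights from `p.2` to `v'.2`, the minimality of `w` forces the points of `V`
  -- counted here to lie left of `v`, hence in `V'`; the point `v'` is counted only for `V'`. Adding
  -- the weak inequality at height `v'.2` gives the strict one at `p`.
  have h4 : (V.filter fun u => u.1 ≤ p.1 ∧ p.2 < u.2 ∧ u.2 ≤ v'.2).card <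
      (V'.filter fun u => u.1 ≤ p.1 ∧ p.2 < u.2 ∧ u.2 ≤ v'.2).card := by
    refine Finset.card_lt_card ?_
    rw [Finset.ssubset_iff_of_subset]
    · refine ⟨v', ?_, ?_⟩
      · simp [hv', e, hp1, hp4.trans_le hw.2.2.2]
      · simp only [Finset.mem_filter, not_and]
        intro h
        rw [hV.1 h hv.1 e] at hy
        exact absurd hy (lt_irrefl _)
    · intro u hu
      simp only [Finset.mem_filter] at hu ⊢
      refine ⟨hcom u hu.1 ?_, hu.2⟩
      by_contra hlt
      rcases (not_lt.1 hlt).eq_or_lt with h | h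
      · rw [hV.1 hv.1 hu.1 h] at hp3
        exact absurd hu.2.2.1 (not_lt.2 hp3)
      · have := hwmin u (Finset.mem_filter.2 ⟨hu.1, h, hp3.trans_lt hu.2.2.1, hu.2.2.2⟩)
        exact absurd (this.trans hu.2.1) (not_le.2 hp2)
  have h5 := upperLeft_eq_add V p.1 h2
  have h6 := upperLeft_eq_add V' p.1 h2
  omega

theorem rectFun_nonneg {v w : Pt} (h1 : v.1 < w.1) (h2 : v.2 < w.2) (p : Pt) :
    0 ≤ rectFun s(v, w) p := by
  rw [rectFun_mk]
  have key : ∀ s x y : ℝ, x < y → step s x - step s y ≤ 0 := fun s x y h => by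
    unfold step
    split_ifs <;> first | (norm_num; done) | (exfalso; grind)
  exact mul_nonneg_of_nonpos_of_nonpos (key _ _ _ h1) (key _ _ _ h2)

theorem rectFun_le_one (r : Sym2 Pt) (p : Pt) : rectFun r p ≤ 1 := by
  classical
  induction r with
  | _ v w =>
    refine (le_abs_self _).trans ?_
    rw [abs_rectFun_mk]
    split_ifs <;> simp

/-- A positive step towards `V'`, with its effect on the quadrant counts. -/
theorem exists_positive_transform {V V' : Finset Pt} (hV : General V) (hV' : General V')
    (hg : SameGrid V V') (hD : ∀ p, quadSum V' p ≤ quadSum V p) (hne : V ≠ V') :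
    ∃ v ∈ V, ∃ w ∈ V, v ≠ w ∧ (∀ p, 0 ≤ rectFun s(v, w) p) ∧
      (∀ p, quadSum V' p ≤ quadSum (transform V s(v, w)) p) ∧
      0 < rectFun s(v, w) v := by
  obtain ⟨v, hv, w, hw, h1, h2, h3⟩ := exists_positive_step hV hV' hg hD hne
  have hvw : v ≠ w := fun e => by rw [e] at h1; exact lt_irrefl _ h1
  have h4 := rectFun_nonneg h1 h2
  refine ⟨v, hv, w, hw, hvw, h4, fun p => ?_, ?_⟩
  · rw [quadSum_transform hV hv hw hvw]
    by_cases hp : p ∈ halfOpen v w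
    · have := h3 p hp
      have := rectFun_le_one s(v, w) p
      linarith
    · have := hD p
      rw [not_not.1 (mt (rectFun_ne_zero_iff v w p).1 hp)]
      linarith
  · refine lt_of_le_of_ne (h4 v) (Ne.symm ((rectFun_ne_zero_iff v w v).2 ?_))
    simp [halfOpen, h1, h2, h1.le, h2.le]

theorem sum_rectFun_pos {V' : Finset Pt} {G : Finset Pt} {r : Sym2 Pt}
    (h : ∀ p, 0 ≤ rectFun r p) {v : Pt} (hv : v ∈ G) (hpos : 0 < rectFun r v)
    {V W : Finset Pt} (hW : ∀ p, quadSum W p = quadSum V p - rectFun r p) :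
    ∑ p ∈ G, (quadSum W p - quadSum V' p) < ∑ p ∈ G, (quadSum V p - quadSum V' p) := by
  refine Finset.sum_lt_sum (fun p _ => ?_) ⟨v, hv, ?_⟩
  · rw [hW]; linarith [h p]
  · rw [hW]; linarith

theorem mem_grid {V W : Finset Pt} (h : SameGrid V W) {v : Pt} (hv : v ∈ V) :
    v ∈ W.image Prod.fst ×ˢ W.image Prod.snd := by
  rw [Finset.mem_product, ← h.1, ← h.2]
  exact ⟨Finset.mem_image_of_mem _ hv, Finset.mem_image_of_mem _ hv⟩

/-- Each positive step keeps the difference of counts nonnegative and lowers its sum over the finite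
grid, since it lowers the value at the lower left corner of the rectangle. The induction runs over a
bound for that sum. -/
theorem exists_transformation_of_le {V V' : Finset Pt} (hV : General V) (hV' : General V')
    (hg : SameGrid V V') (hD : ∀ p, quadSum V' p ≤ quadSum V p) :
    ∃ L, IsTransformation L V V' ∧ ∀ r ∈ L, ∀ p, 0 ≤ rectFun r p := by
  obtain ⟨N, hN⟩ : ∃ N : ℕ, ∑ p ∈ V'.image Prod.fst ×ˢ V'.image Prod.snd,
      (quadSum V p - quadSum V' p) ≤ N := ⟨_, Int.self_le_toNat _⟩
  induction N generalizing V with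
  | zero =>
    by_cases hne : V = V'
    · exact ⟨[], hne, by simp⟩
    obtain ⟨v, hv, w, hw, hvw, h1, h2, h3⟩ := exists_positive_transform hV hV' hg hD hne
    have h4 := sum_rectFun_pos (V' := V') h1 (mem_grid hg hv) h3 (quadSum_transform hV hv hw hvw)
    have h5 := Finset.sum_nonneg (s := V'.image Prod.fst ×ˢ V'.image Prod.snd)
      fun p _ => sub_nonneg.2 (h2 p)
    exact absurd (h5.trans_lt (h4.trans_le hN)) (by simp)
  | succ N ih =>
    by_cases hne : V = V'
    · exact ⟨[], hne, by simp⟩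
    obtain ⟨v, hv, w, hw, hvw, h1, h2, h3⟩ := exists_positive_transform hV hV' hg hD hne
    have h4 := sum_rectFun_pos (V' := V') h1 (mem_grid hg hv) h3 (quadSum_transform hV hv hw hvw)
    obtain ⟨L, hL, hL'⟩ := ih (hV.transform hv hw hvw) ((sameGrid_transform hv hw).trans hg) h2
      (by push_cast at hN; linarith)
    refine ⟨s(v, w) :: L, ⟨⟨v, hv, w, hw, hvw, rfl⟩, hL⟩, fun r hr => ?_⟩
    rcases List.mem_cons.1 hr with rfl | hr
    · exact h1
    · exact hL' r hr

/-- Running the moves backwards through the opposite diagonals changes every sign, which reduces the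
negative case to the positive one. -/
theorem IsTransformation.exists_reverse {L : List (Sym2 Pt)} {V V' : Finset Pt} (hV : General V)
    (h : IsTransformation L V V') :
    ∃ L', IsTransformation L' V' V ∧ ∀ r ∈ L', ∃ s ∈ L, ∀ p, rectFun r p = - rectFun s p := by
  induction L generalizing V with
  | nil => exact ⟨[], h.symm, by simp⟩
  | cons r L ih =>
    obtain ⟨⟨v, hv, w, hw, hvw, rfl⟩, h⟩ := h
    obtain ⟨L', h1, h2⟩ := ih (hV.transform hv hw hvw) h
    refine ⟨L' ++ [otherDiagonal s(v, w)], h1.append ⟨⟨(w.1, v.2), ?_, (v.1, w.2), ?_, ?_, rfl⟩,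
      transform_otherDiagonal hV hv hw hvw⟩, fun r hr => ?_⟩
    · exact mem_transform_mk.2 (Or.inr (Or.inl rfl))
    · exact mem_transform_mk.2 (Or.inr (Or.inr rfl))
    · exact fun e => hV.fst_ne hv hw hvw (congrArg Prod.fst e).symm
    · rcases List.mem_append.1 hr with hr | hr
      · obtain ⟨s, hs, hs'⟩ := h2 r hr
        exact ⟨s, List.mem_cons_of_mem _ hs, hs'⟩
      · rw [List.mem_singleton.1 hr]
        exact ⟨_, List.mem_cons_self, rectFun_otherDiagonal _⟩

/-- If the difference of the quadrant counts has one sign, there is a transformation by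
rectangles of that sign. -/
theorem exists_signed_transformation {V V' : Finset Pt} (hV : General V) (hV' : General V')
    (hg : SameGrid V V') {ε : ℤ} (hε : ε = 1 ∨ ε = -1)
    (hD : ∀ p, 0 ≤ ε * (quadSum V p - quadSum V' p)) :
    ∃ L, IsTransformation L V V' ∧ ∀ r ∈ L, ∀ p, 0 ≤ ε * rectFun r p := by
  rcases hε with rfl | rfl
  · obtain ⟨L, hL, h⟩ := exists_transformation_of_le hV hV' hg fun p => by linarith [hD p]
    exact ⟨L, hL, fun r hr p => by linarith [h r hr p]⟩
  · obtain ⟨L, hL, h⟩ := exists_transformation_of_le hV' hV hg.symm fun p => by linarith [hD p]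
    obtain ⟨L', hL', h'⟩ := hL.exists_reverse hV'
    refine ⟨L', hL', fun r hr p => ?_⟩
    obtain ⟨s, hs, e⟩ := h' r hr
    rw [e]
    linarith [h s hs p]

theorem coherent_of_signed {L : List (Sym2 Pt)} {ε : ℤ}
    (h : ∀ r ∈ L, ∀ p, 0 ≤ ε * rectFun r p) (hε : ε = 1 ∨ ε = -1) : Coherent L := by
  intro r hr s hs p h0 h1
  have a := h r hr p
  have b := h s hs p
  rcases hε with rfl | rfl <;> linarith

/-- Without mixed signs at `p` nothing can cancel. This confines each rectangle of a coherent list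
to the set where the total is nonzero. -/
theorem Coherent.sum_ne_zero {L : List (Sym2 Pt)} (hc : Coherent L) {r : Sym2 Pt} (hr : r ∈ L)
    {p : Pt} (hp : rectFun r p ≠ 0) : (L.map fun r => rectFun r p).sum ≠ 0 := by
  rw [← abs_pos, abs_sum_eq_of_sameSign _ _ fun r hr s hs => hc r hr s hs p]
  refine (abs_pos.2 hp).trans_le (List.single_le_sum ?_ _ (List.mem_map_of_mem hr))
  simp only [List.mem_map]
  rintro _ ⟨s, -, rfl⟩
  exact abs_nonneg _

end LatticeMatching

namespace LatticeMatching

/-! ### Coherence is combinatorial -/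

/-- The diagonal from `v` to `w` has positive slope. -/
def PosSlope (v w : Pt) : Prop := (v.1 < w.1 ∧ v.2 < w.2) ∨ (w.1 < v.1 ∧ w.2 < v.2)

/-- The diagonal from `v` to `w` has negative slope. -/
def NegSlope (v w : Pt) : Prop := (v.1 < w.1 ∧ w.2 < v.2) ∨ (w.1 < v.1 ∧ v.2 < w.2)

/-- Some endpoint in `{a, b}` is smaller than one in `{c, d}`. -/
def SomeLT (a b c d : ℝ) : Prop := a < c ∨ a < d ∨ b < c ∨ b < d

theorem halfOpen_otherDiagonal (v w : Pt) : halfOpen (w.1, v.2) (v.1, w.2) = halfOpen v w := by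
  unfold halfOpen
  rw [min_comm w.1, max_comm w.1]

theorem rectFun_pos_iff {v w p : Pt} :
    0 < rectFun s(v, w) p ↔ PosSlope v w ∧ p ∈ halfOpen v w := by
  constructor
  · intro h
    have hp := (rectFun_ne_zero_iff v w p).1 h.ne'
    refine ⟨?_, hp⟩
    have h1 : v.1 ≠ w.1 := fun e => by
      have := hp.1.1.trans_lt hp.1.2
      rw [e, min_self, max_self] at this
      exact lt_irrefl _ this
    have h2 : v.2 ≠ w.2 := fun e => by
      have := hp.2.1.trans_lt hp.2.2
      rw [e, min_self, max_self] at this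
      exact lt_irrefl _ this
    have key : ¬ NegSlope v w := by
      have e := rectFun_otherDiagonal s(v, w) p
      rw [otherDiagonal_mk] at e
      rintro (⟨a, b⟩ | ⟨a, b⟩)
      · rw [Sym2.eq_swap] at e
        have := rectFun_nonneg (v := (v.1, w.2)) (w := (w.1, v.2)) a b p
        linarith
      · have := rectFun_nonneg (v := (w.1, v.2)) (w := (v.1, w.2)) a b p
        linarith
    unfold PosSlope
    unfold NegSlope at key
    rcases h1.lt_or_gt with a | a <;> rcases h2.lt_or_gt with b | b <;> tauto
  · rintro ⟨h, hp⟩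
    have hp := (rectFun_ne_zero_iff v w p).2 hp
    refine lt_of_le_of_ne ?_ hp.symm
    rcases h with ⟨a, b⟩ | ⟨a, b⟩
    · exact rectFun_nonneg a b p
    · rw [Sym2.eq_swap]
      exact rectFun_nonneg a b p

theorem rectFun_neg_iff {v w p : Pt} :
    rectFun s(v, w) p < 0 ↔ NegSlope v w ∧ p ∈ halfOpen v w := by
  have e := rectFun_otherDiagonal s(v, w) p
  rw [otherDiagonal_mk] at e
  rw [← neg_pos, ← e, rectFun_pos_iff, halfOpen_otherDiagonal]
  unfold PosSlope NegSlope
  simp only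
  tauto

/-- The larger of the two left ends is the candidate for a common point, so overlapping is a matter
of comparing endpoints alone. -/
theorem exists_mem_Ico_iff {a b c d : ℝ} (h : a ≠ b) (h' : c ≠ d) :
    (∃ t, t ∈ Set.Ico (min a b) (max a b) ∧ t ∈ Set.Ico (min c d) (max c d)) ↔
      SomeLT a b c d ∧ SomeLT c d a b := by
  unfold SomeLT
  constructor
  · rintro ⟨t, h1, h2⟩
    simp only [Set.mem_Ico, min_le_iff, lt_max_iff] at h1 h2
    grind
  · intro hs
    refine ⟨max (min a b) (min c d), ?_⟩
    simp only [Set.mem_Ico, le_max_iff, max_lt_iff, lt_max_iff, min_lt_iff]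
    grind

/-- The rectangle `r` is positive, the rectangle `s` is negative, and they overlap. -/
def Conflict (r s : Sym2 Pt) : Prop := ∃ p, 0 < rectFun r p ∧ rectFun s p < 0

/-- The right side mentions only order relations between coordinates, so conflicts can be
transported without regard to lengths. -/
theorem conflict_iff {v w v' w' : Pt} : Conflict s(v, w) s(v', w') ↔
    PosSlope v w ∧ NegSlope v' w' ∧ (SomeLT v.1 w.1 v'.1 w'.1 ∧ SomeLT v'.1 w'.1 v.1 w.1) ∧
      SomeLT v.2 w.2 v'.2 w'.2 ∧ SomeLT v'.2 w'.2 v.2 w.2 := by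
  unfold Conflict
  simp only [rectFun_pos_iff, rectFun_neg_iff]
  by_cases h1 : PosSlope v w
  swap
  · simp [h1]
  by_cases h2 : NegSlope v' w'
  swap
  · simp [h2]
  have a : v.1 ≠ w.1 := by rcases h1 with h | h <;> [exact h.1.ne; exact h.1.ne']
  have b : v.2 ≠ w.2 := by rcases h1 with h | h <;> [exact h.2.ne; exact h.2.ne']
  have c : v'.1 ≠ w'.1 := by rcases h2 with h | h <;> [exact h.1.ne; exact h.1.ne']
  have d : v'.2 ≠ w'.2 := by rcases h2 with h | h <;> [exact h.2.ne'; exact h.2.ne]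
  rw [← exists_mem_Ico_iff a c, ← exists_mem_Ico_iff b d]
  simp only [h1, h2, true_and]
  constructor
  · rintro ⟨p, hp, hp'⟩
    exact ⟨⟨p.1, hp.1, hp'.1⟩, p.2, hp.2, hp'.2⟩
  · rintro ⟨⟨x, hx, hx'⟩, y, hy, hy'⟩
    exact ⟨(x, y), ⟨hx, hy⟩, hx', hy'⟩

theorem coherent_iff_not_conflict {L : List (Sym2 Pt)} :
    Coherent L ↔ ∀ r ∈ L, ∀ s ∈ L, ¬ Conflict r s := by
  simp only [Coherent, Conflict, not_exists, not_and]

/-! ### Transporting transformations -/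

/-- The map respects the comparison of elements of `X`, or reverses it. -/
def MonoOrAnti (g : ℝ → ℝ) (X : Set ℝ) : Prop :=
  (∀ a ∈ X, ∀ b ∈ X, g a < g b ↔ a < b) ∨ ∀ a ∈ X, ∀ b ∈ X, g a < g b ↔ b < a

/-- A map of the grid `X × Y` that carries rectangles to rectangles and preserves coherence. -/
structure GridMap (Ψ : Pt → Pt) (X Y : Set ℝ) : Prop where
  injOn : Set.InjOn Ψ (X ×ˢ Y)
  diag : ∀ r, otherDiagonal (r.map Ψ) = (otherDiagonal r).map Ψ
  conflict : ∀ v w v' w', v ∈ X ×ˢ Y → w ∈ X ×ˢ Y → v' ∈ X ×ˢ Y → w' ∈ X ×ˢ Y →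
    Conflict s(Ψ v, Ψ w) s(Ψ v', Ψ w') →
      Conflict s(v, w) s(v', w') ∨ Conflict s(v', w') s(v, w)

theorem MonoOrAnti.injOn {g : ℝ → ℝ} {X : Set ℝ} (h : MonoOrAnti g X) : Set.InjOn g X := by
  intro a ha b hb e
  rcases h with h | h <;>
  · have h1 := h a ha b hb
    have h2 := h b hb a ha
    rw [e] at h1 h2
    simp only [lt_irrefl, false_iff, not_lt] at h1 h2
    linarith

theorem someLT_of_mono {g : ℝ → ℝ} {X : Set ℝ} (h : ∀ a ∈ X, ∀ b ∈ X, g a < g b ↔ a < b)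
    {a b c d : ℝ} (ha : a ∈ X) (hb : b ∈ X) (hc : c ∈ X) (hd : d ∈ X) :
    SomeLT (g a) (g b) (g c) (g d) ↔ SomeLT a b c d := by
  unfold SomeLT
  rw [h a ha c hc, h a ha d hd, h b hb c hc, h b hb d hd]

theorem someLT_of_anti {g : ℝ → ℝ} {X : Set ℝ} (h : ∀ a ∈ X, ∀ b ∈ X, g a < g b ↔ b < a)
    {a b c d : ℝ} (ha : a ∈ X) (hb : b ∈ X) (hc : c ∈ X) (hd : d ∈ X) :
    SomeLT (g a) (g b) (g c) (g d) ↔ SomeLT c d a b := by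
  unfold SomeLT
  rw [h a ha c hc, h a ha d hd, h b hb c hc, h b hb d hd, @or_left_comm (d < a) (c < b)]

/-- Reversing exactly one coordinate exchanges positive and negative slopes, so the two rectangles
of a conflict change roles. Reversing both or neither preserves the slopes. Overlap of the
projections survives in every case. -/
theorem gridMap_prodMap {g h : ℝ → ℝ} {X Y : Set ℝ} (hg : MonoOrAnti g X) (hh : MonoOrAnti h Y) :
    GridMap (Prod.map g h) X Y where
  injOn := by
    rintro a ⟨ha, ha'⟩ b ⟨hb, hb'⟩ e
    exact Prod.ext (hg.injOn ha hb (congrArg Prod.fst e)) (hh.injOn ha' hb' (congrArg Prod.snd e))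
  diag r := by
    induction r with
    | _ v w => rfl
  conflict := by
    rintro v w v' w' ⟨a, a'⟩ ⟨b, b'⟩ ⟨c, c'⟩ ⟨d, d'⟩
    simp only [conflict_iff, Prod.map_fst, Prod.map_snd]
    have hp : ∀ v w : Pt, PosSlope v w ↔
        (v.1 < w.1 ∧ v.2 < w.2) ∨ (w.1 < v.1 ∧ w.2 < v.2) := fun _ _ => Iff.rfl
    have hn : ∀ v w : Pt, NegSlope v w ↔
        (v.1 < w.1 ∧ w.2 < v.2) ∨ (w.1 < v.1 ∧ v.2 < w.2) := fun _ _ => Iff.rfl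
    rcases hg with hg | hg <;> rcases hh with hh | hh
    · rw [someLT_of_mono hg a b c d, someLT_of_mono hg c d a b, someLT_of_mono hh a' b' c' d',
        someLT_of_mono hh c' d' a' b', hp (Prod.map g h v), hn (Prod.map g h v')]
      simp only [Prod.map_fst, Prod.map_snd]
      rw [hg _ a _ b, hg _ b _ a, hg _ c _ d, hg _ d _ c, hh _ a' _ b', hh _ b' _ a',
        hh _ c' _ d', hh _ d' _ c', ← hp, ← hn]
      exact Or.inl
    · rw [someLT_of_mono hg a b c d, someLT_of_mono hg c d a b, someLT_of_anti hh a' b' c' d',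
        someLT_of_anti hh c' d' a' b', hp (Prod.map g h v), hn (Prod.map g h v')]
      simp only [Prod.map_fst, Prod.map_snd]
      rw [hg _ a _ b, hg _ b _ a, hg _ c _ d, hg _ d _ c, hh _ a' _ b', hh _ b' _ a',
        hh _ c' _ d', hh _ d' _ c', ← hp, ← hn]
      exact fun h => Or.inr ⟨h.2.1, h.1, h.2.2.1.symm, h.2.2.2⟩
    · rw [someLT_of_anti hg a b c d, someLT_of_anti hg c d a b, someLT_of_mono hh a' b' c' d',
        someLT_of_mono hh c' d' a' b', hp (Prod.map g h v), hn (Prod.map g h v')]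
      simp only [Prod.map_fst, Prod.map_snd]
      rw [hg _ a _ b, hg _ b _ a, hg _ c _ d, hg _ d _ c, hh _ a' _ b', hh _ b' _ a',
        hh _ c' _ d', hh _ d' _ c', or_comm, ← hn, or_comm, ← hp]
      exact fun h => Or.inr ⟨h.2.1, h.1, h.2.2.1, h.2.2.2.symm⟩
    · rw [someLT_of_anti hg a b c d, someLT_of_anti hg c d a b, someLT_of_anti hh a' b' c' d',
        someLT_of_anti hh c' d' a' b', hp (Prod.map g h v), hn (Prod.map g h v')]
      simp only [Prod.map_fst, Prod.map_snd]
      rw [hg _ a _ b, hg _ b _ a, hg _ c _ d, hg _ d _ c, hh _ a' _ b', hh _ b' _ a',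
        hh _ c' _ d', hh _ d' _ c', or_comm, ← hp, or_comm, ← hn]
      exact fun h => Or.inl ⟨h.1, h.2.1, h.2.2.1.symm, h.2.2.2.symm⟩

theorem gridMap_swap (X Y : Set ℝ) : GridMap Prod.swap X Y where
  injOn := Prod.swap_injective.injOn
  diag r := by
    induction r with
    | _ v w => exact Sym2.eq_swap
  conflict := by
    rintro v w v' w' - - - - ⟨p, h1, h2⟩
    refine Or.inl ⟨p.swap, ?_, ?_⟩
    · rwa [← rectFun_mirrorRect]
    · rwa [← rectFun_mirrorRect]

theorem GridMap.transform {Ψ : Pt → Pt} {X Y : Set ℝ} (hΨ : GridMap Ψ X Y) {V : Finset Pt}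
    (hV : (V : Set Pt) ⊆ X ×ˢ Y) {v w : Pt} (hv : v ∈ V) (hw : w ∈ V) :
    LatticeMatching.transform (V.image Ψ) s(Ψ v, Ψ w) =
      (LatticeMatching.transform V s(v, w)).image Ψ := by
  have e : s(((Ψ w).1, (Ψ v).2), ((Ψ v).1, (Ψ w).2)) = s(Ψ (w.1, v.2), Ψ (v.1, w.2)) :=
    hΨ.diag s(v, w)
  have e' : ∀ z : Pt, (z = ((Ψ w).1, (Ψ v).2) ∨ z = ((Ψ v).1, (Ψ w).2)) ↔
      (z = Ψ (w.1, v.2) ∨ z = Ψ (v.1, w.2)) := fun z => by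
    rw [← Sym2.mem_iff, ← Sym2.mem_iff, e]
  ext z
  rw [mem_transform_mk, e']
  simp only [Finset.mem_image, mem_transform_mk]
  constructor
  · rintro (⟨⟨u, hu, rfl⟩, h1, h2⟩ | rfl | rfl)
    · exact ⟨u, Or.inl ⟨hu, fun h => h1 (h ▸ rfl), fun h => h2 (h ▸ rfl)⟩, rfl⟩
    · exact ⟨_, Or.inr (Or.inl rfl), rfl⟩
    · exact ⟨_, Or.inr (Or.inr rfl), rfl⟩
  · rintro ⟨u, ⟨hu, h1, h2⟩ | rfl | rfl, rfl⟩
    · exact Or.inl ⟨⟨u, hu, rfl⟩, fun h => h1 (hΨ.injOn (hV hu) (hV hv) h),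
        fun h => h2 (hΨ.injOn (hV hu) (hV hw) h)⟩
    · exact Or.inr (Or.inl rfl)
    · exact Or.inr (Or.inr rfl)

theorem transform_subset_grid {X Y : Set ℝ} {V : Finset Pt} (hV : (V : Set Pt) ⊆ X ×ˢ Y) {v w : Pt}
    (hv : v ∈ V) (hw : w ∈ V) : (transform V s(v, w) : Set Pt) ⊆ X ×ˢ Y := by
  intro z hz
  rw [Finset.mem_coe, mem_transform_mk] at hz
  rcases hz with ⟨hz, -⟩ | rfl | rfl
  · exact hV hz
  · exact ⟨(hV hw).1, (hV hv).2⟩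
  · exact ⟨(hV hv).1, (hV hw).2⟩

/-- All the vertices of the rectangles in the list lie on the grid. -/
def OnGrid (X Y : Set ℝ) (L : List (Sym2 Pt)) : Prop :=
  ∀ r ∈ L, ∃ v ∈ X ×ˢ Y, ∃ w ∈ X ×ˢ Y, r = s(v, w)

theorem IsTransformation.onGrid {X Y : Set ℝ} {L : List (Sym2 Pt)} {V V' : Finset Pt}
    (h : IsTransformation L V V') (hV : (V : Set Pt) ⊆ X ×ˢ Y) : OnGrid X Y L := by
  induction L generalizing V with
  | nil => simp [OnGrid]
  | cons r L ih =>
    obtain ⟨⟨v, hv, w, hw, -, rfl⟩, h⟩ := h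
    intro r hr
    rcases List.mem_cons.1 hr with rfl | hr
    · exact ⟨v, hV hv, w, hV hw, rfl⟩
    · exact ih h (transform_subset_grid hV hv hw) r hr

theorem GridMap.isTransformation {Ψ : Pt → Pt} {X Y : Set ℝ} (hΨ : GridMap Ψ X Y)
    {L : List (Sym2 Pt)} {V V' : Finset Pt} (h : IsTransformation L V V')
    (hV : (V : Set Pt) ⊆ X ×ˢ Y) :
    IsTransformation (L.map (Sym2.map Ψ)) (V.image Ψ) (V'.image Ψ) := by
  induction L generalizing V with
  | nil => exact congrArg _ h
  | cons r L ih =>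
    obtain ⟨⟨v, hv, w, hw, hvw, rfl⟩, h⟩ := h
    refine ⟨⟨Ψ v, Finset.mem_image_of_mem _ hv, Ψ w, Finset.mem_image_of_mem _ hw,
      fun e => hvw (hΨ.injOn (hV hv) (hV hw) e), rfl⟩, ?_⟩
    rw [Sym2.map_mk]
    rw [hΨ.transform hV hv hw]
    exact ih h (transform_subset_grid hV hv hw)

theorem GridMap.coherent {Ψ : Pt → Pt} {X Y : Set ℝ} (hΨ : GridMap Ψ X Y)
    {L : List (Sym2 Pt)} (hL : OnGrid X Y L) (hc : Coherent L) :
    Coherent (L.map (Sym2.map Ψ)) := by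
  rw [coherent_iff_not_conflict] at hc ⊢
  intro r hr s hs h
  obtain ⟨r, hr', rfl⟩ := List.mem_map.1 hr
  obtain ⟨s, hs', rfl⟩ := List.mem_map.1 hs
  clear hr hs
  rename' hr' => hr, hs' => hs
  obtain ⟨v, hv, w, hw, rfl⟩ := hL r hr
  obtain ⟨v', hv', w', hw', rfl⟩ := hL s hs
  rcases hΨ.conflict v w v' w' hv hw hv' hw' h with h | h
  · exact hc _ hr _ hs h
  · exact hc _ hs _ hr h

theorem injOn_list_map {α β : Type*} {F : α → β} {S : Set α} (hF : Set.InjOn F S) :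
    Set.InjOn (List.map F) {L | ∀ r ∈ L, r ∈ S} := by
  intro L hL L' hL' e
  induction L generalizing L' with
  | nil => exact (List.map_eq_nil_iff.1 e.symm).symm
  | cons r L ih =>
    cases L' with
    | nil => simp at e
    | cons r' L' =>
      simp only [List.map_cons, List.cons.injEq] at e
      rw [ih (fun r hr => hL r (List.mem_cons_of_mem _ hr))
        (fun r hr => hL' r (List.mem_cons_of_mem _ hr)) e.2,
        hF (hL r List.mem_cons_self) (hL' r' List.mem_cons_self) e.1]

theorem GridMap.injOn_lists {Ψ : Pt → Pt} {X Y : Set ℝ} (hΨ : GridMap Ψ X Y) :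
    Set.InjOn (List.map (Sym2.map Ψ)) {L | OnGrid X Y L} := by
  refine injOn_list_map (S := {r | ∃ v ∈ X ×ˢ Y, ∃ w ∈ X ×ˢ Y, r = s(v, w)}) ?_
  rintro _ ⟨v, hv, w, hw, rfl⟩ _ ⟨v', hv', w', hw', rfl⟩ e
  rw [Sym2.map_mk, Sym2.map_mk] at e
  change s(Ψ v, Ψ w) = s(Ψ v', Ψ w') at e
  rw [Sym2.eq_iff] at e ⊢
  rcases e with ⟨a, b⟩ | ⟨a, b⟩
  · exact Or.inl ⟨hΨ.injOn hv hv' a, hΨ.injOn hw hw' b⟩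
  · exact Or.inr ⟨hΨ.injOn hv hw' a, hΨ.injOn hw hv' b⟩

/-! ### Coherent transformations of polytopes and their invariance under equivalence -/

namespace LatticePolytope

theorem general0 (P : LatticePolytope) : General P.V0 := ⟨P.x_injOn0, P.y_injOn0⟩
theorem general1 (P : LatticePolytope) : General P.V1 := ⟨P.x_injOn1, P.y_injOn1⟩
theorem sameGrid (P : LatticePolytope) : SameGrid P.V0 P.V1 := ⟨P.x_eq, P.y_eq⟩

/-- Some transformation of `P` never covers a point by rectangles of opposite signs. -/
def HasCoherent (P : LatticePolytope) : Prop := ∃ L, IsTransformation L P.V0 P.V1 ∧ Coherent L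

theorem HasCoherent.f_eq {P : LatticePolytope} (h : P.HasCoherent) :
    P.f = {L | IsTransformation L P.V0 P.V1 ∧ Coherent L}.encard := by
  obtain ⟨L₀, h0, hc⟩ := h
  unfold f
  congr 1
  ext L
  refine and_congr_right fun hL => ?_
  exact minimal_iff_coherent id (fun L => IsTransformation L P.V0 P.V1)
    (fun p => quadSum P.V0 p - quadSum P.V1 p) (fun L hL q => (hL.invariants P.general0).2.2 q)
    h0 hc L hL

/-- Mapping rectangles by `Ψ` is injective on lists supported on the grid, so one inequality
suffices here; the reverse one comes from the symmetry of equivalence. -/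
theorem HasCoherent.transport {P P' : LatticePolytope} (h : P.HasCoherent) {Ψ : Pt → Pt}
    {X Y : Set ℝ} (hΨ : GridMap Ψ X Y) (hP : (P.V0 : Set Pt) ⊆ X ×ˢ Y)
    (h0 : P.V0.image Ψ = P'.V0) (h1 : P.V1.image Ψ = P'.V1) :
    P'.HasCoherent ∧ P.f ≤ P'.f := by
  have key : ∀ L, IsTransformation L P.V0 P.V1 → Coherent L →
      IsTransformation (L.map (Sym2.map Ψ)) P'.V0 P'.V1 ∧ Coherent (L.map (Sym2.map Ψ)) :=
    fun L hL hc => by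
      have := hΨ.isTransformation hL hP
      rw [h0, h1] at this
      exact ⟨this, hΨ.coherent (hL.onGrid hP) hc⟩
  have h' : P'.HasCoherent := by
    obtain ⟨L, hL, hc⟩ := h
    exact ⟨_, key L hL hc⟩
  refine ⟨h', ?_⟩
  rw [h.f_eq, h'.f_eq]
  exact Set.encard_le_encard_of_injOn (f := List.map (Sym2.map Ψ)) (fun L hL => key L hL.1 hL.2)
    (hΨ.injOn_lists.mono fun L hL => hL.1.onGrid hP)

end LatticePolytope

/-- Only the values on the grid matter; the extension by `0` elsewhere is arbitrary. -/
theorem monoOrAnti_extend {n : ℕ} {x x' : Fin n → ℝ} (hx : StrictMono x) (hx' : StrictMono x')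
    {r : Equiv.Perm (Fin n)} (hr : r = 1 ∨ r = Fin.revPerm) :
    MonoOrAnti (Function.extend x (x' ∘ r) 0) (Set.range x) := by
  have e := fun j => hx.injective.extend_apply (x' ∘ r) 0 j
  rcases hr with rfl | rfl
  · refine Or.inl ?_
    rintro _ ⟨i, rfl⟩ _ ⟨j, rfl⟩
    rw [e, e]
    simp [hx.lt_iff_lt, hx'.lt_iff_lt]
  · refine Or.inr ?_
    rintro _ ⟨i, rfl⟩ _ ⟨j, rfl⟩
    rw [e, e]
    simp [hx.lt_iff_lt, hx'.lt_iff_lt]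

theorem strictMono_unique_image {n : ℕ} {x x' : Fin n → ℝ} (hx : StrictMono x)
    (hx' : StrictMono x') (h : Finset.univ.image x = Finset.univ.image x') : x = x' := by
  have h' : Set.range x = Set.range x' := by
    have := congrArg (fun s : Finset ℝ => (s : Set ℝ)) h
    simpa using this
  exact (StrictMono.range_inj hx hx').1 h'

theorem image_fst_of_perm {n : ℕ} (x y : Fin n → ℝ) (σ : Equiv.Perm (Fin n)) :
    (Finset.univ.image fun j => ((x j, y (σ j)) : Pt)).image Prod.fst = Finset.univ.image x := by
  rw [Finset.image_image]; rfl

theorem image_snd_of_perm {n : ℕ} (x y : Fin n → ℝ) (σ : Equiv.Perm (Fin n)) :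
    (Finset.univ.image fun j => ((x j, y (σ j)) : Pt)).image Prod.snd = Finset.univ.image y := by
  rw [Finset.image_image]
  ext t
  simp only [Finset.mem_image, Finset.mem_univ, true_and, Function.comp_apply]
  exact ⟨fun ⟨j, h⟩ => ⟨σ j, h⟩, fun ⟨j, h⟩ => ⟨σ.symm j, by simpa using h⟩⟩

/-- A strictly increasing enumeration is determined by its image, so the common grid lets both
vertex sets use the same coordinates. -/
theorem LatticePolytope.exists_coordinates (P : LatticePolytope) {n : ℕ}
    {σ₀ σ₁ : Equiv.Perm (Fin n)} (h0 : HasPermutation P.V0 σ₀) (h1 : HasPermutation P.V1 σ₁) :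
    ∃ x y : Fin n → ℝ, StrictMono x ∧ StrictMono y ∧
      P.V0 = Finset.univ.image (fun j => (x j, y (σ₀ j))) ∧
      P.V1 = Finset.univ.image (fun j => (x j, y (σ₁ j))) := by
  obtain ⟨x, y, hx, hy, h0⟩ := h0
  obtain ⟨x', y', hx', hy', h1⟩ := h1
  have ex := P.x_eq
  have ey := P.y_eq
  rw [h0, h1, image_fst_of_perm, image_fst_of_perm] at ex
  rw [h0, h1, image_snd_of_perm, image_snd_of_perm] at ey
  obtain rfl := strictMono_unique_image hx hx' ex
  obtain rfl := strictMono_unique_image hy hy' ey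
  exact ⟨x, y, hx, hy, h0, h1⟩

/-- The grid map sends `x j` to `x' (r j)` and `y j` to `y' (l⁻¹ j)`. Since `σ = l * τ * r`, the
vertex with index `j` goes to the one with index `r j`. -/
theorem LatticePolytope.HasCoherent.transport_of_eq {P P' : LatticePolytope} (h : P.HasCoherent)
    {n : ℕ} {σ₀ σ₁ τ₀ τ₁ l r : Equiv.Perm (Fin n)}
    (h0 : HasPermutation P.V0 σ₀) (h1 : HasPermutation P.V1 σ₁)
    (h0' : HasPermutation P'.V0 τ₀) (h1' : HasPermutation P'.V1 τ₁)
    (hl : l = 1 ∨ l = Fin.revPerm) (hr : r = 1 ∨ r = Fin.revPerm)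
    (e0 : σ₀ = l * τ₀ * r) (e1 : σ₁ = l * τ₁ * r) : P'.HasCoherent ∧ P.f ≤ P'.f := by
  obtain ⟨x, y, hx, hy, h0, h1⟩ := P.exists_coordinates h0 h1
  obtain ⟨x', y', hx', hy', h0', h1'⟩ := P'.exists_coordinates h0' h1'
  have hl' : l⁻¹ = 1 ∨ l⁻¹ = Fin.revPerm := by
    rcases hl with rfl | rfl
    · exact Or.inl inv_one
    · exact Or.inr rfl
  have key : ∀ σ τ : Equiv.Perm (Fin n), σ = l * τ * r →
      (Finset.univ.image fun j => ((x j, y (σ j)) : Pt)).image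
        (Prod.map (Function.extend x (x' ∘ r) 0) (Function.extend y (y' ∘ ⇑l⁻¹) 0)) =
      Finset.univ.image fun j => ((x' j, y' (τ j)) : Pt) := by
    intro σ τ e
    rw [Finset.image_image]
    have e' : ∀ j, Prod.map (Function.extend x (x' ∘ r) 0) (Function.extend y (y' ∘ ⇑l⁻¹) 0)
        ((x j, y (σ j)) : Pt) = (x' (r j), y' (τ (r j))) := fun j => by
      rw [Prod.map_apply, hx.injective.extend_apply, hy.injective.extend_apply, e]
      simp
    ext z
    simp only [Finset.mem_image, Finset.mem_univ, true_and, Function.comp_apply, e']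
    exact ⟨fun ⟨j, h⟩ => ⟨r j, h⟩, fun ⟨j, h⟩ => ⟨r.symm j, by simpa using h⟩⟩
  refine h.transport (gridMap_prodMap (monoOrAnti_extend hx hx' hr) (monoOrAnti_extend hy hy' hl'))
    ?_ (by rw [h0, h0', key _ _ e0]) (by rw [h1, h1', key _ _ e1])
  rw [h0]
  intro z hz
  simp only [Finset.coe_image, Finset.coe_univ, Set.image_univ, Set.mem_range] at hz
  obtain ⟨j, rfl⟩ := hz
  exact ⟨⟨j, rfl⟩, ⟨_, rfl⟩⟩

theorem HasPermutation.reflect {V : Finset Pt} {n : ℕ} {σ : Equiv.Perm (Fin n)}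
    (h : HasPermutation V σ) : HasPermutation (LatticeMatching.reflect V) σ⁻¹ := by
  obtain ⟨x, y, hx, hy, rfl⟩ := h
  refine ⟨y, x, hy, hx, ?_⟩
  unfold LatticeMatching.reflect
  rw [Finset.image_image]
  ext z
  simp only [Finset.mem_image, Finset.mem_univ, true_and, Function.comp_apply, Prod.swap_prod_mk]
  exact ⟨fun ⟨j, h⟩ => ⟨σ j, by simpa using h⟩, fun ⟨j, h⟩ => ⟨σ.symm j, by simpa using h⟩⟩

theorem reflect_reflect (V : Finset Pt) : reflect (reflect V) = V := by
  unfold reflect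
  rw [Finset.image_image, Prod.swap_swap_eq, Finset.image_id]

theorem LatticePolytope.HasCoherent.of_equivalent {P P' : LatticePolytope} (h : P.HasCoherent)
    (he : P.Equivalent P') : P'.HasCoherent ∧ P.f ≤ P'.f := by
  obtain ⟨n, σ₀, σ₁, τ₀, τ₁, h0, h1, h0', h1', l, r, hl, hr, ⟨e0, e1⟩ | ⟨e0, e1⟩⟩ := he
  · exact h.transport_of_eq h0 h1 h0' h1' hl hr e0 e1
  -- The inverse permutations belong to the mirror image of `P'`; a final reflection leads back to
  -- `P'`.
  · obtain ⟨a, b⟩ := h.transport_of_eq (P' := P'.mirror) h0 h1 h0'.reflect h1'.reflect hl hr e0 e1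
    obtain ⟨c, d⟩ := a.transport (P' := P') (gridMap_swap Set.univ Set.univ) (by simp)
      (reflect_reflect P'.V0) (reflect_reflect P'.V1)
    exact ⟨c, b.trans d⟩

theorem LatticePolytope.Equivalent.symm {P P' : LatticePolytope} (he : P.Equivalent P') :
    P'.Equivalent P := by
  obtain ⟨n, σ₀, σ₁, τ₀, τ₁, h0, h1, h0', h1', l, r, hl, hr, he⟩ := he
  have hi : ∀ l : Equiv.Perm (Fin n), l = 1 ∨ l = Fin.revPerm → l * l = 1 := by
    rintro l (rfl | rfl)
    · rfl
    · ext; simp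
  have hl' := hi l hl
  have hr' := hi r hr
  rcases he with ⟨rfl, rfl⟩ | ⟨rfl, rfl⟩
  · refine ⟨n, _, _, _, _, h0', h1', h0, h1, l, r, hl, hr, Or.inl ?_⟩
    simp [mul_assoc, hr', ← mul_assoc l l, hl']
  -- Solving `σ = l * τ⁻¹ * r` for `τ` gives `r * σ⁻¹ * l`, so the two factors change places.
  · refine ⟨n, _, _, _, _, h0', h1', h0, h1, r, l, hr, hl, Or.inr ?_⟩
    simp [mul_assoc, ← mul_assoc r, mul_inv_cancel]

theorem LatticePolytope.HasCoherent.f_eq_of_equivalent {P P' : LatticePolytope}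
    (h : P.HasCoherent) (he : P.Equivalent P') : P.f = P'.f := by
  obtain ⟨h', hle⟩ := h.of_equivalent he
  exact le_antisymm hle (h'.of_equivalent he.symm).2

end LatticeMatching

namespace LatticeMatching

/-! ### Segments parallel to the axes -/

theorem mem_segment_vertical {u v p : Pt} (h : u.1 = v.1) :
    p ∈ segment ℝ u v ↔ p.1 = u.1 ∧ p.2 ∈ Set.uIcc u.2 v.2 := by
  obtain ⟨x, a⟩ := u
  obtain ⟨x', b⟩ := v
  obtain rfl : x = x' := h
  rw [← Prod.image_mk_segment_right, segment_eq_uIcc]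
  constructor
  · rintro ⟨t, ht, rfl⟩
    exact ⟨rfl, ht⟩
  · rintro ⟨h1, h2⟩
    exact ⟨p.2, h2, Prod.ext h1.symm rfl⟩

theorem mem_segment_horizontal {u v p : Pt} (h : u.2 = v.2) :
    p ∈ segment ℝ u v ↔ p.2 = u.2 ∧ p.1 ∈ Set.uIcc u.1 v.1 := by
  obtain ⟨a, y⟩ := u
  obtain ⟨b, y'⟩ := v
  obtain rfl : y = y' := h
  rw [← Prod.image_mk_segment_left, segment_eq_uIcc]
  constructor
  · rintro ⟨t, ht, rfl⟩
    exact ⟨rfl, ht⟩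
  · rintro ⟨h1, h2⟩
    exact ⟨p.1, h2, Prod.ext rfl h1.symm⟩

theorem mem_uIcc_of_step_ne {t a b : ℝ} (h : step t a ≠ step t b) : t ∈ Set.uIcc a b := by
  unfold step at h
  rw [Set.mem_uIcc]
  split_ifs at h <;> first | exact absurd rfl h | grind

/-! ### The rotation number of a lattice polytope -/

theorem SameGrid.exists_fst_map {V V' : Finset Pt} (h : SameGrid V V') (hV : General V)
    (hV' : General V') : ∃ φ : Pt → Pt, (∀ u ∈ V, φ u ∈ V' ∧ (φ u).1 = u.1) ∧
      ∀ F : Pt → ℤ, ∑ u ∈ V, F (φ u) = ∑ v ∈ V', F v := by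
  have h1 : ∀ u, ∃ v, u ∈ V → v ∈ V' ∧ v.1 = u.1 := fun u => by
    by_cases hu : u ∈ V
    · obtain ⟨v, hv⟩ := h.exists_fst hu
      exact ⟨v, fun _ => hv⟩
    · exact ⟨u, fun h => absurd h hu⟩
  choose φ hφ using h1
  refine ⟨φ, hφ, fun F => Finset.sum_nbij φ (fun u hu => (hφ u hu).1) ?_ ?_ fun _ _ => rfl⟩
  · intro u hu v hv e
    exact hV.1 hu hv (((hφ u hu).2.symm.trans (congrArg Prod.fst e)).trans (hφ v hv).2)
  · intro v hv
    obtain ⟨u, hu, e⟩ := h.symm.exists_fst hv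
    exact ⟨u, hu, hV'.1 (hφ u hu).1 hv ((hφ u hu).2.trans e)⟩

theorem SameGrid.exists_snd_map {V V' : Finset Pt} (h : SameGrid V V') (hV : General V)
    (hV' : General V') : ∃ φ : Pt → Pt, (∀ u ∈ V, φ u ∈ V' ∧ (φ u).2 = u.2) ∧
      ∀ F : Pt → ℤ, ∑ u ∈ V, F (φ u) = ∑ v ∈ V', F v := by
  have h1 : ∀ u, ∃ v, u ∈ V → v ∈ V' ∧ v.2 = u.2 := fun u => by
    by_cases hu : u ∈ V
    · obtain ⟨v, hv⟩ := h.exists_snd hu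
      exact ⟨v, fun _ => hv⟩
    · exact ⟨u, fun h => absurd h hu⟩
  choose φ hφ using h1
  refine ⟨φ, hφ, fun F => Finset.sum_nbij φ (fun u hu => (hφ u hu).1) ?_ ?_ fun _ _ => rfl⟩
  · intro u hu v hv e
    exact hV.2 hu hv (((hφ u hu).2.symm.trans (congrArg Prod.snd e)).trans (hφ v hv).2)
  · intro v hv
    obtain ⟨u, hu, e⟩ := h.symm.exists_snd hv
    exact ⟨u, hu, hV'.2 (hφ u hu).1 hv ((hφ u hu).2.trans e)⟩

namespace LatticePolytope

/-- Each column contains one vertex of either kind, so the double sum collapses to one vertical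
segment per column; isolated vertices contribute zero. -/
theorem rotation_eq (P : LatticePolytope) (p : Pt) :
    P.rotation p = quadSum P.V0 p - quadSum P.V1 p := by
  obtain ⟨φ, hφ, hs⟩ := P.sameGrid.symm.exists_fst_map P.general1 P.general0
  rw [quadSum, quadSum, ← hs, ← Finset.sum_sub_distrib, rotation]
  refine Finset.sum_congr rfl fun u hu => ?_
  rw [Finset.sum_eq_single (φ u)]
  · rw [if_pos (hφ u hu).2.symm, rayCrossing_eq (hφ u hu).2.symm]
  · intro v hv hne
    exact if_neg fun e => hne (P.general0.1 hv (hφ u hu).1 (e.symm.trans (hφ u hu).2.symm))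
  · exact fun h => absurd (hφ u hu).1 h

theorem mem_boundary_of_vertical (P : LatticePolytope) {u v p : Pt} (hu : u ∈ P.V1)
    (hv : v ∈ P.V0) (e : v.1 = u.1) (hp : p.1 = u.1) (h : step p.2 v.2 ≠ step p.2 u.2) :
    p ∈ P.boundary :=
  ⟨u, v, Or.inr ⟨hu, hv, e.symm, fun h' => h (by rw [h'])⟩,
    (mem_segment_vertical e.symm).2 ⟨hp, mem_uIcc_of_step_ne h.symm⟩⟩

theorem mem_boundary_of_horizontal (P : LatticePolytope) {u v p : Pt} (hu : u ∈ P.V0)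
    (hv : v ∈ P.V1) (e : v.2 = u.2) (hp : p.2 = u.2) (h : step p.1 v.1 ≠ step p.1 u.1) :
    p ∈ P.boundary :=
  ⟨u, v, Or.inl ⟨hu, hv, e.symm, fun h' => h (by rw [h'])⟩,
    (mem_segment_horizontal e.symm).2 ⟨hp, mem_uIcc_of_step_ne h.symm⟩⟩

/-- A column whose term changes would have its vertical edge meet the segment between the two
points. -/
theorem rotation_eq_of_horizontal (P : LatticePolytope) {s s' t : ℝ}
    (h : ∀ x ∈ Set.uIcc s s', (x, t) ∉ P.boundary) : P.rotation (s, t) = P.rotation (s', t) := by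
  obtain ⟨φ, hφ, hs⟩ := P.sameGrid.symm.exists_fst_map P.general1 P.general0
  rw [rotation_eq, rotation_eq, quadSum, quadSum, quadSum, quadSum, ← hs, ← hs,
    ← Finset.sum_sub_distrib, ← Finset.sum_sub_distrib]
  refine Finset.sum_congr rfl fun u hu => ?_
  simp only [quad, (hφ u hu).2, ← mul_sub]
  by_cases hst : step t (φ u).2 = step t u.2
  · rw [hst, sub_self, mul_zero, mul_zero]
  · congr 1
    by_contra hne
    refine h u.1 ?_ (P.mem_boundary_of_vertical hu (hφ u hu).1 (hφ u hu).2 rfl hst)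
    unfold step at hne
    rw [Set.mem_uIcc]
    split_ifs at hne <;> first | exact absurd rfl hne | grind

theorem rotation_eq_of_vertical (P : LatticePolytope) {s t t' : ℝ}
    (h : ∀ y ∈ Set.uIcc t t', (s, y) ∉ P.boundary) : P.rotation (s, t) = P.rotation (s, t') := by
  obtain ⟨φ, hφ, hs⟩ := P.sameGrid.exists_snd_map P.general0 P.general1
  rw [rotation_eq, rotation_eq, quadSum, quadSum, quadSum, quadSum, ← hs, ← hs,
    ← Finset.sum_sub_distrib, ← Finset.sum_sub_distrib]
  refine Finset.sum_congr rfl fun u hu => ?_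
  simp only [quad, (hφ u hu).2, ← sub_mul]
  by_cases hst : step s (φ u).1 = step s u.1
  · rw [hst, sub_self, zero_mul, zero_mul]
  · congr 1
    by_contra hne
    refine h u.2 ?_ (P.mem_boundary_of_horizontal hu (hφ u hu).1 (hφ u hu).2 rfl hst)
    unfold step at hne
    rw [Set.mem_uIcc]
    split_ifs at hne <;> first | exact absurd rfl hne | grind

theorem isClosed_boundary (P : LatticePolytope) : IsClosed P.boundary := by
  have e : P.boundary = ⋃ e ∈ {e : Pt × Pt | P.XEdge e.1 e.2 ∨ P.YEdge e.1 e.2},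
      segment ℝ e.1 e.2 := by
    ext p
    simp [boundary]
  rw [e]
  refine Set.Finite.isClosed_biUnion ?_ fun e _ => ?_
  · refine ((P.V0 ∪ P.V1) ×ˢ (P.V0 ∪ P.V1)).finite_toSet.subset ?_
    rintro ⟨u, v⟩ (h | h)
    · simp [h.1, h.2.1]
    · simp [h.1, h.2.1]
  · rw [← convexHull_pair]
    exact (Set.toFinite _).isClosed_convexHull ℝ

/-- The closure of the points with nonzero rotation number. -/
def support (P : LatticePolytope) : Set Pt := closure {p | P.rotation p ≠ 0}

/-- Off the closed set `∂P` the rotation number is locally constant, so a limit of points with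
nonzero value lies on the boundary or has nonzero value itself. -/
theorem support_subset_carrier (P : LatticePolytope) : P.support ⊆ P.carrier := by
  intro q hq
  by_contra hc
  simp only [carrier, Set.mem_union, Set.mem_ofPred_eq, not_or, not_and, not_not] at hc
  obtain ⟨⟨⟨hb, h0⟩, -⟩, -⟩ := hc
  have h0 := h0 hb
  -- Balls of the maximum metric are squares, so a horizontal move followed by a vertical one stays
  -- inside.
  obtain ⟨ε, hε, hball⟩ := Metric.isOpen_iff.1 P.isClosed_boundary.isOpen_compl q hb
  obtain ⟨p, hp, hpq⟩ := Metric.mem_closure_iff.1 hq ε hε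
  rw [dist_comm, ← Metric.mem_ball, ← ball_prod_same] at hpq
  have hx := Set.OrdConnected.uIcc_subset (s := Metric.ball q.1 ε)
    (Real.ball_eq_Ioo q.1 ε ▸ Set.ordConnected_Ioo) hpq.1 (Metric.mem_ball_self hε)
  have hy := Set.OrdConnected.uIcc_subset (s := Metric.ball q.2 ε)
    (Real.ball_eq_Ioo q.2 ε ▸ Set.ordConnected_Ioo) hpq.2 (Metric.mem_ball_self hε)
  have e1 : P.rotation (p.1, p.2) = P.rotation (q.1, p.2) :=
    P.rotation_eq_of_horizontal fun x hx' =>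
      hball ((ball_prod_same q.1 q.2 ε) ▸ ⟨hx hx', hpq.2⟩)
  have e2 : P.rotation (q.1, p.2) = P.rotation (q.1, q.2) :=
    P.rotation_eq_of_vertical fun y hy' =>
      hball ((ball_prod_same q.1 q.2 ε) ▸ ⟨Metric.mem_ball_self hε, hy hy'⟩)
  exact hp (e1.trans (e2.trans h0))

end LatticePolytope

theorem quadSum_reflect (V : Finset Pt) (p : Pt) : quadSum (reflect V) p = quadSum V p.swap := by
  unfold quadSum reflect
  rw [Finset.sum_image Prod.swap_injective.injOn]
  refine Finset.sum_congr rfl fun v _ => ?_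
  simp [quad, mul_comm]

theorem mem_reflect {V : Finset Pt} {z : Pt} : z ∈ reflect V ↔ z.swap ∈ V := by
  unfold reflect
  rw [Finset.mem_image]
  exact ⟨by rintro ⟨u, hu, rfl⟩; simpa using hu, fun h => ⟨_, h, Prod.swap_swap z⟩⟩

namespace LatticePolytope

theorem rotation_mirror (P : LatticePolytope) (p : Pt) :
    P.mirror.rotation p = P.rotation p.swap := by
  rw [rotation_eq, rotation_eq, ← quadSum_reflect, ← quadSum_reflect]
  rfl

/-- The support of the rotation number together with the vertices. -/
def core (P : LatticePolytope) : Set Pt := P.support ∪ (P.V0 : Set Pt) ∪ (P.V1 : Set Pt)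

theorem core_subset_carrier (P : LatticePolytope) : P.core ⊆ P.carrier := by
  rintro z ((hz | hz) | hz)
  · exact P.support_subset_carrier hz
  · exact Or.inl (Or.inr hz)
  · exact Or.inr hz

theorem swap_mem_core_mirror (P : LatticePolytope) {z : Pt} (hz : z ∈ P.core) :
    z.swap ∈ P.mirror.core := by
  rcases hz with (hz | hz) | hz
  · refine Or.inl (Or.inl ?_)
    refine map_mem_closure continuous_swap hz fun p hp => ?_
    change P.mirror.rotation p.swap ≠ 0
    rwa [rotation_mirror, Prod.swap_swap]
  · exact Or.inl (Or.inr (mem_reflect.2 (by simpa using hz)))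
  · exact Or.inr (mem_reflect.2 (by simpa using hz))

/-- This is the only form in which the disjointness of `P` and `-P^*` is used: the core picks at
most one point from each mirror pair. -/
theorem swap_notMem_core {P : LatticePolytope} (h : Disjoint P.carrier P.mirror.carrier) {z : Pt}
    (hz : z ∈ P.core) : z.swap ∉ P.core := fun hz' => by
  have := P.swap_mem_core_mirror hz'
  rw [Prod.swap_swap] at this
  exact Set.disjoint_left.1 h (P.core_subset_carrier hz) (P.mirror.core_subset_carrier this)

end LatticePolytope

/-! ### Transformations of lattice presentations -/

/-- A finite set in general position that is symmetric about the line `x = y`, with no point on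
that line. -/
structure Symmetric (Δ : Finset Pt) : Prop where
  general : General Δ
  swap_mem : ∀ z ∈ Δ, z.swap ∈ Δ
  ne : ∀ z ∈ Δ, z.1 ≠ z.2

/-- The list followed by the mirror images of its rectangles. -/
def double (L : List (Sym2 Pt)) : List (Sym2 Pt) := L ++ L.map mirrorRect

theorem mem_double {L : List (Sym2 Pt)} {r : Sym2 Pt} :
    r ∈ double L ↔ r ∈ L ∨ mirrorRect r ∈ L := by
  have hm : ∀ r, mirrorRect (mirrorRect r) = r := fun r => by
    induction r with
    | _ v w => simp [mirrorRect_mk]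
  rw [double, List.mem_append, List.mem_map]
  exact or_congr_right ⟨by rintro ⟨s, hs, rfl⟩; rwa [hm], fun h => ⟨_, h, hm r⟩⟩

theorem mirrorRect_mirrorRect (r : Sym2 Pt) : mirrorRect (mirrorRect r) = r := by
  induction r with
  | _ v w => simp [mirrorRect_mk]

theorem totalArea_double (L : List (Sym2 Pt)) : totalArea (double L) = 2 * totalArea L := by
  have h : ∀ L : List (Sym2 Pt), ((L.map mirrorRect).map rectArea).sum = (L.map rectArea).sum :=
    fun L => by rw [List.map_map]; congr 2; ext r; exact rectArea_mirrorRect r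
  unfold totalArea double
  rw [List.map_append, List.sum_append, h]
  ring

/-- Coming from different arcs and avoiding the diagonal guarantee that the first rectangle leaves
`v.swap` and `w.swap` in place, so the mirror rectangle is again a legitimate move and symmetry is
restored after it. -/
theorem Symmetric.step {Δ : Finset Pt} (h : Symmetric Δ) {v w : Pt} (hv : v ∈ Δ) (hw : w ∈ Δ)
    (hvw : v ≠ w) (hvw' : v ≠ w.swap) :
    Symmetric (transform (transform Δ s(v, w)) (mirrorRect s(v, w))) ∧
    ∀ p, quadSum (transform (transform Δ s(v, w)) (mirrorRect s(v, w))) p =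
      quadSum Δ p - rectFun s(v, w) p - rectFun (mirrorRect s(v, w)) p := by
  have hwv' : w ≠ v.swap := fun e => hvw' (by rw [e, Prod.swap_swap])
  have hvv : v.swap ≠ v := fun e => h.ne v hv (congrArg Prod.snd e)
  have hww : w.swap ≠ w := fun e => h.ne w hw (congrArg Prod.snd e)
  have hg := h.general.transform hv hw hvw
  have hv1 : v.swap ∈ transform Δ s(v, w) :=
    mem_transform_mk.2 (Or.inl ⟨h.swap_mem v hv, hvv, hwv'.symm⟩)
  have hw1 : w.swap ∈ transform Δ s(v, w) :=
    mem_transform_mk.2 (Or.inl ⟨h.swap_mem w hw, hvw'.symm, hww⟩)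
  have hvw1 : v.swap ≠ w.swap := fun e => hvw (Prod.swap_injective e)
  rw [mirrorRect_mk]
  have hg2 := hg.transform hv1 hw1 hvw1
  have n1 : w.1 ≠ v.2 := fun e => hwv' (h.general.1 hw (h.swap_mem v hv) e)
  have n2 : v.1 ≠ w.2 := fun e => hvw' (h.general.1 hv (h.swap_mem w hw) e)
  refine ⟨⟨hg2, fun z hz => ?_, fun z hz => ?_⟩, fun p => ?_⟩
  · rw [mem_transform_mk, mem_transform_mk] at hz ⊢
    simp only [Prod.fst_swap, Prod.snd_swap] at hz ⊢
    rcases hz with ⟨⟨hz, h1, h2⟩ | rfl | rfl, h3, h4⟩ | rfl | rfl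
    · exact Or.inl ⟨Or.inl ⟨h.swap_mem z hz, fun e => h3 (by rw [← e, Prod.swap_swap]),
        fun e => h4 (by rw [← e, Prod.swap_swap])⟩, fun e => h1 (Prod.swap_injective e),
        fun e => h2 (Prod.swap_injective e)⟩
    · exact Or.inr (Or.inr rfl)
    · exact Or.inr (Or.inl rfl)
    · exact Or.inl ⟨Or.inr (Or.inr rfl), fun e => n2 (congrArg Prod.snd e).symm,
        fun e => n2 (congrArg Prod.fst e)⟩
    · exact Or.inl ⟨Or.inr (Or.inl rfl), fun e => n1 (congrArg Prod.fst e),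
        fun e => n1 (congrArg Prod.snd e).symm⟩
  · rw [mem_transform_mk, mem_transform_mk] at hz
    rcases hz with ⟨⟨hz, -⟩ | rfl | rfl, -⟩ | rfl | rfl
    · exact h.ne z hz
    · exact n1
    · exact n2
    · exact n2.symm
    · exact n1.symm
  · rw [quadSum_transform hg hv1 hw1 hvw1, quadSum_transform h.general hv hw hvw]

theorem IsPresentationTransformation.sum_double {L : List (Sym2 Pt)} {Δ Δ' : Finset Pt}
    (hΔ : Symmetric Δ) (h : IsPresentationTransformation L Δ Δ') (p : Pt) :
    ((double L).map fun r => rectFun r p).sum = quadSum Δ p - quadSum Δ' p := by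
  unfold double
  rw [List.map_append, List.sum_append, List.map_map]
  induction L generalizing Δ with
  | nil => cases h; simp
  | cons r L ih =>
    obtain ⟨⟨v, hv, w, hw, hvw, hvw', rfl⟩, h⟩ := h
    obtain ⟨h1, h2⟩ := hΔ.step hv hw hvw hvw'
    have := ih h1 h
    rw [h2] at this
    simp only [List.map_cons, List.sum_cons, Function.comp_apply] at this ⊢
    linarith

theorem IsPresentationTransformation.nondegenerate {L : List (Sym2 Pt)} {Δ Δ' : Finset Pt}
    (hΔ : Symmetric Δ) (h : IsPresentationTransformation L Δ Δ') :
    ∀ r ∈ L, ∃ v w : Pt, r = s(v, w) ∧ v.1 ≠ w.1 ∧ v.2 ≠ w.2 := by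
  induction L generalizing Δ with
  | nil => simp
  | cons r L ih =>
    obtain ⟨⟨v, hv, w, hw, hvw, hvw', rfl⟩, h⟩ := h
    intro r hr
    rcases List.mem_cons.1 hr with rfl | hr
    · exact ⟨v, w, rfl, hΔ.general.fst_ne hv hw hvw, hΔ.general.snd_ne hv hw hvw⟩
    · exact ih (hΔ.step hv hw hvw hvw').1 h r hr

theorem IsTransformation.nondegenerate {L : List (Sym2 Pt)} {V V' : Finset Pt}
    (hV : General V) (h : IsTransformation L V V') :
    ∀ r ∈ L, ∃ v w : Pt, r = s(v, w) ∧ v.1 ≠ w.1 ∧ v.2 ≠ w.2 := by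
  induction L generalizing V with
  | nil => simp
  | cons r L ih =>
    obtain ⟨⟨v, hv, w, hw, hvw, rfl⟩, h⟩ := h
    intro r hr
    rcases List.mem_cons.1 hr with rfl | hr
    · exact ⟨v, w, rfl, hV.fst_ne hv hw hvw, hV.snd_ne hv hw hvw⟩
    · exact ih (hV.transform hv hw hvw) h r hr

/-- All four vertices of the rectangle lie in `C`. -/
def VerticesIn (C : Set Pt) (r : Sym2 Pt) : Prop :=
  (∀ z ∈ r, z ∈ C) ∧ ∀ z ∈ otherDiagonal r, z ∈ C

theorem verticesIn_mk {C : Set Pt} {v w : Pt} : VerticesIn C s(v, w) ↔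
    (v ∈ C ∧ w ∈ C) ∧ (w.1, v.2) ∈ C ∧ (v.1, w.2) ∈ C := by
  simp [VerticesIn, otherDiagonal_mk]

/-- Because `C` is disjoint from its mirror image, the moves on `W` and on its reflection do not
interfere and may be made in either order. The second form serves lists that record the mirror
member of a pair. -/
theorem transform_union_reflect {C : Set Pt} (hC : ∀ z ∈ C, z.swap ∉ C) {W : Finset Pt}
    (hW : ∀ z ∈ W, z ∈ C) {v w : Pt} (hvw : VerticesIn C s(v, w)) :
    transform (transform (W ∪ reflect W) s(v, w)) (mirrorRect s(v, w)) =
        transform W s(v, w) ∪ reflect (transform W s(v, w)) ∧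
    transform (transform (W ∪ reflect W) (mirrorRect s(v, w))) s(v, w) =
        transform W s(v, w) ∪ reflect (transform W s(v, w)) := by
  obtain ⟨⟨h1, h2⟩, h3, h4⟩ := verticesIn_mk.1 hvw
  have hsw : ∀ z u : Pt, z.swap = u ↔ z = u.swap := fun z u =>
    ⟨fun e => by rw [← e, Prod.swap_swap], fun e => by rw [e, Prod.swap_swap]⟩
  have hin : ∀ z u : Pt, u ∈ C → z ∈ C → z ≠ u.swap := fun z u hu hz e => hC u hu (e ▸ hz)
  have e1 : ((w.swap.1, v.swap.2) : Pt) = Prod.swap (v.1, w.2) := rfl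
  have e2 : ((v.swap.1, w.swap.2) : Pt) = Prod.swap (w.1, v.2) := rfl
  rw [mirrorRect_mk]
  refine ⟨?_, ?_⟩ <;>
  · ext z
    simp only [mem_transform_mk, Finset.mem_union, mem_reflect, e1, e2, ne_eq, hsw]
    by_cases hz : z ∈ C
    · have n1 := hin z _ h1 hz
      have n2 := hin z _ h2 hz
      have n3 := hin z _ h3 hz
      have n4 := hin z _ h4 hz
      have n5 : z.swap ∉ W := fun h => hC z hz (hW _ h)
      tauto
    · have n1 : z ≠ v := fun e => hz (e ▸ h1)
      have n2 : z ≠ w := fun e => hz (e ▸ h2)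
      have n3 : z ≠ (w.1, v.2) := fun e => hz (e ▸ h3)
      have n4 : z ≠ (v.1, w.2) := fun e => hz (e ▸ h4)
      have n5 : z ∉ W := fun h => hz (hW _ h)
      tauto

theorem transform_subset_of_verticesIn {C : Set Pt} {W : Finset Pt} (hW : ∀ z ∈ W, z ∈ C)
    {v w : Pt} (hvw : VerticesIn C s(v, w)) : ∀ z ∈ transform W s(v, w), z ∈ C := by
  obtain ⟨-, h3, h4⟩ := verticesIn_mk.1 hvw
  intro z hz
  rcases mem_transform_mk.1 hz with ⟨hz, -⟩ | rfl | rfl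
  exacts [hW z hz, h3, h4]

theorem IsTransformation.toPresentation {C : Set Pt} (hC : ∀ z ∈ C, z.swap ∉ C)
    {L : List (Sym2 Pt)} {W W' : Finset Pt} (hW : ∀ z ∈ W, z ∈ C) (h : IsTransformation L W W')
    (hL : ∀ r ∈ L, VerticesIn C r) :
    IsPresentationTransformation L (W ∪ reflect W) (W' ∪ reflect W') := by
  induction L generalizing W with
  | nil => cases h; exact rfl
  | cons r L ih =>
    obtain ⟨⟨v, hv, w, hw, hvw, rfl⟩, h⟩ := h
    have hr := hL _ List.mem_cons_self
    refine ⟨⟨v, Finset.mem_union_left _ hv, w, Finset.mem_union_left _ hw, hvw,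
      fun e => hC w (hW w hw) (e ▸ hW v hv), rfl⟩, ?_⟩
    rw [(transform_union_reflect hC hW hr).1]
    exact ih (transform_subset_of_verticesIn hW hr) h fun r hr => hL r (List.mem_cons_of_mem _ hr)

/-- From every mirror pair the member inside `C` is kept. It acts on the half `W`, and the sequence
of unordered pairs is not affected by this choice. -/
theorem IsPresentationTransformation.exists_half {C : Set Pt} (hC : ∀ z ∈ C, z.swap ∉ C)
    {L : List (Sym2 Pt)} {W Δ' : Finset Pt} (hW : ∀ z ∈ W, z ∈ C)
    (h : IsPresentationTransformation L (W ∪ reflect W) Δ')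
    (hL : ∀ r ∈ L, VerticesIn C r ∨ VerticesIn C (mirrorRect r)) :
    ∃ L' W', IsTransformation L' W W' ∧ (∀ z ∈ W', z ∈ C) ∧ Δ' = W' ∪ reflect W' ∧
      (L'.map fun r => s(r, mirrorRect r)) = (L.map fun r => s(r, mirrorRect r)) ∧
      ∀ r ∈ L', r ∈ double L := by
  have hmem : ∀ W : Finset Pt, (∀ z ∈ W, z ∈ C) → ∀ z ∈ C, z ∈ W ∪ reflect W → z ∈ W := by
    intro W hW z hz hz'
    rcases Finset.mem_union.1 hz' with h | h
    · exact h
    · exact absurd (hW _ (mem_reflect.1 h)) (hC z hz)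
  induction L generalizing W with
  | nil => exact ⟨[], W, rfl, hW, h.symm, rfl, by simp⟩
  | cons r L ih =>
    obtain ⟨⟨v, hv, w, hw, hvw, hvw', rfl⟩, h⟩ := h
    rcases hL _ List.mem_cons_self with hr | hr
    · rw [(transform_union_reflect hC hW hr).1] at h
      obtain ⟨L', W', h1, h2, h3, h4, h5⟩ := ih (transform_subset_of_verticesIn hW hr) h
        fun r hr => hL r (List.mem_cons_of_mem _ hr)
      obtain ⟨⟨a, b⟩, -⟩ := verticesIn_mk.1 hr
      refine ⟨s(v, w) :: L', W', ⟨⟨v, hmem W hW v a hv, w, hmem W hW w b hw, hvw, rfl⟩, h1⟩, h2, h3,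
        by rw [List.map_cons, List.map_cons, h4], fun r hr => ?_⟩
      rw [mem_double]
      rcases List.mem_cons.1 hr with rfl | hr
      · exact Or.inl List.mem_cons_self
      · exact (mem_double.1 (h5 r hr)).imp (List.mem_cons_of_mem _) (List.mem_cons_of_mem _)
    · have hr' : VerticesIn C s(v.swap, w.swap) := hr
      have hsym : ∀ z ∈ W ∪ reflect W, z.swap ∈ W ∪ reflect W := fun z hz => by
        rw [Finset.mem_union, mem_reflect] at hz ⊢
        rw [Prod.swap_swap]
        exact hz.symm
      have e : s(v, w) = mirrorRect s(v.swap, w.swap) := by simp [mirrorRect_mk]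
      have h' := h
      rw [mirrorRect_mk, e, (transform_union_reflect hC hW hr').2] at h'
      obtain ⟨L', W', h1, h2, h3, h4, h5⟩ := ih (transform_subset_of_verticesIn hW hr') h'
        fun r hr => hL r (List.mem_cons_of_mem _ hr)
      obtain ⟨⟨a, b⟩, -⟩ := verticesIn_mk.1 hr'
      refine ⟨s(v.swap, w.swap) :: L', W', ⟨⟨v.swap, hmem W hW _ a (hsym v hv), w.swap,
        hmem W hW _ b (hsym w hw), fun e => hvw (Prod.swap_injective e), rfl⟩, h1⟩, h2, h3, ?_,
        fun r hr => ?_⟩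
      · rw [List.map_cons, List.map_cons, h4]
        congr 1
        rw [← mirrorRect_mk, mirrorRect_mirrorRect]
        exact Sym2.eq_swap
      · rw [mem_double]
        rcases List.mem_cons.1 hr with rfl | hr
        · exact Or.inr (by rw [← e]; exact List.mem_cons_self)
        · exact (mem_double.1 (h5 r hr)).imp (List.mem_cons_of_mem _) (List.mem_cons_of_mem _)

theorem closure_halfOpen {v w : Pt} (h1 : v.1 ≠ w.1) (h2 : v.2 ≠ w.2) :
    closure (halfOpen v w) = Set.uIcc v.1 w.1 ×ˢ Set.uIcc v.2 w.2 := by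
  unfold halfOpen
  rw [closure_prod_eq, closure_Ico, closure_Ico]
  · rfl
  · exact fun e => h2 (by rwa [← sub_eq_zero, ← abs_eq_zero, ← max_sub_min_eq_abs', sub_eq_zero, eq_comm])
  · exact fun e => h1 (by rwa [← sub_eq_zero, ← abs_eq_zero, ← max_sub_min_eq_abs', sub_eq_zero, eq_comm])

theorem verticesIn_of_subset {C : Set Pt} {v w : Pt}
    (h : Set.uIcc v.1 w.1 ×ˢ Set.uIcc v.2 w.2 ⊆ C) : VerticesIn C s(v, w) :=
  verticesIn_mk.2 ⟨⟨h ⟨Set.left_mem_uIcc, Set.left_mem_uIcc⟩,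
    h ⟨Set.right_mem_uIcc, Set.right_mem_uIcc⟩⟩, h ⟨Set.right_mem_uIcc, Set.left_mem_uIcc⟩,
    h ⟨Set.left_mem_uIcc, Set.right_mem_uIcc⟩⟩

namespace PartialMatching

theorem symmetric_presentation {m : ℕ} (δ : PartialMatching m) : Symmetric δ.presentation := by
  have hmem : ∀ z, z ∈ δ.presentation ↔ ∃ i j : Fin m, δ.graph.Adj i j ∧
      (((i : ℕ) : ℝ) + 1, ((j : ℕ) : ℝ) + 1) = z := fun z => by
    simp [presentation]
  have hinj : ∀ i j : Fin m, ((i : ℕ) : ℝ) + 1 = ((j : ℕ) : ℝ) + 1 → i = j := fun i j e =>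
    Fin.ext (by exact_mod_cast add_right_cancel e)
  refine ⟨⟨?_, ?_⟩, ?_, ?_⟩
  · intro z hz z' hz' e
    rw [Finset.mem_coe, hmem] at hz hz'
    obtain ⟨i, j, h, rfl⟩ := hz
    obtain ⟨i', j', h', rfl⟩ := hz'
    obtain rfl := hinj i i' e
    rw [δ.degree_le_one i j j' h h']
  · intro z hz z' hz' e
    rw [Finset.mem_coe, hmem] at hz hz'
    obtain ⟨i, j, h, rfl⟩ := hz
    obtain ⟨i', j', h', rfl⟩ := hz'
    obtain rfl := hinj j j' e
    rw [δ.degree_le_one j i i' h.symm h'.symm]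
  · intro z hz
    rw [hmem] at hz ⊢
    obtain ⟨i, j, h, rfl⟩ := hz
    exact ⟨j, i, h.symm, rfl⟩
  · intro z hz
    rw [hmem] at hz
    obtain ⟨i, j, h, rfl⟩ := hz
    exact fun e => h.ne (hinj i j e)

end PartialMatching

/-! ### Minimal transformations of presentations and of associated polytopes -/

namespace LatticePolytope

theorem IsAssociated.quadSum_sub {P : LatticePolytope} {Δ Δ' : Finset Pt}
    (h : P.IsAssociated Δ Δ') (p : Pt) :
    quadSum Δ p - quadSum Δ' p = P.rotation p + P.rotation p.swap := by
  obtain ⟨rfl, h0, rfl, h1⟩ := h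
  have e : ∀ V W : Finset Pt, Disjoint V W → quadSum (V ∪ W) p = quadSum V p + quadSum W p :=
    fun V W h => Finset.sum_union h
  rw [e _ _ h0, e _ _ h1, ← rotation_mirror, rotation_eq, rotation_eq]
  ring

/-- Coherence excludes cancellation, so the rotation number is nonzero wherever a rectangle of the
list is; taking closures brings in the four vertices. -/
theorem rect_subset_support {P : LatticePolytope} {L : List (Sym2 Pt)}
    (hL : IsTransformation L P.V0 P.V1) (hc : Coherent L) {r : Sym2 Pt} (hr : r ∈ L) :
    (∀ p, rectFun r p ≠ 0 → P.rotation p ≠ 0) ∧ VerticesIn P.core r := by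
  have h : ∀ p, rectFun r p ≠ 0 → P.rotation p ≠ 0 := fun p hp => by
    rw [rotation_eq, ← (hL.invariants P.general0).2.2 p]
    exact hc.sum_ne_zero hr hp
  refine ⟨h, ?_⟩
  obtain ⟨v, w, rfl, h1, h2⟩ := hL.nondegenerate P.general0 r hr
  refine verticesIn_of_subset ?_
  rw [← closure_halfOpen h1 h2]
  exact (closure_mono fun p hp => h p ((rectFun_ne_zero_iff v w p).2 hp)).trans
    fun z hz => Or.inl (Or.inl hz)

/-- The closed rectangle is connected and covered by the support and its mirror image, two disjoint
closed sets; it cannot meet both. -/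
theorem rect_in_half {P : LatticePolytope} (hd : Disjoint P.carrier P.mirror.carrier)
    {Δ Δ' : Finset Pt} (hA : P.IsAssociated Δ Δ') (hΔ : Symmetric Δ) {L : List (Sym2 Pt)}
    (hL : IsPresentationTransformation L Δ Δ') (hc : Coherent (double L)) {r : Sym2 Pt}
    (hr : r ∈ L) : VerticesIn P.core r ∨ VerticesIn P.core (mirrorRect r) := by
  obtain ⟨v, w, rfl, h1, h2⟩ := hL.nondegenerate hΔ r hr
  have hsub : halfOpen v w ⊆ P.support ∪ Prod.swap ⁻¹' P.support := fun p hp => by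
    have := hc.sum_ne_zero (mem_double.2 (Or.inl hr)) ((rectFun_ne_zero_iff v w p).2 hp)
    rw [hL.sum_double hΔ, hA.quadSum_sub] at this
    by_cases h0 : P.rotation p = 0
    · exact Or.inr (subset_closure (by simpa [h0] using this))
    · exact Or.inl (subset_closure h0)
  have hcl : IsClosed P.support := isClosed_closure
  have hcl' : IsClosed (Prod.swap ⁻¹' P.support) := hcl.preimage continuous_swap
  have hK := (hcl.union hcl').closure_subset_iff.2 hsub
  rw [closure_halfOpen h1 h2] at hK
  have hcon : IsPreconnected (Set.uIcc v.1 w.1 ×ˢ Set.uIcc v.2 w.2) :=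
    isPreconnected_uIcc.prod isPreconnected_uIcc
  have hdis : Set.uIcc v.1 w.1 ×ˢ Set.uIcc v.2 w.2 ∩
      (P.support ∩ Prod.swap ⁻¹' P.support) = ∅ := by
    rw [Set.eq_empty_iff_forall_notMem]
    rintro z ⟨-, h, h'⟩
    exact swap_notMem_core hd (Or.inl (Or.inl h)) (Or.inl (Or.inl h'))
  rcases isPreconnected_iff_subset_of_disjoint_closed.1 hcon _ _ hcl hcl' hK hdis with h | h
  · exact Or.inl (verticesIn_of_subset (h.trans fun z hz => Or.inl (Or.inl hz)))
  · refine Or.inr ?_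
    rw [mirrorRect_mk]
    refine verticesIn_of_subset fun z hz => ?_
    have hz' : z.swap ∈ Prod.swap ⁻¹' P.support := h ⟨hz.2, hz.1⟩
    rw [Set.mem_preimage, Prod.swap_swap] at hz'
    exact Or.inl (Or.inl hz')

theorem presentationF_eq_f {m : ℕ} {δ δ' : PartialMatching m} {P : LatticePolytope}
    (hA : P.IsAssociated δ.presentation δ'.presentation)
    (hd : Disjoint P.carrier P.mirror.carrier) (h : P.HasCoherent) :
    presentationF δ.presentation δ'.presentation = P.f := by
  have hC : ∀ z ∈ P.core, z.swap ∉ P.core := fun z hz => swap_notMem_core hd hz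
  have h0 : ∀ z ∈ P.V0, z ∈ P.core := fun z hz => Or.inl (Or.inr hz)
  have h1 : ∀ z ∈ P.V1, z ∈ P.core := fun z hz => Or.inr hz
  have hΔ := δ.symmetric_presentation
  have e0 : P.V0 ∪ reflect P.V0 = δ.presentation := hA.1
  have e1 : P.V1 ∪ reflect P.V1 = δ'.presentation := hA.2.2.1
  -- A coherent list for `P` stays coherent after adding mirror images: a rectangle and a mirrored
  -- one cannot share a point, since they live on different sides.
  have up : ∀ L, IsTransformation L P.V0 P.V1 → Coherent L →
      IsPresentationTransformation L δ.presentation δ'.presentation ∧ Coherent (double L) := by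
    intro L hL hc
    refine ⟨?_, fun r hr s hs p hp hn => ?_⟩
    · rw [← e0, ← e1]
      exact hL.toPresentation hC h0 fun r hr => (rect_subset_support hL hc hr).2
    · have hin : ∀ r ∈ L, ∀ q, rectFun r q ≠ 0 → q ∈ P.core := fun r hr q hq =>
        Or.inl (Or.inl (subset_closure ((rect_subset_support hL hc hr).1 q hq)))
      have hm : ∀ r, rectFun (mirrorRect r) p.swap = rectFun r p := fun r => by
        rw [rectFun_mirrorRect, Prod.swap_swap]
      rcases mem_double.1 hr with hr | hr <;> rcases mem_double.1 hs with hs | hs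
      · exact hc r hr s hs p hp hn
      · exact hC p (hin r hr p hp.ne') (hin _ hs _ (by rw [hm]; exact hn.ne))
      · exact hC p (hin s hs p hn.ne) (hin _ hr _ (by rw [hm]; exact hp.ne'))
      · exact hc _ hr _ hs p.swap (by rwa [hm]) (by rwa [hm])
  obtain ⟨L₀, hL₀, hc₀⟩ := h
  -- Doubling a list multiplies its area by two, so minimality can be tested on doubled lists.
  have hmin : ∀ L, IsPresentationTransformation L δ.presentation δ'.presentation →
      ((∀ L', IsPresentationTransformation L' δ.presentation δ'.presentation →
        totalArea L ≤ totalArea L') ↔ Coherent (double L)) := fun L hL => by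
    rw [← minimal_iff_coherent double
      (fun L => IsPresentationTransformation L δ.presentation δ'.presentation)
      (fun p => quadSum δ.presentation p - quadSum δ'.presentation p)
      (fun L hL q => hL.sum_double hΔ q) (up L₀ hL₀ hc₀).1 (up L₀ hL₀ hc₀).2 L hL]
    simp only [totalArea_double, mul_le_mul_iff_right₀ (two_pos : (0 : ℝ) < 2)]
  rw [HasCoherent.f_eq ⟨L₀, hL₀, hc₀⟩, presentationF]
  have hinj : Set.InjOn (fun L : List (Sym2 Pt) => L.map fun r => s(r, mirrorRect r))
      {L | IsTransformation L P.V0 P.V1 ∧ Coherent L} := by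
    have hsub : {L | IsTransformation L P.V0 P.V1 ∧ Coherent L} ⊆
        {L | ∀ r ∈ L, r ∈ {r | VerticesIn P.core r}} := fun L hL r hr =>
      (rect_subset_support hL.1 hL.2 hr).2
    refine (injOn_list_map ?_).mono hsub
    intro r hr r' hr' e
    simp only [Sym2.eq_iff] at e
    rcases e with e | e
    · exact e.1
    · exfalso
      induction r' with
      | _ v w =>
        rw [e.1, mirrorRect_mk] at hr
        exact hC v (verticesIn_mk.1 hr').1.1 (verticesIn_mk.1 hr).1.1
  rw [← hinj.encard_image]
  congr 1
  ext M
  constructor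
  · rintro ⟨L, ⟨hL, hLm⟩, rfl⟩
    have hc := (hmin L hL).1 hLm
    have hL' := hL
    rw [← e0] at hL'
    obtain ⟨L', W', a, b, c, d, e⟩ := hL'.exists_half hC h0 fun r hr =>
      rect_in_half hd hA hΔ hL hc hr
    have hmem : ∀ W : Finset Pt, (∀ z ∈ W, z ∈ P.core) →
        ∀ z, z ∈ W ↔ z ∈ P.core ∧ z ∈ W ∪ reflect W := fun W hW z => by
      rw [Finset.mem_union, mem_reflect]
      exact ⟨fun h => ⟨hW z h, Or.inl h⟩, fun ⟨h, h'⟩ =>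
        h'.resolve_right fun h'' => hC z h (hW _ h'')⟩
    -- Each set consists of the points of the final presentation that lie in the core.
    have eW : W' = P.V1 := by
      ext z
      rw [hmem W' b, hmem P.V1 h1, ← c, e1]
    subst eW
    exact ⟨L', ⟨a, fun r hr s hs => hc r (e r hr) s (e s hs)⟩, d⟩
  · rintro ⟨L, ⟨hL, hc⟩, rfl⟩
    obtain ⟨a, b⟩ := up L hL hc
    exact ⟨L, ⟨a, (hmin L a).2 b⟩, rfl⟩

end LatticePolytope

end LatticeMatching

namespace LatticeMatching

/-! ### The rotation number of an embedded closed path -/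

/-- The indicator of `s ≤ x`. -/
noncomputable def stepLe (s x : ℝ) : ℤ := if s ≤ x then 1 else 0

theorem mem_uIcc_of_stepLe_ne {t a b : ℝ} (h : stepLe t a ≠ stepLe t b) : t ∈ Set.uIcc a b := by
  unfold stepLe at h
  rw [Set.mem_uIcc]
  split_ifs at h <;> first | exact absurd rfl h | grind

/-- `f` is one of the two one-sided indicators at `c`. -/
def IsStep (c : ℝ) (f : ℝ → ℤ) : Prop := f = step c ∨ f = stepLe c

theorem IsStep.mem_uIcc {c a b : ℝ} {f : ℝ → ℤ} (hf : IsStep c f) (h : f a ≠ f b) :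
    c ∈ Set.uIcc a b := by
  rcases hf with rfl | rfl
  · exact mem_uIcc_of_step_ne h
  · exact mem_uIcc_of_stepLe_ne h

theorem isStep_step (c : ℝ) : IsStep c (step c) := Or.inl rfl
theorem isStep_stepLe (c : ℝ) : IsStep c (stepLe c) := Or.inr rfl

theorem step_ne_stepLe {c x : ℝ} (h : step c x ≠ stepLe c x) : x = c := by
  unfold step stepLe at h
  split_ifs at h <;> first | exact absurd rfl h | grind

namespace ClosedPath

variable (γ : ClosedPath)

/-- The rotation number, for general test functions in place of the indicators of half-lines. -/
def pairing (f g : ℝ → ℤ) : ℤ :=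
  ∑ i, (f (γ.a i).1 * g (γ.a i).2 - f (γ.b i).1 * g (γ.b i).2)

theorem sum_succ (F : Fin (γ.n + 1) → ℤ) : ∑ i, F (i + 1) = ∑ i, F i :=
  Equiv.sum_comp (Equiv.addRight (1 : Fin (γ.n + 1))) F

/-- Summation by parts along the closed path. With `step` taken as the limit from the right or above
and `stepLe` as that from the left or below, the pairings at a corner are the rotation numbers in
the four quadrants around it. -/
theorem pairing_vertical (f g : ℝ → ℤ) : γ.pairing f g =
    ∑ i, f (γ.b i).1 * (g (γ.a (i + 1)).2 - g (γ.b i).2) := by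
  unfold pairing
  rw [Finset.sum_sub_distrib, ← γ.sum_succ fun i => f (γ.a i).1 * g (γ.a i).2,
    ← Finset.sum_sub_distrib]
  refine Finset.sum_congr rfl fun i _ => ?_
  rw [γ.vertical]
  ring

theorem pairing_horizontal (f g : ℝ → ℤ) : γ.pairing f g =
    ∑ i, g (γ.a i).2 * (f (γ.a i).1 - f (γ.b i).1) := by
  unfold pairing
  refine Finset.sum_congr rfl fun i _ => ?_
  rw [γ.horizontal]
  ring

theorem rotation_eq (p : Pt) : γ.rotation p = γ.pairing (step p.1) (step p.2) := by
  rw [pairing_vertical, rotation]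
  refine Finset.sum_congr rfl fun i _ => ?_
  rw [rayCrossing_eq (γ.vertical i)]
  unfold quad
  rw [γ.vertical]
  ring

theorem mem_vertical_iff {i : Fin (γ.n + 1)} {p : Pt} :
    p ∈ segment ℝ (γ.b i) (γ.a (i + 1)) ↔
      p.1 = (γ.b i).1 ∧ p.2 ∈ Set.uIcc (γ.b i).2 (γ.a (i + 1)).2 :=
  mem_segment_vertical (γ.vertical i)

theorem mem_horizontal_iff {i : Fin (γ.n + 1)} {p : Pt} :
    p ∈ segment ℝ (γ.a i) (γ.b i) ↔
      p.2 = (γ.a i).2 ∧ p.1 ∈ Set.uIcc (γ.a i).1 (γ.b i).1 :=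
  mem_segment_horizontal (γ.horizontal i)

variable {γ}

/-- If no vertical segment leaves `z` in the direction in which `g` is one-sided, the pairings with
the two one-sided indicators at `z.1` agree. -/
theorem pairing_eq_of_free_vertical (z : Pt) (g : ℝ → ℤ)
    (h : ∀ i, (γ.b i).1 = z.1 → g (γ.a (i + 1)).2 = g (γ.b i).2) :
    γ.pairing (step z.1) g = γ.pairing (stepLe z.1) g := by
  rw [pairing_vertical, pairing_vertical]
  refine Finset.sum_congr rfl fun i _ => ?_
  by_cases e : (γ.b i).1 = z.1
  · rw [h i e, sub_self, mul_zero, mul_zero]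
  · congr 1
    by_contra hne
    exact e (step_ne_stepLe hne)

theorem pairing_eq_of_free_horizontal (z : Pt) (f : ℝ → ℤ)
    (h : ∀ i, (γ.a i).2 = z.2 → f (γ.a i).1 = f (γ.b i).1) :
    γ.pairing f (step z.2) = γ.pairing f (stepLe z.2) := by
  rw [pairing_horizontal, pairing_horizontal]
  refine Finset.sum_congr rfl fun i _ => ?_
  by_cases e : (γ.a i).2 = z.2
  · rw [h i e, sub_self, mul_zero, mul_zero]
  · congr 1
    by_contra hne
    exact e (step_ne_stepLe hne)

theorem Embedded.horizontal_unique (h : γ.Embedded) {i j : Fin (γ.n + 1)} {p : Pt}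
    (hi : p ∈ segment ℝ (γ.a i) (γ.b i)) (hj : p ∈ segment ℝ (γ.a j) (γ.b j)) : i = j := by
  by_contra hne
  exact Set.disjoint_left.1 (h.2.1 i j hne) hi hj

theorem Embedded.vertical_unique (h : γ.Embedded) {i j : Fin (γ.n + 1)} {p : Pt}
    (hi : p ∈ segment ℝ (γ.b i) (γ.a (i + 1))) (hj : p ∈ segment ℝ (γ.b j) (γ.a (j + 1))) :
    i = j := by
  by_contra hne
  exact Set.disjoint_left.1 (h.2.2.1 i j hne) hi hj

theorem Embedded.fst_ne (h : γ.Embedded) (i : Fin (γ.n + 1)) : (γ.a i).1 ≠ (γ.b i).1 :=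
  fun e => (h.1 i).1 (Prod.ext e (γ.horizontal i))

theorem Embedded.snd_ne (h : γ.Embedded) (i : Fin (γ.n + 1)) : (γ.b i).2 ≠ (γ.a (i + 1)).2 :=
  fun e => (h.1 i).2 (Prod.ext (γ.vertical i) e)

/-- If the segment through `z` does not extend to the side seen by `g`, embeddedness forbids any
other vertical segment there, so the quadrants to the left and right of `z` on that side carry the
same value. -/
theorem Embedded.free_vertical (h : γ.Embedded) {z : Pt} {i : Fin (γ.n + 1)}
    (hz : z ∈ segment ℝ (γ.b i) (γ.a (i + 1))) {g : ℝ → ℤ} (hg : IsStep z.2 g)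
    (hi : g (γ.a (i + 1)).2 = g (γ.b i).2) :
    γ.pairing (step z.1) g = γ.pairing (stepLe z.1) g := by
  refine pairing_eq_of_free_vertical z g fun j hj => ?_
  by_contra hne
  have : z ∈ segment ℝ (γ.b j) (γ.a (j + 1)) :=
    γ.mem_vertical_iff.2 ⟨hj.symm, hg.mem_uIcc (Ne.symm hne)⟩
  obtain rfl := h.vertical_unique this hz
  exact hne hi

theorem Embedded.free_horizontal (h : γ.Embedded) {z : Pt} {i : Fin (γ.n + 1)}
    (hz : z ∈ segment ℝ (γ.a i) (γ.b i)) {f : ℝ → ℤ} (hf : IsStep z.1 f)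
    (hi : f (γ.a i).1 = f (γ.b i).1) :
    γ.pairing f (step z.2) = γ.pairing f (stepLe z.2) := by
  refine pairing_eq_of_free_horizontal z f fun j hj => ?_
  by_contra hne
  have : z ∈ segment ℝ (γ.a j) (γ.b j) :=
    γ.mem_horizontal_iff.2 ⟨hj.symm, hf.mem_uIcc hne⟩
  obtain rfl := h.horizontal_unique this hz
  exact hne hi

/-- The one-sided pairings do not change along a vertical segment. -/
theorem Embedded.along_vertical (h : γ.Embedded) (i : Fin (γ.n + 1)) {f g g' : ℝ → ℤ}
    (hf : IsStep (γ.b i).1 f)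
    (hg : ∀ y, g y ≠ g' y → (γ.b i).2 < y ∧ y < (γ.a (i + 1)).2 ∨
      (γ.a (i + 1)).2 < y ∧ y < (γ.b i).2) : γ.pairing f g = γ.pairing f g' := by
  rw [pairing_horizontal, pairing_horizontal]
  refine Finset.sum_congr rfl fun k _ => ?_
  by_cases hk : g (γ.a k).2 = g' (γ.a k).2
  · rw [hk]
  · have hy := hg _ hk
    have e : f (γ.a k).1 = f (γ.b k).1 := by
      by_contra hne
      have h1 : ((γ.b i).1, (γ.a k).2) ∈ segment ℝ (γ.a k) (γ.b k) :=
        γ.mem_horizontal_iff.2 ⟨rfl, hf.mem_uIcc hne⟩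
      have h2 : ((γ.b i).1, (γ.a k).2) ∈ segment ℝ (γ.b i) (γ.a (i + 1)) :=
        γ.mem_vertical_iff.2 ⟨rfl, Set.mem_uIcc.2 (hy.imp (fun h => ⟨h.1.le, h.2.le⟩)
          fun h => ⟨h.1.le, h.2.le⟩)⟩
      rcases h.2.2.2 _ _ _ h1 h2 with ⟨rfl, e⟩ | ⟨rfl, e⟩
      · have e' := congrArg Prod.snd e
        simp only at e'
        rw [e'] at hy
        rcases hy with hy | hy <;> linarith [hy.1, hy.2]
      · rcases hy with hy | hy <;> linarith [hy.1, hy.2]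
    rw [e, sub_self, mul_zero, mul_zero]

/-- The one-sided pairings do not change along a horizontal segment. -/
theorem Embedded.along_horizontal (h : γ.Embedded) (i : Fin (γ.n + 1)) {f f' g : ℝ → ℤ}
    (hg : IsStep (γ.a i).2 g)
    (hf : ∀ x, f x ≠ f' x → (γ.a i).1 < x ∧ x < (γ.b i).1 ∨
      (γ.b i).1 < x ∧ x < (γ.a i).1) : γ.pairing f g = γ.pairing f' g := by
  rw [pairing_vertical, pairing_vertical]
  refine Finset.sum_congr rfl fun k _ => ?_
  by_cases hk : f (γ.b k).1 = f' (γ.b k).1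
  · rw [hk]
  · have hx := hf _ hk
    have e : g (γ.a (k + 1)).2 = g (γ.b k).2 := by
      by_contra hne
      have h1 : ((γ.b k).1, (γ.a i).2) ∈ segment ℝ (γ.b k) (γ.a (k + 1)) :=
        γ.mem_vertical_iff.2 ⟨rfl, hg.mem_uIcc (Ne.symm hne)⟩
      have h2 : ((γ.b k).1, (γ.a i).2) ∈ segment ℝ (γ.a i) (γ.b i) :=
        γ.mem_horizontal_iff.2 ⟨rfl, Set.mem_uIcc.2 (hx.imp (fun h => ⟨h.1.le, h.2.le⟩)
          fun h => ⟨h.1.le, h.2.le⟩)⟩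
      rcases h.2.2.2 _ _ _ h2 h1 with ⟨rfl, e⟩ | ⟨rfl, e⟩
      · rcases hx with hx | hx <;> linarith [hx.1, hx.2]
      · have e' := congrArg Prod.fst e
        simp only at e'
        rw [e'] at hx
        rcases hx with hx | hx <;> linarith [hx.1, hx.2]
    rw [e, sub_self, mul_zero, mul_zero]

variable (γ)

/-- The rotation number to the left of the `i`-th vertical segment. -/
noncomputable def leftValue (i : Fin (γ.n + 1)) : ℤ :=
  if (γ.b i).2 < (γ.a (i + 1)).2 then γ.pairing (stepLe (γ.b i).1) (step (γ.b i).2)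
  else γ.pairing (step (γ.b i).1) (stepLe (γ.b i).2)

variable {γ}

theorem step_self (x : ℝ) : step x x = 0 := by simp [step]
theorem stepLe_self (x : ℝ) : stepLe x x = 1 := by simp [stepLe]
theorem step_of_lt {x y : ℝ} (h : x < y) : step x y = 1 := by simp [step, h]
theorem stepLe_of_lt {x y : ℝ} (h : x < y) : stepLe x y = 1 := by simp [stepLe, h.le]
theorem step_of_gt {x y : ℝ} (h : y < x) : step x y = 0 := by simp [step, h.le]
theorem Embedded.leftValue_end (h : γ.Embedded) (i : Fin (γ.n + 1)) : γ.leftValue i =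
    if (γ.b i).2 < (γ.a (i + 1)).2 then
      γ.pairing (stepLe (γ.a (i + 1)).1) (stepLe (γ.a (i + 1)).2)
    else γ.pairing (step (γ.a (i + 1)).1) (step (γ.a (i + 1)).2) := by
  unfold leftValue
  rw [← γ.vertical i]
  split_ifs with hi
  · refine h.along_vertical i (isStep_stepLe _) fun y hy => ?_
    unfold step stepLe at hy
    split_ifs at hy <;> first | exact absurd rfl hy | grind
  · have hi' := lt_of_le_of_ne (not_lt.1 hi) (h.snd_ne i).symm
    refine h.along_vertical i (isStep_step _) fun y hy => ?_
    unfold step stepLe at hy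
    split_ifs at hy <;> first | exact absurd rfl hy | grind

/-- Turning a corner keeps the left side on the left. In two of the four turns the same quadrant
lies on the left before and after; in the other two, the left region fills three quadrants, and two
passages across free rays connect them. -/
theorem Embedded.corner_a (h : γ.Embedded) (i : Fin (γ.n + 1)) : γ.leftValue i =
    if (γ.a (i + 1)).1 < (γ.b (i + 1)).1 then
      γ.pairing (step (γ.a (i + 1)).1) (step (γ.a (i + 1)).2)
    else γ.pairing (stepLe (γ.a (i + 1)).1) (stepLe (γ.a (i + 1)).2) := by
  rw [h.leftValue_end i]
  set z := γ.a (i + 1) with hz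
  have hV : z ∈ segment ℝ (γ.b i) (γ.a (i + 1)) := right_mem_segment ℝ _ _
  have hH : z ∈ segment ℝ (γ.a (i + 1)) (γ.b (i + 1)) := left_mem_segment ℝ _ _
  have h1 := h.fst_ne (i + 1)
  have h2 := h.snd_ne i
  rw [← hz] at h1 h2
  split_ifs with hv hh hh
  · rw [h.free_vertical hV (isStep_step _), h.free_horizontal hH (isStep_stepLe _)]
    · rw [← hz, stepLe_self, stepLe_of_lt hh]
    · rw [← hz, step_self, step_of_gt hv]
  · rfl
  · rfl
  · have hv' := lt_of_le_of_ne (not_lt.1 hv) h2.symm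
    have hh' := lt_of_le_of_ne (not_lt.1 hh) h1.symm
    rw [← h.free_vertical hV (isStep_stepLe _), ← h.free_horizontal hH (isStep_step _)]
    · rw [← hz, step_self, step_of_gt hh']
    · rw [← hz, stepLe_self, stepLe_of_lt hv']

theorem Embedded.corner_b (h : γ.Embedded) (i : Fin (γ.n + 1)) : γ.leftValue i =
    if (γ.a i).1 < (γ.b i).1 then γ.pairing (stepLe (γ.b i).1) (step (γ.b i).2)
    else γ.pairing (step (γ.b i).1) (stepLe (γ.b i).2) := by
  unfold leftValue
  set z := γ.b i with hz
  have hV : z ∈ segment ℝ (γ.b i) (γ.a (i + 1)) := left_mem_segment ℝ _ _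
  have hH : z ∈ segment ℝ (γ.a i) (γ.b i) := right_mem_segment ℝ _ _
  have h1 := h.fst_ne i
  have h2 := h.snd_ne i
  rw [← hz] at h1 h2
  split_ifs with hv hh hh
  · rfl
  · have hh' := lt_of_le_of_ne (not_lt.1 hh) h1.symm
    rw [h.free_horizontal hH (isStep_stepLe _), ← h.free_vertical hV (isStep_stepLe _)]
    · rw [← hz, stepLe_self, stepLe_of_lt hv]
    · rw [← hz, stepLe_self, stepLe_of_lt hh']
  · have hv' := lt_of_le_of_ne (not_lt.1 hv) h2.symm
    rw [← h.free_vertical hV (isStep_step _), h.free_horizontal hH (isStep_step _)]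
    · rw [← hz, step_self, step_of_gt hh]
    · rw [← hz, step_self, step_of_gt hv']
  · rfl

theorem Embedded.leftValue_succ (h : γ.Embedded) (i : Fin (γ.n + 1)) :
    γ.leftValue (i + 1) = γ.leftValue i := by
  rw [h.corner_a i, h.corner_b (i + 1), ← γ.horizontal (i + 1)]
  split_ifs with hh
  · refine h.along_horizontal (i + 1) (isStep_step _) fun x hx => ?_
    unfold step stepLe at hx
    split_ifs at hx <;> first | exact absurd rfl hx | grind
  · have hh' := lt_of_le_of_ne (not_lt.1 hh) (h.fst_ne (i + 1)).symm
    refine h.along_horizontal (i + 1) (isStep_stepLe _) fun x hx => ?_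
    unfold step stepLe at hx
    split_ifs at hx <;> first | exact absurd rfl hx | grind

theorem Embedded.leftValue_eq (h : γ.Embedded) (i : Fin (γ.n + 1)) :
    γ.leftValue i = γ.leftValue 0 := by
  induction i using Fin.induction with
  | zero => rfl
  | succ i ih => rw [← Fin.coeSucc_eq_succ, h.leftValue_succ, ih]

/-- The values on the two sides of a vertical segment. -/
theorem Embedded.side_values (h : γ.Embedded) {i : Fin (γ.n + 1)} {t : ℝ}
    (ht : step t (γ.a (i + 1)).2 ≠ step t (γ.b i).2) :
    (γ.pairing (stepLe (γ.b i).1) (step t) = γ.leftValue 0 ∧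
      γ.pairing (step (γ.b i).1) (step t) = γ.leftValue 0 - 1) ∨
    (γ.pairing (step (γ.b i).1) (step t) = γ.leftValue 0 ∧
      γ.pairing (stepLe (γ.b i).1) (step t) = γ.leftValue 0 - 1) := by
  have jump : γ.pairing (stepLe (γ.b i).1) (step t) - γ.pairing (step (γ.b i).1) (step t) =
      step t (γ.a (i + 1)).2 - step t (γ.b i).2 := by
    rw [pairing_vertical, pairing_vertical, ← Finset.sum_sub_distrib,
      Finset.sum_eq_single i _ fun h => absurd (Finset.mem_univ i) h]
    · rw [stepLe_self, step_self]; ring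
    · intro j _ hji
      rw [← sub_mul]
      by_contra hne
      have e1 : (γ.b j).1 = (γ.b i).1 := step_ne_stepLe fun e => hne (by rw [e, sub_self, zero_mul])
      have e2 : step t (γ.b j).2 ≠ step t (γ.a (j + 1)).2 := fun e =>
        hne (by rw [e, sub_self, mul_zero])
      exact hji (h.vertical_unique (p := ((γ.b i).1, t))
        (γ.mem_vertical_iff.2 ⟨e1.symm, mem_uIcc_of_step_ne e2⟩)
        (γ.mem_vertical_iff.2 ⟨rfl, mem_uIcc_of_step_ne ht.symm⟩))
  have hl := h.leftValue_eq i
  generalize γ.leftValue 0 = l at hl ⊢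
  unfold leftValue at hl
  split_ifs at hl with hv
  · refine Or.inl ?_
    have e : γ.pairing (stepLe (γ.b i).1) (step t) =
        γ.pairing (stepLe (γ.b i).1) (step (γ.b i).2) := by
      refine h.along_vertical i (isStep_stepLe _) fun y hy => ?_
      unfold step at hy ht
      split_ifs at hy ht <;> first | exact absurd rfl hy | exact absurd rfl ht | grind
    have e' : step t (γ.a (i + 1)).2 - step t (γ.b i).2 = 1 := by
      unfold step at ht ⊢
      split_ifs at ht ⊢ <;> first | exact absurd rfl ht | rfl | grind
    exact ⟨e.trans hl, by linarith [e.trans hl]⟩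
  · have hv' := lt_of_le_of_ne (not_lt.1 hv) (h.snd_ne i).symm
    refine Or.inr ?_
    have e : γ.pairing (step (γ.b i).1) (step t) =
        γ.pairing (step (γ.b i).1) (stepLe (γ.b i).2) := by
      refine h.along_vertical i (isStep_step _) fun y hy => ?_
      unfold step stepLe at hy
      unfold step at ht
      split_ifs at hy ht <;> first | exact absurd rfl hy | exact absurd rfl ht | grind
    have e' : step t (γ.a (i + 1)).2 - step t (γ.b i).2 = -1 := by
      unfold step at ht ⊢
      split_ifs at ht ⊢ <;> first | exact absurd rfl ht | rfl | grind
    exact ⟨e.trans hl, by linarith [e.trans hl]⟩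

/-- Moving `p` to the right changes nothing until the first vertical segment at its height, where
one of the two side values is read off; if there is no such segment, the value is `0`. -/
theorem Embedded.rotation_cases (h : γ.Embedded) (p : Pt) :
    γ.rotation p = 0 ∨ γ.rotation p = γ.leftValue 0 ∨ γ.rotation p = γ.leftValue 0 - 1 := by
  rw [rotation_eq]
  set S := Finset.univ.filter fun i =>
    p.1 < (γ.b i).1 ∧ step p.2 (γ.a (i + 1)).2 ≠ step p.2 (γ.b i).2 with hS
  rcases S.eq_empty_or_nonempty with he | hne
  · left
    rw [pairing_vertical]
    refine Finset.sum_eq_zero fun i _ => ?_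
    by_contra hi
    have : i ∈ S := by
      rw [hS, Finset.mem_filter]
      refine ⟨Finset.mem_univ i, ?_, fun e => hi (by rw [e, sub_self, mul_zero])⟩
      by_contra hlt
      exact hi (by simp [step, hlt])
    rw [he] at this
    exact absurd this (Finset.notMem_empty i)
  · right
    obtain ⟨j, hj, hmin⟩ := Finset.exists_min_image S (fun i => (γ.b i).1) hne
    have hj' := (Finset.mem_filter.1 hj).2
    have e : γ.pairing (step p.1) (step p.2) = γ.pairing (stepLe (γ.b j).1) (step p.2) := by
      rw [pairing_vertical, pairing_vertical]
      refine Finset.sum_congr rfl fun i _ => ?_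
      by_cases hi : step p.2 (γ.a (i + 1)).2 = step p.2 (γ.b i).2
      · rw [hi, sub_self, mul_zero, mul_zero]
      · congr 1
        by_cases hlt : p.1 < (γ.b i).1
        · have := hmin i (Finset.mem_filter.2 ⟨Finset.mem_univ i, hlt, hi⟩)
          simp [step, stepLe, hlt, this]
        · simp [step, stepLe, hlt, (not_lt.1 hlt).trans_lt hj'.1]
    rw [e]
    rcases h.side_values hj'.2 with h | h
    · exact Or.inl h.1
    · exact Or.inr h.2

/-- To the right of the rightmost vertical segment at height `t` the rotation number vanishes. As
the side values are `leftValue 0` and `leftValue 0 - 1`, one of these is zero. -/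
theorem Embedded.leftValue_zero_or_one (h : γ.Embedded) :
    γ.leftValue 0 = 0 ∨ γ.leftValue 0 = 1 := by
  set t := min (γ.b 0).2 (γ.a (0 + 1)).2
  set S := Finset.univ.filter fun i => step t (γ.a (i + 1)).2 ≠ step t (γ.b i).2 with hS
  have hne : S.Nonempty := by
    refine ⟨0, Finset.mem_filter.2 ⟨Finset.mem_univ _, ?_⟩⟩
    have := h.snd_ne 0
    rcases this.lt_or_gt with hlt | hlt
    · simp only [t, min_eq_left hlt.le, step_self, step_of_lt hlt, ne_eq, one_ne_zero,
        not_false_eq_true]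
    · simp only [t, min_eq_right hlt.le, step_self, step_of_lt hlt, ne_eq, zero_ne_one,
        not_false_eq_true]
  obtain ⟨j, hj, hmax⟩ := Finset.exists_max_image S (fun i => (γ.b i).1) hne
  have e : γ.pairing (step (γ.b j).1) (step t) = 0 := by
    rw [pairing_vertical]
    refine Finset.sum_eq_zero fun i _ => ?_
    by_cases hi : step t (γ.a (i + 1)).2 = step t (γ.b i).2
    · rw [hi, sub_self, mul_zero]
    · have := hmax i (Finset.mem_filter.2 ⟨Finset.mem_univ i, hi⟩)
      simp [step, this]
  rcases h.side_values (Finset.mem_filter.1 hj).2 with h | h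
  · right; linarith [h.2]
  · left; linarith [h.1]

/-- The rotation number of an embedded closed path takes only the values `0` and `ε`, for one
sign `ε`. -/
theorem Embedded.exists_sign (h : γ.Embedded) :
    ∃ ε : ℤ, (ε = 1 ∨ ε = -1) ∧ ∀ p, γ.rotation p = 0 ∨ γ.rotation p = ε := by
  rcases h.leftValue_zero_or_one with h0 | h0
  · refine ⟨-1, Or.inr rfl, fun p => ?_⟩
    have := h.rotation_cases p
    rw [h0] at this
    tauto
  · refine ⟨1, Or.inl rfl, fun p => ?_⟩
    have := h.rotation_cases p
    rw [h0] at this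
    tauto

end ClosedPath

end LatticeMatching

namespace LatticeMatching

/-! ### Closed walks along the edges of a lattice polytope -/

/-- `s` and `t` lie between `u` and `v`, and `s` comes first on the way from `u` to `v`. -/
def Dir (u v s t : ℝ) : Prop := (u ≤ s ∧ s ≤ t ∧ t ≤ v) ∨ (v ≤ t ∧ t ≤ s ∧ s ≤ u)

namespace LatticePolytope

variable {P : LatticePolytope}

theorem XEdge.fst_ne {u v : Pt} (h : P.XEdge u v) : u.1 ≠ v.1 := fun e => h.2.2.2 (Prod.ext e h.2.2.1)

theorem YEdge.snd_ne {u v : Pt} (h : P.YEdge u v) : u.2 ≠ v.2 := fun e => h.2.2.2 (Prod.ext h.2.2.1 e)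

theorem XEdge.unique {u v u' v' : Pt} (h : P.XEdge u v) (h' : P.XEdge u' v') (e : u.2 = u'.2) :
    u = u' ∧ v = v' :=
  ⟨P.y_injOn0 h.1 h'.1 e, P.y_injOn1 h.2.1 h'.2.1 (h.2.2.1.symm.trans (e.trans h'.2.2.1))⟩

theorem YEdge.unique {u v u' v' : Pt} (h : P.YEdge u v) (h' : P.YEdge u' v') (e : u.1 = u'.1) :
    u = u' ∧ v = v' :=
  ⟨P.x_injOn1 h.1 h'.1 e, P.x_injOn0 h.2.1 h'.2.1 (h.2.2.1.symm.trans (e.trans h'.2.2.1))⟩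

variable (P)

/-- The segment from `s` to `t` runs along an edge in the `x`-direction. -/
def HStep (s t : Pt) : Prop :=
  ∃ u v, P.XEdge u v ∧ s.2 = u.2 ∧ t.2 = u.2 ∧ Dir u.1 v.1 s.1 t.1

/-- The segment from `s` to `t` runs along an edge in the `y`-direction. -/
def VStep (s t : Pt) : Prop :=
  ∃ u v, P.YEdge u v ∧ s.1 = u.1 ∧ t.1 = u.1 ∧ Dir u.2 v.2 s.2 t.2

variable {P}

theorem dir_iff {u v s t : ℝ} :
    (s ∈ Set.uIcc u v ∧ t ∈ Set.uIcc s v) ↔ Dir u v s t := by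
  unfold Dir
  rw [Set.mem_uIcc, Set.mem_uIcc]
  grind

theorem hStep_iff {s t : Pt} : P.HStep s t ↔
    ∃ u v, P.XEdge u v ∧ s ∈ segment ℝ u v ∧ t ∈ segment ℝ s v := by
  refine exists_congr fun u => exists_congr fun v => and_congr_right fun h => ?_
  rw [mem_segment_horizontal h.2.2.1, ← dir_iff]
  constructor
  · rintro ⟨h1, h2, h3, h4⟩
    exact ⟨⟨h1, h3⟩, (mem_segment_horizontal (h1.trans h.2.2.1)).2 ⟨h2.trans h1.symm, h4⟩⟩
  · rintro ⟨⟨h1, h3⟩, h4⟩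
    obtain ⟨h5, h6⟩ := (mem_segment_horizontal (h1.trans h.2.2.1)).1 h4
    exact ⟨h1, h5.trans h1, h3, h6⟩

theorem vStep_iff {s t : Pt} : P.VStep s t ↔
    ∃ u v, P.YEdge u v ∧ s ∈ segment ℝ u v ∧ t ∈ segment ℝ s v := by
  refine exists_congr fun u => exists_congr fun v => and_congr_right fun h => ?_
  rw [mem_segment_vertical h.2.2.1, ← dir_iff]
  constructor
  · rintro ⟨h1, h2, h3, h4⟩
    exact ⟨⟨h1, h3⟩, (mem_segment_vertical (h1.trans h.2.2.1)).2 ⟨h2.trans h1.symm, h4⟩⟩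
  · rintro ⟨⟨h1, h3⟩, h4⟩
    obtain ⟨h5, h6⟩ := (mem_segment_vertical (h1.trans h.2.2.1)).1 h4
    exact ⟨h1, h5.trans h1, h3, h6⟩

theorem HStep.snd_eq {s t : Pt} (h : P.HStep s t) : s.2 = t.2 := by
  obtain ⟨u, v, -, h1, h2, -⟩ := h
  rw [h1, h2]

theorem VStep.fst_eq {s t : Pt} (h : P.VStep s t) : s.1 = t.1 := by
  obtain ⟨u, v, -, h1, h2, -⟩ := h
  rw [h1, h2]

/-- Two equally directed runs on one edge that share a point can swap their ends; this is the
surgery by which closed walks are cut. -/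
theorem dir_exchange {u v s t s' t' p : ℝ} (huv : u ≠ v) (h : Dir u v s t) (h' : Dir u v s' t')
    (hp : p ∈ Set.uIcc s t) (hp' : p ∈ Set.uIcc s' t') : Dir u v s t' := by
  rw [Set.mem_uIcc] at hp hp'
  unfold Dir at *
  rcases huv.lt_or_gt with huv | huv <;> grind

theorem dir_split {u v s t p : ℝ} (huv : u ≠ v) (h : Dir u v s t) (hp : p ∈ Set.uIcc s t) :
    Dir u v s p ∧ Dir u v p t := by
  rw [Set.mem_uIcc] at hp
  unfold Dir at *
  rcases huv.lt_or_gt with huv | huv <;> grind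

theorem HStep.exchange {s t s' t' p : Pt} (h : P.HStep s t) (h' : P.HStep s' t')
    (hp : p ∈ segment ℝ s t) (hp' : p ∈ segment ℝ s' t') : P.HStep s t' := by
  have hp := (mem_segment_horizontal h.snd_eq).1 hp
  have hp' := (mem_segment_horizontal h'.snd_eq).1 hp'
  obtain ⟨u, v, he, h1, h2, h3⟩ := h
  obtain ⟨u', v', he', h1', h2', h3'⟩ := h'
  obtain ⟨rfl, rfl⟩ := he.unique he' (by rw [← h1, ← hp.1, hp'.1, h1'])
  exact ⟨u, v, he, h1, h2', dir_exchange he.fst_ne h3 h3' hp.2 hp'.2⟩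

theorem VStep.exchange {s t s' t' p : Pt} (h : P.VStep s t) (h' : P.VStep s' t')
    (hp : p ∈ segment ℝ s t) (hp' : p ∈ segment ℝ s' t') : P.VStep s t' := by
  have hp := (mem_segment_vertical h.fst_eq).1 hp
  have hp' := (mem_segment_vertical h'.fst_eq).1 hp'
  obtain ⟨u, v, he, h1, h2, h3⟩ := h
  obtain ⟨u', v', he', h1', h2', h3'⟩ := h'
  obtain ⟨rfl, rfl⟩ := he.unique he' (by rw [← h1, ← hp.1, hp'.1, h1'])
  exact ⟨u, v, he, h1, h2', dir_exchange he.snd_ne h3 h3' hp.2 hp'.2⟩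

theorem HStep.split {s t p : Pt} (h : P.HStep s t) (hp : p ∈ segment ℝ s t) :
    P.HStep s p ∧ P.HStep p t := by
  have hp := (mem_segment_horizontal h.snd_eq).1 hp
  obtain ⟨u, v, he, h1, h2, h3⟩ := h
  obtain ⟨a, b⟩ := dir_split he.fst_ne h3 hp.2
  exact ⟨⟨u, v, he, h1, hp.1.trans h1, a⟩, ⟨u, v, he, hp.1.trans h1, h2, b⟩⟩

theorem VStep.split {s t p : Pt} (h : P.VStep s t) (hp : p ∈ segment ℝ s t) :
    P.VStep s p ∧ P.VStep p t := by
  have hp := (mem_segment_vertical h.fst_eq).1 hp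
  obtain ⟨u, v, he, h1, h2, h3⟩ := h
  obtain ⟨a, b⟩ := dir_split he.snd_ne h3 hp.2
  exact ⟨⟨u, v, he, h1, hp.1.trans h1, a⟩, ⟨u, v, he, hp.1.trans h1, h2, b⟩⟩

/-- There is a walk from `s` to `t` along the oriented edges of `P`, made of `n` pairs of a
horizontal and a vertical step, that contributes `r` to the rotation number about `p`. -/
inductive Walk (P : LatticePolytope) (p : Pt) : Pt → Pt → ℕ → ℤ → Prop
  | nil (s : Pt) : Walk P p s s 0 0
  | cons {s b t u : Pt} {n : ℕ} {r : ℤ} (h : P.HStep s b) (v : P.VStep b t)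
      (w : Walk P p t u n r) : Walk P p s u (n + 1) (rayCrossing p b t + r)

theorem Walk.append {p s t u : Pt} {n m : ℕ} {r r' : ℤ} (w : P.Walk p s t n r)
    (w' : P.Walk p t u m r') : P.Walk p s u (n + m) (r + r') := by
  induction w with
  | nil => simpa using w'
  | cons h v _ ih =>
    have := Walk.cons h v (ih w')
    rwa [← add_assoc, add_right_comm] at this

theorem Walk.single {p s b t : Pt} (h : P.HStep s b) (v : P.VStep b t) :
    P.Walk p s t 1 (rayCrossing p b t) := by
  simpa using Walk.cons h v (Walk.nil (p := p) t)

theorem Walk.exists_points {p s t : Pt} {n : ℕ} {r : ℤ} (w : P.Walk p s t n r) :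
    ∃ a b : ℕ → Pt, a 0 = s ∧ a n = t ∧
      (∀ i < n, P.HStep (a i) (b i) ∧ P.VStep (b i) (a (i + 1))) ∧
      r = ∑ i ∈ Finset.range n, rayCrossing p (b i) (a (i + 1)) := by
  induction w with
  | nil s => exact ⟨fun _ => s, fun _ => s, rfl, rfl, by simp, by simp⟩
  | @cons s b₀ t u n r h v w ih =>
    obtain ⟨a, b, h0, h1, h2, h3⟩ := ih
    refine ⟨fun i => Nat.casesOn i s a, fun i => Nat.casesOn i b₀ b, rfl, h1, ?_, ?_⟩
    · rintro (_ | i) hi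
      · simpa [h0] using ⟨h, v⟩
      · exact h2 i (by omega)
    · rw [Finset.sum_range_succ', h3, add_comm]
      simp [h0]

theorem walk_of_points {p : Pt} {n : ℕ} {a b : ℕ → Pt}
    (h : ∀ i < n, P.HStep (a i) (b i) ∧ P.VStep (b i) (a (i + 1))) {i j : ℕ} (hij : i ≤ j)
    (hj : j ≤ n) :
    P.Walk p (a i) (a j) (j - i) (∑ k ∈ Finset.Ico i j, rayCrossing p (b k) (a (k + 1))) := by
  induction j, hij using Nat.le_induction with
  | base => simpa using Walk.nil (a i)
  | succ j hij ih =>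
    have := (ih (by omega)).append (Walk.single (h j (by omega)).1 (h j (by omega)).2)
    rw [Finset.sum_Ico_succ_top hij]
    rwa [show j + 1 - i = j - i + 1 by omega]

/-- Each crossing number is a difference of values at the two ends, so swapping the ends of two runs
in one column preserves the sum. -/
theorem rayCrossing_exchange {p b b' t t' : Pt} (h : b.1 = t.1) (h' : b'.1 = t'.1)
    (e : b.1 = b'.1) :
    rayCrossing p b t + rayCrossing p b' t' = rayCrossing p b t' + rayCrossing p b' t := by
  rw [rayCrossing_eq h, rayCrossing_eq h', rayCrossing_eq (e.trans h'),
    rayCrossing_eq (e.symm.trans h)]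
  ring

/-- The coordinates of `p` differ from those of all vertices. -/
def IsGeneric (P : LatticePolytope) (p : Pt) : Prop := ∀ v ∈ P.V0, v.1 ≠ p.1 ∧ v.2 ≠ p.2

theorem exists_real_generic (S : Finset ℝ) (s : ℝ) :
    ∃ s', ∀ x ∈ S, step s x = step s' x ∧ x ≠ s' := by
  rcases (S.filter (s < ·)).eq_empty_or_nonempty with he | hne
  · refine ⟨s + 1, fun x hx => ?_⟩
    have : ¬ s < x := fun h => by
      have := Finset.mem_filter.2 ⟨hx, h⟩
      rw [he] at this
      exact absurd this (Finset.notMem_empty x)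
    have h2 : ¬ s + 1 < x := by linarith
    exact ⟨by simp only [step, if_neg this, if_neg h2], by linarith⟩
  · obtain ⟨m, hm, hmin⟩ := Finset.exists_min_image _ id hne
    have hm' := (Finset.mem_filter.1 hm).2
    refine ⟨(s + m) / 2, fun x hx => ?_⟩
    by_cases h : s < x
    · have := hmin x (Finset.mem_filter.2 ⟨hx, h⟩)
      simp only [id] at this
      have h2 : (s + m) / 2 < x := by linarith
      exact ⟨by simp only [step, if_pos h, if_pos h2], h2.ne'⟩
    · have h2 : x < (s + m) / 2 := by linarith
      exact ⟨by simp only [step, if_neg h, if_neg h2.not_gt], h2.ne⟩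

/-- A small shift up and to the right changes no strict comparison with finitely many coordinates,
while it leaves all the grid lines; statements about quadrant counts thus need checking only at
generic points. -/
theorem exists_generic (F : Finset Pt) (p : Pt) :
    ∃ p' : Pt, ∀ v ∈ F, quad p v = quad p' v ∧ v.1 ≠ p'.1 ∧ v.2 ≠ p'.2 := by
  obtain ⟨s, hs⟩ := exists_real_generic (F.image Prod.fst) p.1
  obtain ⟨t, ht⟩ := exists_real_generic (F.image Prod.snd) p.2
  refine ⟨(s, t), fun v hv => ?_⟩
  have h1 := hs v.1 (Finset.mem_image_of_mem _ hv)
  have h2 := ht v.2 (Finset.mem_image_of_mem _ hv)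
  exact ⟨by rw [quad, quad, h1.1, h2.1], h1.2, h2.2⟩

theorem IsGeneric.notMem_trace {γ : ClosedPath} (hγ : γ.RunsIn P) {p : Pt} (hp : P.IsGeneric p) :
    p ∉ γ.trace := by
  intro h
  obtain ⟨i, h | h⟩ := Set.mem_iUnion.1 h
  · obtain ⟨u, v, he, h1, -⟩ := hStep_iff.2 (hγ i).1
    exact (hp u he.1).2 (h1.symm.trans ((mem_segment_horizontal (γ.horizontal i)).1 h).1.symm)
  · obtain ⟨u, v, he, h1, -⟩ := vStep_iff.2 (hγ i).2
    exact (hp v he.2.1).1 (he.2.2.1.symm.trans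
      (h1.symm.trans ((mem_segment_vertical (γ.vertical i)).1 h).1.symm))

theorem exists_closedPath {p : Pt} {N : ℕ} {a b : ℕ → Pt} (h0 : a (N + 1) = a 0)
    (h : ∀ i < N + 1, P.HStep (a i) (b i) ∧ P.VStep (b i) (a (i + 1))) :
    ∃ γ : ClosedPath, γ.RunsIn P ∧ γ.n = N ∧
      (∀ i : Fin (γ.n + 1), γ.a i = a i ∧ γ.b i = b i ∧ γ.a (i + 1) = a (i + 1)) ∧
      γ.rotation p = ∑ i ∈ Finset.range (N + 1), rayCrossing p (b i) (a (i + 1)) := by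
  have hs : ∀ i : Fin (N + 1), a ((i + 1 : Fin (N + 1)) : ℕ) = a (i + 1) := fun i => by
    rw [Fin.val_add_one]
    split_ifs with hi
    · rw [hi, Fin.val_last, h0]
    · rfl
  refine ⟨⟨N, fun i => a i, fun i => b i, fun i => (h i i.2).1.snd_eq, fun i => ?_⟩, fun i => ?_,
    rfl, fun i => ⟨rfl, rfl, hs i⟩, ?_⟩
  · rw [hs]
    exact (h i i.2).2.fst_eq
  · refine ⟨hStep_iff.1 (h i i.2).1, vStep_iff.1 ?_⟩
    simp only [hs]
    exact (h i i.2).2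
  · rw [ClosedPath.rotation, Finset.sum_range]
    refine Finset.sum_congr rfl fun i _ => ?_
    simp only [hs]

/-- A closed walk of minimal structure is an embedded closed path. -/
theorem embedded_of_points {γ : ClosedPath} {a b : ℕ → Pt} (hN : γ.n ≠ 0)
    (h0 : a (γ.n + 1) = a 0)
    (hγ : ∀ i : Fin (γ.n + 1), γ.a i = a i ∧ γ.b i = b i ∧ γ.a (i + 1) = a (i + 1))
    (hH : ∀ i j q, i < j → j < γ.n + 1 → q ∈ segment ℝ (a i) (b i) → q ∉ segment ℝ (a j) (b j))
    (hV : ∀ i j q, i < j → j < γ.n + 1 → q ∈ segment ℝ (b i) (a (i + 1)) →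
      q ∉ segment ℝ (b j) (a (j + 1)))
    (hC : ∀ i j q, i < γ.n + 1 → j < γ.n + 1 → q ∈ segment ℝ (a i) (b i) →
      q ∈ segment ℝ (b j) (a (j + 1)) →
      (j = i ∧ q = b i) ∨ (i = j + 1 ∧ q = a i) ∨ (i = 0 ∧ j = γ.n ∧ q = a 0)) :
    γ.Embedded := by
  refine ⟨fun i => ?_, fun i j hij => ?_, fun i j hij => ?_, fun i j q hq hq' => ?_⟩
  · obtain ⟨e1, e2, e3⟩ := hγ i
    rw [e1, e2, e3]
    constructor
    · intro e
      rcases Nat.eq_zero_or_pos (i : ℕ) with hi | hi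
      · refine hV 0 γ.n (a 0) (by omega) (by omega) ?_ ?_
        · rw [hi] at e
          rw [e]
          exact left_mem_segment ℝ _ _
        · rw [h0]
          exact right_mem_segment ℝ _ _
      · refine hV (i - 1) i (a i) (by omega) i.2 ?_ ?_
        · rw [Nat.sub_add_cancel hi]
          exact right_mem_segment ℝ _ _
        · rw [e]
          exact left_mem_segment ℝ _ _
    · intro e
      by_cases hi : (i : ℕ) = γ.n
      · refine hH 0 γ.n (a 0) (by omega) (by omega) (left_mem_segment ℝ _ _) ?_
        rw [← h0, ← hi, ← e]
        exact right_mem_segment ℝ _ _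
      · refine hH i (i + 1) (b i) (by omega) (by omega) (right_mem_segment ℝ _ _) ?_
        rw [e]
        exact left_mem_segment ℝ _ _
  · rw [Set.disjoint_left, (hγ i).1, (hγ i).2.1, (hγ j).1, (hγ j).2.1]
    intro q hq hq'
    rcases lt_or_gt_of_ne (Fin.val_ne_of_ne hij) with hlt | hlt
    · exact hH i j q hlt j.2 hq hq'
    · exact hH j i q hlt i.2 hq' hq
  · rw [Set.disjoint_left, (hγ i).2.2, (hγ i).2.1, (hγ j).2.2, (hγ j).2.1]
    intro q hq hq'
    rcases lt_or_gt_of_ne (Fin.val_ne_of_ne hij) with hlt | hlt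
    · exact hV i j q hlt j.2 hq hq'
    · exact hV j i q hlt i.2 hq' hq
  · rw [(hγ i).1, (hγ i).2.1] at hq
    rw [(hγ j).2.1, (hγ j).2.2] at hq'
    rw [(hγ i).1, (hγ i).2.1]
    rcases hC i j q i.2 j.2 hq hq' with ⟨h1, h2⟩ | ⟨h1, h2⟩ | ⟨h1, h2, h3⟩
    · exact Or.inl ⟨Fin.ext h1, h2⟩
    · refine Or.inr ⟨Fin.ext ?_, h2⟩
      rw [Fin.val_add_one, if_neg, h1]
      intro e
      have := i.2
      rw [h1, e, Fin.val_last] at this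
      omega
    · refine Or.inr ⟨Fin.ext ?_, by rw [h1, h3]⟩
      rw [Fin.val_add_one, if_pos, h1]
      exact Fin.ext h2

/-- If every embedded closed path has rotation number `0` or `ε` about `p`, the contribution of
every closed walk has sign `ε`. -/
theorem Walk.sign {ε : ℤ} (hε : ε = 1 ∨ ε = -1) {p : Pt}
    (hemb : ∀ γ : ClosedPath, γ.Embedded → γ.RunsIn P → γ.rotation p = 0 ∨ γ.rotation p = ε)
    {s : Pt} {n : ℕ} {r : ℤ} (w : P.Walk p s s n r) : 0 ≤ ε * r := by
  induction n using Nat.strong_induction_on generalizing s r with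
  | _ n ih =>
  obtain ⟨a, b, h0, h1, hst, hr⟩ := w.exists_points
  have hcl : a n = a 0 := h1.trans h0.symm
  -- Every surgery below splits the walk into two strictly shorter closed walks with the same total
  -- contribution.
  have two : ∀ (s s' : Pt) (m m' : ℕ) (r₁ r₂ : ℤ), P.Walk p s s m r₁ → P.Walk p s' s' m' r₂ →
      m < n → m' < n → r = r₁ + r₂ → 0 ≤ ε * r := by
    intro s s' m m' r₁ r₂ w₁ w₂ hm hm' e
    rw [e, mul_add]
    exact add_nonneg (ih m hm w₁) (ih m' hm' w₂)
  set c : ℕ → ℤ := fun k => rayCrossing p (b k) (a (k + 1)) with hc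
  have W : ∀ i j, i ≤ j → j ≤ n → P.Walk p (a i) (a j) (j - i) (∑ k ∈ Finset.Ico i j, c k) :=
    fun i j hij hj => walk_of_points hst hij hj
  have hsum : ∀ i j, i < j → j < n → r = ∑ k ∈ Finset.Ico 0 i, c k + c i +
      ∑ k ∈ Finset.Ico (i + 1) j, c k + c j + ∑ k ∈ Finset.Ico (j + 1) n, c k := by
    intro i j hij hj
    rw [hr, Finset.range_eq_Ico, ← Finset.sum_Ico_consecutive c (Nat.zero_le i) (by omega : i ≤ n),
      ← Finset.sum_Ico_consecutive c (Nat.le_succ i) (by omega : i + 1 ≤ n),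
      ← Finset.sum_Ico_consecutive c (by omega : i + 1 ≤ j) (by omega : j ≤ n),
      ← Finset.sum_Ico_consecutive c (Nat.le_succ j) (by omega : j + 1 ≤ n)]
    simp only [Nat.succ_eq_add_one, Finset.Ico_add_one_right_eq_Icc, Finset.Icc_self, Finset.sum_singleton]
    ring
  have hsum1 : ∀ i, i < n → r = ∑ k ∈ Finset.Ico 0 i, c k + c i +
      ∑ k ∈ Finset.Ico (i + 1) n, c k := by
    intro i hi
    rw [hr, Finset.range_eq_Ico, ← Finset.sum_Ico_consecutive c (Nat.zero_le i) (by omega : i ≤ n),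
      ← Finset.sum_Ico_consecutive c (Nat.le_succ i) (by omega : i + 1 ≤ n)]
    simp only [Nat.succ_eq_add_one, Finset.Ico_add_one_right_eq_Icc, Finset.Icc_self, Finset.sum_singleton]
    ring
  -- Two horizontal steps that meet swap their ends; horizontal motion contributes nothing.
  by_cases hH : ∃ i j q, i < j ∧ j < n ∧ q ∈ segment ℝ (a i) (b i) ∧ q ∈ segment ℝ (a j) (b j)
  · obtain ⟨i, j, q, hij, hj, hq, hq'⟩ := hH
    obtain ⟨hi1, hi2⟩ := hst i (by omega)
    obtain ⟨hj1, hj2⟩ := hst j hj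
    have outer := (W 0 i (by omega) (by omega)).append
      (Walk.cons (hi1.exchange hj1 hq hq') hj2 (W (j + 1) n (by omega) le_rfl))
    have inner := (W (i + 1) j hij (by omega)).append
      (Walk.single (hj1.exchange hi1 hq' hq) hi2)
    rw [hcl] at outer
    refine two _ _ _ _ _ _ outer inner (by omega) (by omega) ?_
    rw [hsum i j hij hj]
    ring
  by_cases hV : ∃ i j q, i < j ∧ j < n ∧ q ∈ segment ℝ (b i) (a (i + 1)) ∧
      q ∈ segment ℝ (b j) (a (j + 1))
  · obtain ⟨i, j, q, hij, hj, hq, hq'⟩ := hV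
    obtain ⟨hi1, hi2⟩ := hst i (by omega)
    obtain ⟨hj1, hj2⟩ := hst j hj
    have outer := (W 0 i (by omega) (by omega)).append
      (Walk.cons hi1 (hi2.exchange hj2 hq hq') (W (j + 1) n (by omega) le_rfl))
    have inner := (W (i + 1) j hij (by omega)).append
      (Walk.single hj1 (hj2.exchange hi2 hq' hq))
    rw [hcl] at outer
    refine two _ _ _ _ _ _ outer inner (by omega) (by omega) ?_
    have e := rayCrossing_exchange (p := p) hi2.fst_eq hj2.fst_eq
      (((mem_segment_vertical hi2.fst_eq).1 hq).1.symm.trans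
        ((mem_segment_vertical hj2.fst_eq).1 hq').1)
    rw [hsum i j hij hj]
    simp only [hc]
    linarith
  -- A horizontal and a vertical step that meet away from a regular corner are cut at the meeting
  -- point.
  by_cases hC : ∃ i j q, i < n ∧ j < n ∧ q ∈ segment ℝ (a i) (b i) ∧
      q ∈ segment ℝ (b j) (a (j + 1)) ∧
      ¬ ((j = i ∧ q = b i) ∨ (i = j + 1 ∧ q = a i) ∨ (i = 0 ∧ j + 1 = n ∧ q = a 0))
  · obtain ⟨i, j, q, hi, hj, hq, hq', hne⟩ := hC
    obtain ⟨hi1, hi2⟩ := hst i hi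
    obtain ⟨hj1, hj2⟩ := hst j hj
    have hi1' := hi1.split hq
    have hj2' := hj2.split hq'
    have q2 := ((mem_segment_horizontal hi1.snd_eq).1 hq).1
    have q1 := ((mem_segment_vertical hj2.fst_eq).1 hq').1
    have e : c j = rayCrossing p (b j) q + rayCrossing p q (a (j + 1)) := by
      simp only [hc]
      rw [rayCrossing_eq hj2.fst_eq, rayCrossing_eq q1.symm,
        rayCrossing_eq (q1.trans hj2.fst_eq)]
      ring
    rcases lt_trichotomy i j with hij | rfl | hij
    · have outer := (W 0 i (by omega) (by omega)).append
        (Walk.cons hi1'.1 hj2'.2 (W (j + 1) n (by omega) le_rfl))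
      have inner := Walk.cons hi1'.2 hi2 ((W (i + 1) j hij (by omega)).append
        (Walk.single hj1 hj2'.1))
      rw [hcl] at outer
      -- In this extreme case the inner walk would have full length, but the meeting point would be
      -- the closing corner `a 0`.
      have hlt : ¬ (i = 0 ∧ j + 1 = n) := by
        rintro ⟨rfl, e'⟩
        refine hne (Or.inr (Or.inr ⟨rfl, e', Prod.ext ?_ q2⟩))
        rw [q1, hj2.fst_eq, e', hcl]
      refine two _ _ _ _ _ _ outer inner (by omega) (by omega) ?_
      rw [hsum i j hij hj, e]
      simp only [hc]
      ring
    · exact absurd (Or.inl ⟨rfl, Prod.ext q1 (q2.trans hi1.snd_eq)⟩) hne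
    · have outer := (W 0 j (by omega) (by omega)).append
        (Walk.cons hj1 hj2'.1 (Walk.cons hi1'.2 hi2 (W (i + 1) n (by omega) le_rfl)))
      have inner := (W (j + 1) i hij (by omega)).append
        (Walk.single hi1'.1 hj2'.2)
      rw [hcl] at outer
      have hlt : i ≠ j + 1 := by
        rintro rfl
        exact hne (Or.inr (Or.inl ⟨rfl, Prod.ext (q1.trans hj2.fst_eq) q2⟩))
      refine two _ _ _ _ _ _ outer inner (by omega) (by omega) ?_
      rw [hsum j i hij hi, e]
      simp only [hc]
      ring
  push Not at hH hV hC
  rcases n with _ | N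
  · simp [hr]
  obtain ⟨γ, hγ1, rfl, hγ3, hγ4⟩ := exists_closedPath (p := p) hcl hst
  have hrot : γ.rotation p = r := hγ4.trans hr.symm
  -- A closed walk with one pair of steps is degenerate: its horizontal and vertical runs both have
  -- length zero.
  by_cases hN : γ.n = 0
  · have e : a 0 = b 0 := by
      obtain ⟨h2, h3⟩ := hst 0 (by omega)
      rw [hN] at hcl
      exact Prod.ext (by rw [← hcl, h3.fst_eq]) h2.snd_eq
    have : r = 0 := by
      rw [hr, hN, zero_add, Finset.sum_range_one, zero_add]
      simp only [hN, zero_add] at hcl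
      rw [hcl, e, rayCrossing_eq rfl, sub_self]
    rw [this, mul_zero]
  · have hE := embedded_of_points hN hcl hγ3 hH hV fun i j q hi hj hq hq' => by
      have := hC i j q hi hj hq hq'
      rcases this with h | h | ⟨h, h', h''⟩
      · exact Or.inl h
      · exact Or.inr (Or.inl h)
      · exact Or.inr (Or.inr ⟨h, by omega, h''⟩)
    rw [← hrot]
    rcases hemb γ hE hγ1 with h | h <;> rw [h]
    · simp
    · rcases hε with rfl | rfl <;> simp

/-- If all closed walks contribute with sign `ε`, so does the boundary of `P`. -/
theorem rotation_sign_of_walks {ε : ℤ} {p : Pt}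
    (hw : ∀ (s : Pt) (n : ℕ) (r : ℤ), P.Walk p s s n r → 0 ≤ ε * r) : 0 ≤ ε * P.rotation p := by
  obtain ⟨φ, hφ, hsφ⟩ := P.sameGrid.exists_snd_map P.general0 P.general1
  obtain ⟨ψ, hψ, hsψ⟩ := P.sameGrid.symm.exists_fst_map P.general1 P.general0
  -- Following the row and then the column from an initial vertex permutes the initial vertices. Its
  -- orbits away from isolated vertices trace the closed paths of `∂P`.
  set π : Pt → Pt := fun u => ψ (φ u) with hπ
  have hπm : ∀ u ∈ P.V0, π u ∈ P.V0 := fun u hu => (hψ _ (hφ u hu).1).1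
  have hπk : ∀ k, ∀ u ∈ P.V0, π^[k] u ∈ P.V0 := fun k => by
    induction k with
    | zero => exact fun u hu => hu
    | succ k ih => exact fun u hu => by rw [Function.iterate_succ_apply']; exact hπm _ (ih u hu)
  have hπs : ∀ F : Pt → ℤ, ∑ u ∈ P.V0, F (π u) = ∑ u ∈ P.V0, F u := fun F =>
    (hsφ fun w => F (ψ w)).trans (hsψ F)
  have hπsk : ∀ k (F : Pt → ℤ), ∑ u ∈ P.V0, F (π^[k] u) = ∑ u ∈ P.V0, F u := fun k => by
    induction k with
    | zero => exact fun F => rfl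
    | succ k ih =>
      intro F
      simp only [Function.iterate_succ_apply']
      rw [ih fun u => F (π u), hπs]
  have hrot : P.rotation p = ∑ u ∈ P.V0, rayCrossing p (φ u) (π u) := by
    rw [rotation_eq, quadSum, quadSum, ← hπs, ← hsφ, ← Finset.sum_sub_distrib]
    refine Finset.sum_congr rfl fun u hu => ?_
    rw [rayCrossing_eq (hψ _ (hφ u hu).1).2.symm]
  have hinj : Function.Injective fun u : P.V0 => (⟨π u, hπm u u.2⟩ : P.V0) := by
    rintro ⟨u, hu⟩ ⟨v, hv⟩ e
    have e1 : ψ (φ u) = ψ (φ v) := congrArg Subtype.val e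
    have e2 : φ u = φ v := P.x_injOn1 (hφ u hu).1 (hφ v hv).1 (by
      rw [← (hψ _ (hφ u hu).1).2, e1, (hψ _ (hφ v hv).1).2])
    exact Subtype.ext (P.y_injOn0 hu hv (by rw [← (hφ u hu).2, e2, (hφ v hv).2]))
  -- The order of the permutation serves as a common period, so orbits need not be separated: every
  -- start gives a closed walk of length `N`.
  obtain ⟨N, hN, hNp⟩ : ∃ N, 0 < N ∧ ∀ u ∈ P.V0, π^[N] u = u := by
    set e : Equiv.Perm P.V0 := Equiv.ofBijective _ (Finite.injective_iff_bijective.1 hinj) with he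
    have hk : ∀ k (u : P.V0), ((e ^ k) u : Pt) = π^[k] u := fun k => by
      induction k with
      | zero => exact fun u => rfl
      | succ k ih =>
        intro u
        rw [pow_succ', Equiv.Perm.mul_apply, Function.iterate_succ_apply', ← ih u]
        rfl
    refine ⟨orderOf e, orderOf_pos e, fun u hu => ?_⟩
    rw [← hk (orderOf e) ⟨u, hu⟩, pow_orderOf_eq_one]
    rfl
  have hfix : ∀ u ∈ P.V0, φ u = u → π u = u := fun u hu e => by
    have h1 := hφ u hu
    have h2 := hψ _ h1.1
    exact P.x_injOn0 h2.1 hu (by rw [h2.2, e])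
  have hne : ∀ u ∈ P.V0, φ u ≠ u → π u ≠ φ u ∧ φ (π u) ≠ π u := fun u hu e => by
    have h1 := hφ u hu
    have h2 := hψ _ h1.1
    have h3 : π u ≠ φ u := fun e' => e (e' ▸ P.y_injOn0 h2.1 hu (by
      rw [← h1.2]; exact congrArg Prod.snd e'))
    refine ⟨h3, fun e' => h3 ?_⟩
    have h4 := hφ _ h2.1
    exact e' ▸ P.x_injOn1 h4.1 h1.1 (by rw [← h2.2]; exact congrArg Prod.fst e')
  have hwalk : ∀ u ∈ P.V0, φ u ≠ u → ∀ k, φ (π^[k] u) ≠ π^[k] u ∧ P.Walk p u (π^[k] u) k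
      (∑ i ∈ Finset.range k, rayCrossing p (φ (π^[i] u)) (π (π^[i] u))) := by
    intro u hu hu' k
    induction k with
    | zero => exact ⟨hu', by simpa using Walk.nil u⟩
    | succ k ih =>
      have hm := hπk k u hu
      have h1 := hφ _ hm
      have h2 := hψ _ h1.1
      obtain ⟨h3, h4⟩ := hne _ hm ih.1
      rw [Function.iterate_succ_apply', Finset.sum_range_succ]
      refine ⟨h4, ih.2.append (Walk.single ?_ ?_)⟩
      · exact hStep_iff.2 ⟨_, _, ⟨hm, h1.1, h1.2.symm, ih.1.symm⟩, left_mem_segment ℝ _ _,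
          right_mem_segment ℝ _ _⟩
      · exact vStep_iff.2 ⟨_, _, ⟨h1.1, h2.1, h2.2.symm, h3.symm⟩, left_mem_segment ℝ _ _,
          right_mem_segment ℝ _ _⟩
  have hu : ∀ u ∈ P.V0, 0 ≤ ε * ∑ i ∈ Finset.range N,
      rayCrossing p (φ (π^[i] u)) (π (π^[i] u)) := by
    intro u hu
    by_cases e : φ u = u
    · have e' := hfix u hu e
      have : ∀ i, π^[i] u = u := fun i => Function.iterate_fixed e' i
      simp [this, e, e', rayCrossing_eq]
    · have := (hwalk u hu e N).2
      rw [hNp u hu] at this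
      exact hw _ _ _ this
  -- Summing over all starts counts each vertical run `N` times.
  have key : (N : ℤ) * P.rotation p = ∑ u ∈ P.V0, ∑ i ∈ Finset.range N,
      rayCrossing p (φ (π^[i] u)) (π (π^[i] u)) := by
    rw [Finset.sum_comm, Finset.sum_congr rfl fun i _ =>
      (hπsk i fun u => rayCrossing p (φ u) (π u)).trans hrot.symm]
    simp
  have h3 : 0 ≤ (N : ℤ) * (ε * P.rotation p) := by
    rw [mul_left_comm, key, Finset.mul_sum]
    exact Finset.sum_nonneg hu
  exact nonneg_of_mul_nonneg_right h3 (by exact_mod_cast hN)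

/-- The sign of the boundary is obtained at generic points, which lie on no path and can therefore
be tested with the regions of (1), and is then carried to all points by a small shift. -/
theorem Condition1.hasCoherent (h : P.Condition1) : P.HasCoherent := by
  obtain ⟨ε, hε, h⟩ := h
  have hgen : ∀ p, P.IsGeneric p → 0 ≤ ε * P.rotation p := fun p hp => by
    refine rotation_sign_of_walks fun s n r w => w.sign hε fun γ hγ hγ' => ?_
    by_cases h0 : γ.rotation p = 0
    · exact Or.inl h0
    · exact Or.inr (h γ hγ hγ' p ⟨hp.notMem_trace hγ', h0⟩)
  obtain ⟨L, hL, hL'⟩ := exists_signed_transformation P.general0 P.general1 P.sameGrid hε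
    fun p => by
      obtain ⟨p', hp'⟩ := exists_generic (P.V0 ∪ P.V1) p
      have e0 : quadSum P.V0 p = quadSum P.V0 p' :=
        Finset.sum_congr rfl fun v hv => (hp' v (Finset.mem_union_left _ hv)).1
      have e1 : quadSum P.V1 p = quadSum P.V1 p' :=
        Finset.sum_congr rfl fun v hv => (hp' v (Finset.mem_union_right _ hv)).1
      rw [e0, e1, ← rotation_eq]
      exact hgen p' fun v hv => (hp' v (Finset.mem_union_left _ hv)).2
  exact ⟨L, hL, coherent_of_signed hL' hε⟩

end LatticePolytope

end LatticeMatching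

namespace LatticeMatching

/-! ### Decompositions of the boundary into embedded closed paths -/

/-- Steps from `k` to `l`: a path of the group `k` has a terminal vertex that is an initial vertex of
a path of the group `l`. -/
def Precedes {K ι : Type*} (γ : K → ClosedPath) (g : K → ι) (k l : ι) : Prop :=
  k ≠ l ∧ ∃ κ κ', g κ = k ∧ g κ' = l ∧
    ∃ c, c ∈ Set.range (γ κ).b ∧ c ∈ Set.range (γ κ').a

/-- The boundary of `P` is the union of embedded closed paths that touch in single points at most,
sorted into groups that can be processed one after the other. -/
structure Decomposition (P : LatticePolytope) {K ι : Type*} [Fintype K] [DecidableEq ι]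
    (γ : K → ClosedPath) (g : K → ι) : Prop where
  embedded : ∀ κ, (γ κ).Embedded
  runsIn : ∀ κ, (γ κ).RunsIn P
  cover : ∀ p ∈ P.boundary, ∃ κ, p ∈ (γ κ).trace
  meet : ∀ κ κ' x, κ ≠ κ' → x ∈ (γ κ).trace → x ∈ (γ κ').trace →
    g κ ≠ g κ' ∧ ∀ y, y ∈ (γ κ).trace → y ∈ (γ κ').trace → y = x
  acyclic : ∀ k, ¬ Relation.TransGen (Precedes γ g) k k
  sign : ∀ k, ∃ ε : ℤ, (ε = 1 ∨ ε = -1) ∧ ∀ p, P.IsGeneric p →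
    0 ≤ ε * ∑ κ with g κ = k, (γ κ).rotation p
  disjoint : ∀ k l p, P.IsGeneric p → ∑ κ with g κ = k, (γ κ).rotation p ≠ 0 →
    ∑ κ with g κ = l, (γ κ).rotation p ≠ 0 → k = l

/-- The point `x` is taken between `z` and the next element of `S` (or `w`) in the direction of `w`;
an interval with ends in `S` that contains `x` then reaches back to `z`. -/
theorem exists_real_near (S : Finset ℝ) {z w : ℝ} (h : z ≠ w) :
    ∃ x, x ≠ z ∧ x ∈ Set.uIcc z w ∧ x ∉ S ∧
      ∀ a ∈ S, ∀ b ∈ S, x ∈ Set.uIcc a b → z ∈ Set.uIcc a b := by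
  have key : ∀ (S : Finset ℝ) (z w : ℝ), z < w → ∃ x, z < x ∧ x < w ∧
      ∀ s ∈ S, s ≤ z ∨ x < s := by
    intro S z w h
    have hne : ((insert w S).filter (z < ·)).Nonempty :=
      ⟨w, Finset.mem_filter.2 ⟨Finset.mem_insert_self _ _, h⟩⟩
    obtain ⟨m, hm, hmin⟩ := Finset.exists_min_image _ id hne
    have hm' := (Finset.mem_filter.1 hm).2
    have hmw := hmin w (Finset.mem_filter.2 ⟨Finset.mem_insert_self _ _, h⟩)
    simp only [id] at hmw
    refine ⟨(z + m) / 2, by linarith, by linarith, fun s hs => ?_⟩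
    by_cases hs' : z < s
    · have := hmin s (Finset.mem_filter.2 ⟨Finset.mem_insert_of_mem hs, hs'⟩)
      simp only [id] at this
      exact Or.inr (by linarith)
    · exact Or.inl (not_lt.1 hs')
  rcases h.lt_or_gt with h | h
  · obtain ⟨x, h1, h2, h3⟩ := key S z w h
    refine ⟨x, h1.ne', Set.mem_uIcc.2 (Or.inl ⟨h1.le, h2.le⟩), fun hx => ?_, fun a ha b hb hx => ?_⟩
    · have := h3 x hx
      grind
    · have ha := h3 a ha
      have hb := h3 b hb
      rw [Set.mem_uIcc] at hx ⊢
      grind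
  · obtain ⟨x, h1, h2, h3⟩ := key (S.image (-·)) (-z) (-w) (neg_lt_neg h)
    have h4 : ∀ s ∈ S, z ≤ s ∨ s < -x := fun s hs => by
      have := h3 (-s) (Finset.mem_image_of_mem _ hs)
      rcases this with h | h
      · exact Or.inl (by linarith)
      · exact Or.inr (by linarith)
    refine ⟨-x, by linarith, Set.mem_uIcc.2 (Or.inr ⟨by linarith, by linarith⟩), fun hx => ?_,
      fun a ha b hb hx => ?_⟩
    · have := h4 _ hx
      grind
    · have ha := h4 a ha
      have hb := h4 b hb
      rw [Set.mem_uIcc] at hx ⊢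
      grind

theorem dir_end_mem {u v a b a' b' z : ℝ} (huv : u ≠ v) (h : Dir u v a b) (h' : Dir u v a' b')
    (hz : z ∈ Set.uIcc a b) (hz' : z ∈ Set.uIcc a' b') :
    (b ∈ Set.uIcc a' b' ∨ b' ∈ Set.uIcc a b) ∧ (a ∈ Set.uIcc a' b' ∨ a' ∈ Set.uIcc a b) := by
  unfold Dir at *
  rw [Set.mem_uIcc] at *
  rw [Set.mem_uIcc, Set.mem_uIcc, Set.mem_uIcc]
  rcases huv.lt_or_gt with huv | huv <;> grind

namespace Decomposition

open LatticePolytope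

variable {P : LatticePolytope} {K ι : Type*} {γ : K → ClosedPath} {g : K → ι}

/-- The initial vertex with a given index. -/
def ini (γ : K → ClosedPath) (t : Σ κ, Fin ((γ κ).n + 1)) : Pt := (γ t.1).a t.2

/-- The terminal vertex with a given index. -/
def ter (γ : K → ClosedPath) (t : Σ κ, Fin ((γ κ).n + 1)) : Pt := (γ t.1).b t.2

/-- The horizontal segment with a given index. -/
def seg (γ : K → ClosedPath) (t : Σ κ, Fin ((γ κ).n + 1)) : Set Pt :=
  segment ℝ (ini γ t) (ter γ t)

theorem seg_subset_trace (t : Σ κ, Fin ((γ κ).n + 1)) : seg γ t ⊆ (γ t.1).trace :=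
  fun _ hz => Set.mem_iUnion.2 ⟨t.2, Or.inl hz⟩

theorem ini_mem (t : Σ κ, Fin ((γ κ).n + 1)) : ini γ t ∈ seg γ t := left_mem_segment ℝ _ _

theorem ter_mem (t : Σ κ, Fin ((γ κ).n + 1)) : ter γ t ∈ seg γ t := right_mem_segment ℝ _ _


variable [Fintype K] [DecidableEq ι]

theorem ini_ne_ter (D : Decomposition P γ g) (t : Σ κ, Fin ((γ κ).n + 1)) : ini γ t ≠ ter γ t := ((D.embedded t.1).1 t.2).1

theorem hStep (D : Decomposition P γ g) (t : Σ κ, Fin ((γ κ).n + 1)) : P.HStep (ini γ t) (ter γ t) :=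
  hStep_iff.2 (D.runsIn t.1 t.2).1

theorem mem_seg (D : Decomposition P γ g) {t : Σ κ, Fin ((γ κ).n + 1)} {z : Pt} :
    z ∈ seg γ t ↔ z.2 = (ini γ t).2 ∧ z.1 ∈ Set.uIcc (ini γ t).1 (ter γ t).1 :=
  mem_segment_horizontal (D.hStep t).snd_eq

theorem dir_of_edge (D : Decomposition P γ g) {u v z : Pt} (he : P.XEdge u v) (hz : z.2 = u.2)
    {t : Σ κ, Fin ((γ κ).n + 1)} (ht : z ∈ seg γ t) : Dir u.1 v.1 (ini γ t).1 (ter γ t).1 := by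
  obtain ⟨u', v', he', h1, h2, h3⟩ := D.hStep t
  obtain ⟨rfl, rfl⟩ := he.unique he' (by rw [← hz, (D.mem_seg.1 ht).1, h1])
  exact h3

/-- Points near `z` on an edge lie, together with `z`, on one of the paths. -/
theorem exists_cover (D : Decomposition P γ g) {u v z w : Pt} (he : P.XEdge u v) (hz : z ∈ segment ℝ u v)
    (hw : w ∈ segment ℝ u v) (hne : z ≠ w) :
    ∃ t x, z ∈ seg γ t ∧ (x, z.2) ∈ seg γ t ∧ x ≠ z.1 ∧ x ∈ Set.uIcc z.1 w.1 := by
  rw [mem_segment_horizontal he.2.2.1] at hz hw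
  have hne' : z.1 ≠ w.1 := fun e => hne (Prod.ext e (hz.1.trans hw.1.symm))
  -- Avoiding the abscissas of all corners keeps the nearby point off the vertical segments, so a
  -- horizontal one must cover it.
  obtain ⟨x, h1, h2, h3, h4⟩ := exists_real_near
    ((Finset.univ.image fun t => (ini γ t).1) ∪ (Finset.univ.image fun t => (ter γ t).1)) hne'
  have hb : (x, z.2) ∈ P.boundary :=
    ⟨u, v, Or.inl he, (mem_segment_horizontal he.2.2.1).2
      ⟨hz.1, Set.uIcc_subset_uIcc hz.2 hw.2 h2⟩⟩
  have hi : ∀ t, (ini γ t).1 ∈ ((Finset.univ.image fun t => (ini γ t).1) ∪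
      (Finset.univ.image fun t => (ter γ t).1)) := fun t =>
    Finset.mem_union_left _ (Finset.mem_image_of_mem _ (Finset.mem_univ t))
  have ht : ∀ t, (ter γ t).1 ∈ ((Finset.univ.image fun t => (ini γ t).1) ∪
      (Finset.univ.image fun t => (ter γ t).1)) := fun t =>
    Finset.mem_union_right _ (Finset.mem_image_of_mem _ (Finset.mem_univ t))
  obtain ⟨κ, hκ⟩ := D.cover _ hb
  obtain ⟨i, h | h⟩ := Set.mem_iUnion.1 hκ
  · have h' := D.mem_seg (t := ⟨κ, i⟩).1 h
    refine ⟨⟨κ, i⟩, x, D.mem_seg.2 ⟨h'.1, ?_⟩, h, h1, h2⟩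
    exact h4 _ (hi _) _ (ht _) h'.2
  · have h' := (mem_segment_vertical ((γ κ).vertical i)).1 h
    have h'' : x = (ter γ ⟨κ, i⟩).1 := h'.1
    exact absurd (h'' ▸ ht ⟨κ, i⟩) h3

theorem exists_in (D : Decomposition P γ g) {u v z : Pt} (he : P.XEdge u v) (hz : z ∈ segment ℝ u v) (hne : z ≠ u) :
    ∃ t, z ∈ seg γ t ∧ z ≠ ini γ t := by
  obtain ⟨t, x, h1, h2, h3, h4⟩ := D.exists_cover he hz (left_mem_segment ℝ u v) hne
  refine ⟨t, h1, fun e => ?_⟩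
  rw [mem_segment_horizontal he.2.2.1] at hz
  have hd := D.dir_of_edge he hz.1 h1
  have h2 := (D.mem_seg.1 h2).2
  rw [← e] at hd h2
  have := he.fst_ne
  simp only at h2
  unfold Dir at hd
  rw [Set.mem_uIcc] at h2 h4
  rcases this.lt_or_gt with huv | huv <;> grind

theorem exists_out (D : Decomposition P γ g) {u v z : Pt} (he : P.XEdge u v) (hz : z ∈ segment ℝ u v) (hne : z ≠ v) :
    ∃ t, z ∈ seg γ t ∧ z ≠ ter γ t := by
  obtain ⟨t, x, h1, h2, h3, h4⟩ := D.exists_cover he hz (right_mem_segment ℝ u v) hne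
  refine ⟨t, h1, fun e => ?_⟩
  rw [mem_segment_horizontal he.2.2.1] at hz
  have hd := D.dir_of_edge he hz.1 h1
  have h2 := (D.mem_seg.1 h2).2
  rw [← e] at hd h2
  have := he.fst_ne
  simp only at h2
  unfold Dir at hd
  rw [Set.mem_uIcc] at h2 h4
  rcases this.lt_or_gt with huv | huv <;> grind

theorem eq_of_two_points (D : Decomposition P γ g) {t t' : Σ κ, Fin ((γ κ).n + 1)} {z y : Pt} (hz : z ∈ seg γ t)
    (hz' : z ∈ seg γ t') (hy : y ∈ seg γ t) (hy' : y ∈ seg γ t') (hne : y ≠ z) : t = t' := by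
  obtain ⟨κ, i⟩ := t
  obtain ⟨κ', i'⟩ := t'
  by_cases e : κ = κ'
  · subst e
    obtain rfl : i = i' := (D.embedded κ).horizontal_unique hz hz'
    rfl
  · exact absurd ((D.meet κ κ' z e (seg_subset_trace _ hz) (seg_subset_trace _ hz')).2 y
      (seg_subset_trace _ hy) (seg_subset_trace _ hy')) hne

theorem same_edge (D : Decomposition P γ g) {t t' : Σ κ, Fin ((γ κ).n + 1)} {z : Pt} (hz : z ∈ seg γ t)
    (hz' : z ∈ seg γ t') : ((ter γ t ∈ seg γ t' ∨ ter γ t' ∈ seg γ t) ∧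
      (ini γ t ∈ seg γ t' ∨ ini γ t' ∈ seg γ t)) := by
  obtain ⟨u, v, he, h1, h2, h3⟩ := D.hStep t
  have e := (D.mem_seg.1 hz).1
  have e' := (D.mem_seg.1 hz').1
  have h3' := D.dir_of_edge he (e.trans h1) hz'
  have h4 := (D.hStep t).snd_eq
  have h4' := (D.hStep t').snd_eq
  have key := dir_end_mem he.fst_ne h3 h3' (D.mem_seg.1 hz).2 (D.mem_seg.1 hz').2
  simp only [D.mem_seg]
  refine ⟨key.1.imp (fun h => ⟨?_, h⟩) fun h => ⟨?_, h⟩,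
    key.2.imp (fun h => ⟨?_, h⟩) fun h => ⟨?_, h⟩⟩
  · rw [← h4, ← e, e']
  · rw [← h4', ← e', e]
  · rw [← e, e']
  · rw [← e', e]

/-- Segments on one edge have the same direction. If both continue beyond `z`, they share the nearer
end as a second point, which distinct paths must not do. -/
theorem out_unique (D : Decomposition P γ g) {t t' : Σ κ, Fin ((γ κ).n + 1)} {z : Pt} (hz : z ∈ seg γ t)
    (hz' : z ∈ seg γ t') (hne : z ≠ ter γ t) (hne' : z ≠ ter γ t') : t = t' := by
  rcases (D.same_edge hz hz').1 with h | h
  · exact D.eq_of_two_points hz hz' (ter_mem t) h hne.symm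
  · exact D.eq_of_two_points hz hz' h (ter_mem t') hne'.symm

theorem in_unique (D : Decomposition P γ g) {t t' : Σ κ, Fin ((γ κ).n + 1)} {z : Pt} (hz : z ∈ seg γ t)
    (hz' : z ∈ seg γ t') (hne : z ≠ ini γ t) (hne' : z ≠ ini γ t') : t = t' := by
  rcases (D.same_edge hz hz').2 with h | h
  · exact D.eq_of_two_points hz hz' (ini_mem t) h hne.symm
  · exact D.eq_of_two_points hz hz' h (ini_mem t') hne'.symm

theorem ini_injective (D : Decomposition P γ g) : Function.Injective (ini γ) := fun t t' e =>
  D.out_unique (ini_mem t) (e ▸ ini_mem t') (D.ini_ne_ter t) (e ▸ D.ini_ne_ter t')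

theorem ter_injective (D : Decomposition P γ g) : Function.Injective (ter γ) := fun t t' e =>
  D.in_unique (ter_mem t) (e ▸ ter_mem t') (D.ini_ne_ter t).symm (e ▸ (D.ini_ne_ter t').symm)

theorem mem_edge (D : Decomposition P γ g) {t : Σ κ, Fin ((γ κ).n + 1)} : ∃ u v, P.XEdge u v ∧ ini γ t ∈ segment ℝ u v ∧
    ter γ t ∈ segment ℝ u v ∧ Dir u.1 v.1 (ini γ t).1 (ter γ t).1 := by
  obtain ⟨u, v, he, h1, h2, h3⟩ := D.hStep t
  refine ⟨u, v, he, (mem_segment_horizontal he.2.2.1).2 ⟨h1, ?_⟩,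
    (mem_segment_horizontal he.2.2.1).2 ⟨h2, ?_⟩, h3⟩ <;>
  · unfold Dir at h3
    rw [Set.mem_uIcc]
    grind

/-- An initial vertex is a vertex of `P`, or the terminal vertex of a path in another group. -/
theorem ini_cases (D : Decomposition P γ g) (t : Σ κ, Fin ((γ κ).n + 1)) :
    ini γ t ∈ P.V0 ∨ ∃ t', ter γ t' = ini γ t ∧ g t'.1 ≠ g t.1 := by
  obtain ⟨u, v, he, hz, -⟩ := D.mem_edge (t := t)
  by_cases hu : ini γ t = u
  · exact Or.inl (hu ▸ he.1)
  obtain ⟨t', h1, h2⟩ := D.exists_in he hz hu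
  -- If the arriving segment continued beyond this point, it would coincide with the one that starts
  -- here.
  have e : ini γ t = ter γ t' := by
    by_contra hne
    have := D.out_unique (ini_mem t) h1 (D.ini_ne_ter t) hne
    exact h2 (by rw [this])
  refine Or.inr ⟨t', e.symm, (D.meet _ _ (ini γ t) (fun h => h2 ?_) (seg_subset_trace _ h1)
    (seg_subset_trace _ (ini_mem t))).1⟩
  obtain ⟨κ, i⟩ := t
  obtain ⟨κ', i'⟩ := t'
  obtain rfl : κ' = κ := h
  obtain rfl : i' = i := (D.embedded κ').horizontal_unique h1 (ini_mem ⟨κ', i⟩)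
  rfl

theorem ter_cases (D : Decomposition P γ g) (t : Σ κ, Fin ((γ κ).n + 1)) : ter γ t ∈ P.V1 ∨ ∃ t', ini γ t' = ter γ t := by
  obtain ⟨u, v, he, -, hz, -⟩ := D.mem_edge (t := t)
  by_cases hv : ter γ t = v
  · exact Or.inl (hv ▸ he.2.1)
  obtain ⟨t', h1, h2⟩ := D.exists_out he hz hv
  refine Or.inr ⟨t', ?_⟩
  by_contra hne
  have := D.in_unique (ter_mem t) h1 (D.ini_ne_ter t).symm (Ne.symm hne)
  exact h2 (by rw [this])

theorem ini_notMem (D : Decomposition P γ g) (t : Σ κ, Fin ((γ κ).n + 1)) : ini γ t ∉ P.V1 := fun h => by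
  obtain ⟨u, v, he, hz, -, hd⟩ := D.mem_edge (t := t)
  rw [mem_segment_horizontal he.2.2.1] at hz
  have e := P.y_injOn1 h he.2.1 (hz.1.trans he.2.2.1)
  rw [e] at hd
  have h1 := he.fst_ne
  refine D.ini_ne_ter t (Prod.ext ?_ (D.hStep t).snd_eq)
  rw [e]
  unfold Dir at hd
  rcases h1.lt_or_gt with huv | huv <;> grind

theorem ter_notMem (D : Decomposition P γ g) (t : Σ κ, Fin ((γ κ).n + 1)) : ter γ t ∉ P.V0 := fun h => by
  obtain ⟨u, v, he, -, hz, hd⟩ := D.mem_edge (t := t)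
  rw [mem_segment_horizontal he.2.2.1] at hz
  have e := P.y_injOn0 h he.1 hz.1
  rw [e] at hd
  have h1 := he.fst_ne
  refine D.ini_ne_ter t (Prod.ext ?_ (D.hStep t).snd_eq)
  rw [e]
  unfold Dir at hd
  rcases h1.lt_or_gt with huv | huv <;> grind

theorem exists_ini (D : Decomposition P γ g) {z : Pt} (h0 : z ∈ P.V0) (h1 : z ∉ P.V1) : ∃ t, ini γ t = z := by
  obtain ⟨v, hv, e⟩ := P.sameGrid.exists_snd h0
  have he : P.XEdge z v := ⟨h0, hv, e.symm, fun h => h1 (h ▸ hv)⟩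
  obtain ⟨t, h2, h3⟩ := D.exists_out he (left_mem_segment ℝ z v) he.2.2.2
  have hd := D.dir_of_edge he rfl h2
  have h4 := D.mem_seg.1 h2
  refine ⟨t, Prod.ext ?_ h4.1.symm⟩
  have h5 := h4.2
  have h6 := he.fst_ne
  rw [Set.mem_uIcc] at h5
  unfold Dir at hd
  rcases h6.lt_or_gt with huv | huv <;> grind

theorem exists_ter (D : Decomposition P γ g) {z : Pt} (h0 : z ∉ P.V0) (h1 : z ∈ P.V1) : ∃ t, ter γ t = z := by
  obtain ⟨u, hu, e⟩ := P.sameGrid.symm.exists_snd h1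
  have he : P.XEdge u z := ⟨hu, h1, e, fun h => h0 (h ▸ hu)⟩
  obtain ⟨t, h2, h3⟩ := D.exists_in he (right_mem_segment ℝ u z) he.2.2.2.symm
  have hd := D.dir_of_edge he e.symm h2
  have h4 := D.mem_seg.1 h2
  refine ⟨t, Prod.ext ?_ ((D.hStep t).snd_eq.symm.trans h4.1.symm)⟩
  have h5 := h4.2
  have h6 := he.fst_ne
  rw [Set.mem_uIcc] at h5
  unfold Dir at hd
  rcases h6.lt_or_gt with huv | huv <;> grind

theorem count_map_of_injective {K : Type*} [Fintype K] {γ : K → ClosedPath} {F : (Σ κ, Fin ((γ κ).n + 1)) → Pt} (hF : Function.Injective F)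
    (z : Pt) [Decidable (∃ t, F t = z)] :
    ((Finset.univ : Finset (Σ κ, Fin ((γ κ).n + 1))).val.map F).count z =
      if ∃ t, F t = z then 1 else 0 := by
  have hn : (Finset.univ.val.map F).Nodup := Finset.univ.nodup.map hF
  rw [Multiset.count_eq_of_nodup hn]
  simp

theorem ite_add_ite_eq {A B p q : Prop} [Decidable A] [Decidable B] [Decidable p] [Decidable q]
    (h1 : A → ¬ q) (h2 : B → ¬ p) (h3 : A → p ∨ B) (h4 : B → q ∨ A)
    (h5 : p → ¬ q → A) (h6 : ¬ p → q → B) :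
    (if q then 1 else 0) + (if A then 1 else 0) = (if p then 1 else 0) + (if B then (1 : ℕ) else 0) := by
  by_cases hA : A <;> by_cases hB : B <;> by_cases hp : p <;> by_cases hq : q <;>
    simp_all

/-- Terminal and initial corners of touching paths cancel, so replacing all initial corners by all
terminal corners turns `V0` into `V1`. Multisets are compared point by point. -/
theorem total (D : Decomposition P γ g) : P.V1.val + (Finset.univ : Finset (Σ κ, Fin ((γ κ).n + 1))).val.map (ini γ) =
    P.V0.val + (Finset.univ : Finset (Σ κ, Fin ((γ κ).n + 1))).val.map (ter γ) := by
  classical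
  refine Multiset.ext.2 fun z => ?_
  rw [Multiset.count_add, Multiset.count_add, count_map_of_injective D.ini_injective,
    count_map_of_injective D.ter_injective, Multiset.count_eq_of_nodup P.V1.nodup,
    Multiset.count_eq_of_nodup P.V0.nodup]
  simp only [Finset.mem_val]
  have i1 : (∃ t, ini γ t = z) → z ∉ P.V1 := by
    rintro ⟨t, rfl⟩; exact D.ini_notMem t
  have i2 : (∃ t, ter γ t = z) → z ∉ P.V0 := by
    rintro ⟨t, rfl⟩; exact D.ter_notMem t
  have i3 : (∃ t, ini γ t = z) → z ∈ P.V0 ∨ ∃ t, ter γ t = z := by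
    rintro ⟨t, rfl⟩
    exact (D.ini_cases t).imp_right fun ⟨t', h, _⟩ => ⟨t', h⟩
  have i4 : (∃ t, ter γ t = z) → z ∈ P.V1 ∨ ∃ t, ini γ t = z := by
    rintro ⟨t, rfl⟩
    exact D.ter_cases t
  have i5 := D.exists_ini (z := z)
  have i6 := D.exists_ter (z := z)
  exact ite_add_ite_eq i1 i2 i3 i4 i5 i6


/-- The contribution of a group of paths to the rotation number. -/
theorem sum_rotation_eq (k : ι) (p : Pt) : ∑ κ with g κ = k, (γ κ).rotation p =
    ∑ t : Σ κ, Fin ((γ κ).n + 1) with g t.1 = k, (quad p (ini γ t) - quad p (ter γ t)) := by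
  rw [Finset.sum_filter, Finset.sum_filter, Fintype.sum_sigma]
  refine Finset.sum_congr rfl fun κ _ => ?_
  simp only
  split_ifs
  · rw [ClosedPath.rotation_eq]
    rfl
  · simp

theorem map_fst_eq (k : ι) :
    ((Finset.univ.filter fun t : Σ κ, Fin ((γ κ).n + 1) => g t.1 = k).val.map
      fun t => (ini γ t).1) =
    (Finset.univ.filter fun t : Σ κ, Fin ((γ κ).n + 1) => g t.1 = k).val.map
      fun t => (ter γ t).1 := by
  set e : Equiv.Perm (Σ κ, Fin ((γ κ).n + 1)) :=
    Equiv.sigmaCongrRight fun κ => Equiv.addRight (1 : Fin ((γ κ).n + 1)) with he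
  have h1 : ∀ t, (ter γ t).1 = (ini γ (e t)).1 := fun t => (γ t.1).vertical t.2
  have h2 : (Finset.univ.filter fun t : Σ κ, Fin ((γ κ).n + 1) => g t.1 = k).map e.toEmbedding =
      Finset.univ.filter fun t : Σ κ, Fin ((γ κ).n + 1) => g t.1 = k := by
    ext t
    simp only [Finset.mem_map, Finset.mem_filter, Finset.mem_univ, true_and]
    constructor
    · rintro ⟨t', h, rfl⟩
      exact h
    · intro h
      refine ⟨e.symm t, ?_, e.apply_symm_apply t⟩
      have : (e (e.symm t)).1 = (e.symm t).1 := rfl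
      rw [← this, e.apply_symm_apply]
      exact h
  conv_lhs => rw [← h2]
  rw [Finset.map_val, Multiset.map_map]
  exact Multiset.map_congr rfl fun t _ => (h1 t).symm


theorem map_snd_eq (D : Decomposition P γ g) (k : ι) :
    ((Finset.univ.filter fun t : Σ κ, Fin ((γ κ).n + 1) => g t.1 = k).val.map
      fun t => (ini γ t).2) =
    (Finset.univ.filter fun t : Σ κ, Fin ((γ κ).n + 1) => g t.1 = k).val.map
      fun t => (ter γ t).2 :=
  Multiset.map_congr rfl fun t _ => (D.hStep t).snd_eq

theorem exists_generic_sum (p : Pt) : ∃ p', P.IsGeneric p' ∧ ∀ k,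
    ∑ t : Σ κ, Fin ((γ κ).n + 1) with g t.1 = k, (quad p (ini γ t) - quad p (ter γ t)) =
    ∑ κ with g κ = k, (γ κ).rotation p' := by
  obtain ⟨p', hp'⟩ := exists_generic
    (P.V0 ∪ (Finset.univ.image (ini γ) ∪ Finset.univ.image (ter γ))) p
  refine ⟨p', fun v hv => (hp' v (Finset.mem_union_left _ hv)).2, fun k => ?_⟩
  rw [sum_rotation_eq]
  refine Finset.sum_congr rfl fun t _ => ?_
  rw [(hp' _ (Finset.mem_union_right _ (Finset.mem_union_left _
      (Finset.mem_image_of_mem _ (Finset.mem_univ t))))).1,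
    (hp' _ (Finset.mem_union_right _ (Finset.mem_union_right _
      (Finset.mem_image_of_mem _ (Finset.mem_univ t))))).1]


/-! ### Processing the groups one after the other -/

/-- The state after the groups in `S` have been processed. -/
structure Stage (P : LatticePolytope) (γ : K → ClosedPath) (g : K → ι) (S : Finset ι)
    (V : Finset Pt) : Prop where
  general : General V
  balance : V.val + (Finset.univ.filter fun t : Σ κ, Fin ((γ κ).n + 1) => g t.1 ∈ S).val.map (ini γ)
    = P.V0.val + (Finset.univ.filter fun t : Σ κ, Fin ((γ κ).n + 1) => g t.1 ∈ S).val.map (ter γ)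
  exists_list : ∃ L, IsTransformation L P.V0 V ∧ ∀ r ∈ L, ∃ k ∈ S, ∃ ε : ℤ, (ε = 1 ∨ ε = -1) ∧
    (∀ p, 0 ≤ ε * ∑ t : Σ κ, Fin ((γ κ).n + 1) with g t.1 = k,
      (quad p (ini γ t) - quad p (ter γ t))) ∧ ∀ p, rectFun r p ≠ 0 → 0 ≤ ε * rectFun r p ∧
      ∑ t : Σ κ, Fin ((γ κ).n + 1) with g t.1 = k, (quad p (ini γ t) - quad p (ter γ t)) ≠ 0

theorem filter_insert_val {T : Type*} [Fintype T] (G : T → ι) {S : Finset ι} {k : ι} (hk : k ∉ S)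
    (F : T → Pt) : (Finset.univ.filter fun t => G t ∈ insert k S).val.map F =
      (Finset.univ.filter fun t => G t = k).val.map F +
      (Finset.univ.filter fun t => G t ∈ S).val.map F := by
  classical
  have hd : Disjoint (Finset.univ.filter fun t => G t = k) (Finset.univ.filter fun t => G t ∈ S) := by
    rw [Finset.disjoint_left]
    intro t h1 h2
    rw [Finset.mem_filter] at h1 h2
    exact hk (h1.2 ▸ h2.2)
  have e : (Finset.univ.filter fun t => G t ∈ insert k S) =
      (Finset.univ.filter fun t => G t = k).disjUnion (Finset.univ.filter fun t => G t ∈ S) hd := by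
    ext t
    simp
  rw [e, Finset.disjUnion_val, Multiset.map_add]

theorem general_of_map {V V' : Finset Pt} (hV : General V)
    (h1 : V'.val.map Prod.fst = V.val.map Prod.fst) (h2 : V'.val.map Prod.snd = V.val.map Prod.snd) :
    General V' ∧ SameGrid V V' := by
  have n1 : (V'.val.map Prod.fst).Nodup := h1 ▸ Finset.nodup_map_iff_injOn.2 hV.1
  have n2 : (V'.val.map Prod.snd).Nodup := h2 ▸ Finset.nodup_map_iff_injOn.2 hV.2
  refine ⟨⟨Finset.nodup_map_iff_injOn.1 n1, Finset.nodup_map_iff_injOn.1 n2⟩, ?_, ?_⟩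
  · unfold Finset.image
    rw [h1]
  · unfold Finset.image
    rw [h2]

/-- The initial corners of group `k` are exchanged for its terminal corners. Coordinates are
preserved, and the quadrant count changes by the group's rotation number, which has one sign; hence
a signed transformation exists. -/
theorem Stage.insert {S : Finset ι} {V : Finset Pt} (D : Decomposition P γ g)
    (h : Stage P γ g S V) {k : ι} (hk : k ∉ S) (hpre : ∀ l, Precedes γ g l k → l ∈ S) :
    ∃ V', Stage P γ g (Insert.insert k S) V' := by
  classical
  set U := Finset.univ.filter fun t : Σ κ, Fin ((γ κ).n + 1) => g t.1 = k with hU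
  set U' := Finset.univ.filter fun t : Σ κ, Fin ((γ κ).n + 1) => g t.1 ∈ S with hU'
  -- An initial corner of the group is present now: it is a vertex of `V0` or was created by a
  -- preceding group, and no processed group has consumed it because initial corners are distinct.
  have hle : U.val.map (ini γ) ≤ V.val := by
    refine (Multiset.le_iff_subset (U.nodup.map D.ini_injective)).2 fun z hz => ?_
    obtain ⟨t, ht, rfl⟩ := Multiset.mem_map.1 hz
    have htk : g t.1 = k := (Finset.mem_filter.1 ht).2
    have hm : ini γ t ∈ V.val + U'.val.map (ini γ) := by
      rw [h.balance, Multiset.mem_add]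
      rcases D.ini_cases t with h0 | ⟨t', e, hne⟩
      · exact Or.inl h0
      · refine Or.inr (Multiset.mem_map.2 ⟨t', ?_, e⟩)
        refine Finset.mem_filter.2 ⟨Finset.mem_univ _, hpre _ ⟨htk ▸ hne, t'.1, t.1, rfl, htk,
          ini γ t, ⟨t'.2, e⟩, ⟨t.2, rfl⟩⟩⟩
    rcases Multiset.mem_add.1 hm with h0 | h0
    · exact h0
    · obtain ⟨t', ht', e⟩ := Multiset.mem_map.1 h0
      rw [D.ini_injective e] at ht'
      have h2 := (Finset.mem_filter.1 ht').2
      rw [htk] at h2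
      exact absurd h2 hk
  obtain ⟨R, hR⟩ := Multiset.le_iff_exists_add.1 hle
  have e1 : (R + U.val.map (ter γ)).map Prod.fst = V.val.map Prod.fst := by
    rw [hR, Multiset.map_add, Multiset.map_add, Multiset.map_map, Multiset.map_map, add_comm]
    congr 1
    exact (map_fst_eq k).symm
  have e2 : (R + U.val.map (ter γ)).map Prod.snd = V.val.map Prod.snd := by
    rw [hR, Multiset.map_add, Multiset.map_add, Multiset.map_map, Multiset.map_map, add_comm]
    congr 1
    exact (D.map_snd_eq k).symm
  have hnd : (R + U.val.map (ter γ)).Nodup :=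
    Multiset.Nodup.of_map Prod.fst (e1 ▸ Finset.nodup_map_iff_injOn.2 h.general.1)
  set V' : Finset Pt := ⟨R + U.val.map (ter γ), hnd⟩ with hV'
  obtain ⟨g1, g2⟩ := general_of_map (V' := V') h.general e1 e2
  have hq : ∀ p, quadSum V p - quadSum V' p = ∑ t ∈ U, (quad p (ini γ t) - quad p (ter γ t)) := by
    intro p
    have a1 : quadSum V p = (V.val.map (quad p)).sum := rfl
    have a2 : quadSum V' p = ((R + U.val.map (ter γ)).map (quad p)).sum := rfl
    have a3 : ∑ t ∈ U, quad p (ini γ t) = ((U.val.map (ini γ)).map (quad p)).sum := by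
      rw [Multiset.map_map]; rfl
    have a4 : ∑ t ∈ U, quad p (ter γ t) = ((U.val.map (ter γ)).map (quad p)).sum := by
      rw [Multiset.map_map]; rfl
    rw [Finset.sum_sub_distrib, a1, a2, a3, a4, hR, Multiset.map_add, Multiset.map_add,
      Multiset.sum_add, Multiset.sum_add]
    ring
  obtain ⟨ε, hε, hs⟩ := D.sign k
  have hs' : ∀ p, 0 ≤ ε * ∑ t ∈ U, (quad p (ini γ t) - quad p (ter γ t)) := fun p => by
    obtain ⟨p', hp', e⟩ := exists_generic_sum (P := P) (γ := γ) (g := g) p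
    rw [e k]
    exact hs p' hp'
  obtain ⟨L, hL, hL'⟩ := exists_signed_transformation h.general g1 g2 hε fun p => by
    rw [hq]; exact hs' p
  obtain ⟨L₀, hL₀, hL₀'⟩ := h.exists_list
  refine ⟨V', g1, ?_, L₀ ++ L, hL₀.append hL, fun r hr => ?_⟩
  · rw [filter_insert_val (fun t : Σ κ, Fin ((γ κ).n + 1) => g t.1) hk,
      filter_insert_val (fun t : Σ κ, Fin ((γ κ).n + 1) => g t.1) hk]
    have hb := h.balance
    rw [hR] at hb
    change R + U.val.map (ter γ) + (U.val.map (ini γ) + U'.val.map (ini γ)) =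
      P.V0.val + (U.val.map (ter γ) + U'.val.map (ter γ))
    calc R + U.val.map (ter γ) + (U.val.map (ini γ) + U'.val.map (ini γ))
        = U.val.map (ini γ) + R + U'.val.map (ini γ) + U.val.map (ter γ) := by abel
      _ = P.V0.val + U'.val.map (ter γ) + U.val.map (ter γ) := by rw [hb]
      _ = P.V0.val + (U.val.map (ter γ) + U'.val.map (ter γ)) := by abel
  · rcases List.mem_append.1 hr with hr | hr
    · obtain ⟨l, hl, hrest⟩ := hL₀' r hr
      exact ⟨l, Finset.mem_insert_of_mem hl, hrest⟩
    · refine ⟨k, Finset.mem_insert_self _ _, ε, hε, hs', fun p hp => ⟨hL' r hr p, ?_⟩⟩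
      rw [← hq, ← (hL.invariants h.general).2.2 p]
      exact (coherent_of_signed hL' hε).sum_ne_zero hr hp

/-- A group of `S` that precedes no other in `S` can be treated last; removing it leaves a set still
closed under predecessors. Acyclicity and finiteness provide such a group. -/
theorem exists_stage [Finite ι] (D : Decomposition P γ g) (S : Finset ι)
    (hS : ∀ k l, l ∈ S → Precedes γ g k l → k ∈ S) : ∃ V, Stage P γ g S V := by
  induction hn : S.card generalizing S with
  | zero =>
    rw [Finset.card_eq_zero] at hn
    subst hn
    exact ⟨P.V0, P.general0, by simp, [], rfl, by simp⟩
  | succ n ih =>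
    have : IsTrans ι (flip (Relation.TransGen (Precedes γ g))) :=
      ⟨fun a b c h1 h2 => Relation.TransGen.trans h2 h1⟩
    have : Std.Irrefl (flip (Relation.TransGen (Precedes γ g))) := ⟨fun a => D.acyclic a⟩
    have hwf := Finite.wellFounded_of_trans_of_irrefl (flip (Relation.TransGen (Precedes γ g)))
    have hne : S.Nonempty := Finset.card_pos.1 (by omega)
    obtain ⟨k, hk, hmax⟩ := hwf.has_min (S : Set ι) hne
    have hnot : ∀ l ∈ S, ¬ Precedes γ g k l := fun l hl h =>
      hmax l hl (Relation.TransGen.single h)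
    have hS' : ∀ a l, l ∈ S.erase k → Precedes γ g a l → a ∈ S.erase k := fun a l hl h => by
      have hl' := (Finset.mem_erase.1 hl).2
      refine Finset.mem_erase.2 ⟨fun e => ?_, hS a l hl' h⟩
      subst e
      exact hnot l hl' h
    obtain ⟨V, hV⟩ := ih (S.erase k) hS' (by
      rw [Finset.card_erase_of_mem hk, hn, Nat.add_sub_cancel])
    obtain ⟨V', hV'⟩ := hV.insert D (Finset.notMem_erase k S) fun l hl =>
      Finset.mem_erase.2 ⟨hl.1, hS l k hk hl⟩
    rw [Finset.insert_erase hk] at hV'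
    exact ⟨V', hV'⟩

/-- Overlapping rectangles must come from the same group, as different groups are nonzero at
different points, and rectangles within a group share its sign. -/
theorem hasCoherent [Fintype ι] (D : Decomposition P γ g) : P.HasCoherent := by
  obtain ⟨V, hV⟩ := D.exists_stage Finset.univ fun _ _ _ _ => Finset.mem_univ _
  have hb := hV.balance
  simp only [Finset.mem_univ, Finset.filter_true] at hb
  rw [← D.total] at hb
  obtain rfl : V = P.V1 := Finset.val_injective (add_right_cancel hb)
  obtain ⟨L, hL, hL'⟩ := hV.exists_list
  refine ⟨L, hL, fun r hr s hs p h0 h1 => ?_⟩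
  obtain ⟨k, -, ε, hε, hk, hr'⟩ := hL' r hr
  obtain ⟨l, -, ε', hε', hl, hs'⟩ := hL' s hs
  obtain ⟨a1, a2⟩ := hr' p h0.ne'
  obtain ⟨b1, b2⟩ := hs' p h1.ne
  obtain rfl : k = l := by
    obtain ⟨p', hp', e⟩ := exists_generic_sum (P := P) (γ := γ) (g := g) p
    rw [e] at a2 b2
    exact D.disjoint k l p' hp' a2 b2
  have hk := hk p
  have hl := hl p
  -- The two signs recorded for this group may formally differ, but then its nonzero contribution
  -- would be both nonnegative and nonpositive.
  rcases hε with rfl | rfl <;> rcases hε' with rfl | rfl <;>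
    first | linarith | exact a2 (le_antisymm (by linarith) (by linarith))

end Decomposition

/-! ### Coherent transformations under condition (2) -/

namespace LatticePolytope

variable {P : LatticePolytope}

theorem IsGeneric.mem_inside {γ : ClosedPath} (hγ : γ.RunsIn P) {p : Pt} (hp : P.IsGeneric p)
    (h : γ.rotation p ≠ 0) : p ∈ γ.inside := ⟨hp.notMem_trace hγ, h⟩

/-- One group consists of an outer path `A i` and all its holes. Only outer paths of different
groups can touch, so the ring condition on the outer paths gives the acyclicity of the groups. -/
theorem Condition2.hasCoherent (h : P.Condition2) : P.HasCoherent := by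
  obtain ⟨-, m, A, n, B, hA, hB, hbd, hAA, hBB, hBA, hac⟩ := h
  have tr : ∀ γ : ClosedPath, ∀ z ∈ γ.trace, z ∈ γ.region := fun γ z hz => Or.inl hz
  have hAA' : ∀ i j, i ≠ j → ∀ z, z ∈ (A i).region → z ∈ (A j).region →
      z ∈ (A i).trace ∧ z ∈ (A j).trace ∧ ∀ y ∈ (A i).region, y ∈ (A j).region → y = z := by
    intro i j hij z hz hz'
    rcases hAA i j hij with h | ⟨c, -, hc, h⟩
    · exact absurd (h ▸ ⟨hz, hz'⟩ : z ∈ (∅ : Set Pt)) (Set.notMem_empty z)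
    · have e : ∀ y ∈ (A i).region, y ∈ (A j).region → y = c := fun y hy hy' =>
        (h ▸ ⟨hy, hy'⟩ : y ∈ ({c} : Set Pt))
      rw [e z hz hz']
      exact ⟨hc.1, hc.2, e⟩
  have ins : ∀ i j z, z ∈ (B i j).region → z ∈ (A i).region ∧ z ∉ (A i).trace := fun i j z hz =>
    ⟨Or.inr (hBA i j hz), (hBA i j hz).1⟩
  set γ : (Σ i : Fin m, Option (Fin (n i))) → ClosedPath :=
    fun κ => κ.2.elim (A κ.1) (B κ.1) with hγ
  have hmeet : ∀ κ κ' x, κ ≠ κ' → x ∈ (γ κ).trace → x ∈ (γ κ').trace →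
      κ.1 ≠ κ'.1 ∧ κ.2 = none ∧ κ'.2 = none := by
    rintro ⟨i, _ | j⟩ ⟨i', _ | j'⟩ x hne hx hx'
    · exact ⟨fun e => hne (by cases e; rfl), rfl, rfl⟩
    · exfalso
      have h1 := ins i' j' x (tr _ x hx')
      by_cases e : i = i'
      · subst e
        exact h1.2 hx
      · exact h1.2 (hAA' i i' e x (tr _ x hx) h1.1).2.1
    · exfalso
      have h1 := ins i j x (tr _ x hx)
      by_cases e : i = i'
      · subst e
        exact h1.2 hx'
      · exact h1.2 (hAA' i i' e x h1.1 (tr _ x hx')).1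
    · exfalso
      have h1 := ins i j x (tr _ x hx)
      have h2 := ins i' j' x (tr _ x hx')
      by_cases e : i = i'
      · subst e
        exact Set.disjoint_left.1 (hBB i j j' fun e => hne (by rw [e])) (tr _ x hx) (tr _ x hx')
      · exact h1.2 (hAA' i i' e x h1.1 h2.1).1
  have hsum : ∀ k p, ∑ κ with κ.1 = k, (γ κ).rotation p =
      (A k).rotation p + ∑ j, (B k j).rotation p := by
    intro k p
    rw [Finset.sum_filter, Fintype.sum_sigma, Finset.sum_eq_single k]
    · simp [Fintype.sum_option, hγ]
    · intro i _ hik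
      simp [hik]
    · exact fun h => absurd (Finset.mem_univ k) h
  -- Holes lie inside their outer path, so they contribute nothing outside it.
  have hBz : ∀ k p, P.IsGeneric p → (A k).rotation p = 0 → ∀ j, (B k j).rotation p = 0 := by
    intro k p hp h0 j
    by_contra hne
    exact (hBA k j (Or.inr (hp.mem_inside (hB k j).2 hne))).2 h0
  have hAne : ∀ k p, P.IsGeneric p → ∑ κ with κ.1 = k, (γ κ).rotation p ≠ 0 →
      p ∈ (A k).inside := by
    intro k p hp hne
    refine hp.mem_inside (hA k).2 fun h0 => hne ?_
    rw [hsum, h0, Finset.sum_eq_zero fun j _ => hBz k p hp h0 j, add_zero]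
  have D : Decomposition P γ Sigma.fst := by
    refine ⟨?_, ?_, fun p hp => ?_, fun κ κ' x hne hx hx' => ?_, fun k hk => hac k ?_, fun k => ?_,
      fun k l p hp h1 h2 => ?_⟩
    · rintro ⟨i, _ | j⟩
      exacts [(hA i).1, (hB i j).1]
    · rintro ⟨i, _ | j⟩
      exacts [(hA i).2, (hB i j).2]
    · rw [hbd] at hp
      rcases hp with hp | hp
      · obtain ⟨i, hi⟩ := Set.mem_iUnion.1 hp
        exact ⟨⟨i, none⟩, hi⟩
      · obtain ⟨i, hi⟩ := Set.mem_iUnion.1 hp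
        obtain ⟨j, hj⟩ := Set.mem_iUnion.1 hi
        exact ⟨⟨i, some j⟩, hj⟩
    · obtain ⟨h1, h2, h3⟩ := hmeet κ κ' x hne hx hx'
      refine ⟨h1, fun y hy hy' => ?_⟩
      obtain ⟨i, o⟩ := κ
      obtain ⟨i', o'⟩ := κ'
      obtain rfl : o = none := h2
      obtain rfl : o' = none := h3
      exact (hAA' i i' h1 x (tr _ x hx) (tr _ x hx')).2.2 y (tr _ y hy) (tr _ y hy')
    · refine Relation.TransGen.mono (fun a b hab => ?_) k k hk
      obtain ⟨hne, κ, κ', rfl, rfl, c, ⟨i, hi⟩, ⟨i', hi'⟩⟩ := hab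
      have hc : c ∈ (γ κ).trace :=
        Set.mem_iUnion.2 ⟨i, Or.inl (hi ▸ right_mem_segment ℝ _ _)⟩
      have hc' : c ∈ (γ κ').trace :=
        Set.mem_iUnion.2 ⟨i', Or.inl (hi' ▸ left_mem_segment ℝ _ _)⟩
      obtain ⟨-, h2, h3⟩ := hmeet κ κ' c (fun e => hne (by rw [e])) hc hc'
      obtain ⟨j, o⟩ := κ
      obtain ⟨j', o'⟩ := κ'
      obtain rfl : o = none := h2
      obtain rfl : o' = none := h3
      exact ⟨hne, c, ⟨i, hi⟩, ⟨i', hi'⟩⟩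
    · obtain ⟨ε, hε, h⟩ := (hA k).1.exists_sign
      refine ⟨ε, hε, fun p hp => ?_⟩
      rw [hsum]
      rcases h p with h0 | h0
      · rw [h0, Finset.sum_eq_zero fun j _ => hBz k p hp h0 j]
        simp
      -- The holes are disjoint, so at most one surrounds `p`. Whatever its orientation, it cannot
      -- outweigh the outer path, and the total is `0`, `ε` or `2 * ε`.
      · have hb : |∑ j, (B k j).rotation p| ≤ 1 := by
          by_cases hex : ∃ j, (B k j).rotation p ≠ 0
          · obtain ⟨j, hj⟩ := hex
            rw [Finset.sum_eq_single j]
            · obtain ⟨ε', hε', h'⟩ := (hB k j).1.exists_sign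
              rcases h' p with e | e <;> rw [e]
              · simp
              · rcases hε' with rfl | rfl <;> simp
            · intro j' _ hne
              by_contra hj'
              exact Set.disjoint_left.1 (hBB k j' j hne)
                (Or.inr (hp.mem_inside (hB k j').2 hj')) (Or.inr (hp.mem_inside (hB k j).2 hj))
            · exact fun h => absurd (Finset.mem_univ j) h
          · push Not at hex
            rw [Finset.sum_eq_zero fun j _ => hex j]
            simp
        rw [h0]
        obtain ⟨b1, b2⟩ := abs_le.1 hb
        rcases hε with rfl | rfl <;> linarith
    · by_contra hkl
      have h1 := hAne k p hp h1
      exact h1.1 (hAA' k l hkl p (Or.inr h1) (Or.inr (hAne l p hp h2))).1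
  exact D.hasCoherent

end LatticePolytope

end LatticeMatching

/-! ### The three statements combined -/

theorem mainTheorem9 :
    (∀ (m : ℕ) (δ δ' : LatticeMatching.PartialMatching m) (P : LatticeMatching.LatticePolytope),
      P.IsAssociated δ.presentation δ'.presentation →
      Disjoint P.carrier P.mirror.carrier →
      P.Condition1 ∨ P.Condition2 →
      LatticeMatching.presentationF δ.presentation δ'.presentation = P.f) ∧
    (∀ P P' : LatticeMatching.LatticePolytope,
      P.Condition1 ∨ P.Condition2 → P.Equivalent P' → P.f = P'.f) ∧
    (∀ (m₁ m₂ : ℕ) (δ₁ δ₁' : LatticeMatching.PartialMatching m₁)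
      (δ₂ δ₂' : LatticeMatching.PartialMatching m₂) (P₁ P₂ : LatticeMatching.LatticePolytope),
      P₁.IsAssociated δ₁.presentation δ₁'.presentation →
      P₂.IsAssociated δ₂.presentation δ₂'.presentation →
      Disjoint P₁.carrier P₁.mirror.carrier → Disjoint P₂.carrier P₂.mirror.carrier →
      P₁.Condition1 ∨ P₁.Condition2 → P₂.Condition1 ∨ P₂.Condition2 →
      P₁.Equivalent P₂ →
      LatticeMatching.presentationF δ₁.presentation δ₁'.presentation =
        LatticeMatching.presentationF δ₂.presentation δ₂'.presentation) := by
  have key : ∀ P : LatticeMatching.LatticePolytope,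
      P.Condition1 ∨ P.Condition2 → P.HasCoherent :=
    fun P h => h.elim (fun h => h.hasCoherent) (fun h => h.hasCoherent)
  have a : ∀ (m : ℕ) (δ δ' : LatticeMatching.PartialMatching m)
      (P : LatticeMatching.LatticePolytope),
      P.IsAssociated δ.presentation δ'.presentation →
      Disjoint P.carrier P.mirror.carrier →
      P.Condition1 ∨ P.Condition2 →
      LatticeMatching.presentationF δ.presentation δ'.presentation = P.f :=
    fun m δ δ' P hA hd hc => LatticeMatching.LatticePolytope.presentationF_eq_f hA hd (key P hc)
  have b : ∀ P P' : LatticeMatching.LatticePolytope,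
      P.Condition1 ∨ P.Condition2 → P.Equivalent P' → P.f = P'.f :=
    fun P P' hc he => (key P hc).f_eq_of_equivalent he
  exact ⟨a, b, fun m₁ m₂ δ₁ δ₁' δ₂ δ₂' P₁ P₂ h1 h2 d1 d2 c1 c2 he =>
    (a m₁ δ₁ δ₁' P₁ h1 d1 c1).trans ((b P₁ P₂ c1 he).trans (a m₂ δ₂ δ₂' P₂ h2 d2 c2).symm)⟩
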